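/- Let $L=\mathbb Z\wr\mathbb Z/2\mathbb Z=\bigl(\bigoplus_{\mathbb Z}\mathbb Z/2\mathbb Z\bigr)\rtimes\mathbb Z$ be the lamplighter group, let $a$ be the generator of $\mathbb Z$ (acting by the shift $i\mapsto i+1$ of the coordinates), let $\varepsilon$ be the non-trivial element in position $0$, and put $u_i=a^i\varepsilon a^{-i}$ for $i\in\mathbb Z$. Let $g\mapsto\hat g$ be an isomorphism from $L$ onto a second copy $\hat L$ of $L$. For $\mathcal A\subseteq\mathbb Z$, Dyson's group $L(\mathcal A)$ is the amalgamated product of $L$ and $\hat L$ in which $u_i$ is identified with $\hat u_i$ for every $i\in\mathcal A$. A group is *recursively presented* (re) if it has a presentation with finitely many generators and a recursively enumerable set of relators; a finitely generated group is *co-re* if the words in its generators that represent a non-trivial element form a recursively enumerable set, and it has *solvable word problem* if the words that represent the identity form a recursive set. A group $G$ with a finite generating family $S$ has *computable finite quotients* (CFQ) if there is an algorithm that, given a finite presentation of a finite group $F$ and a function $f:S\to F$ (given by words in the generators of $F$), decides whether $f$ extends to a group morphism $G\to F$; a finitely generated group has CFQ if it has CFQ for some finite generating family. The *finitary image* of a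 group is its quotient by the intersection of all its subgroups of finite index. The *profinite topology* $\mathcal{PT}(\mathbb Z)$ on $\mathbb Z$ has as a basis the sets $n+p\mathbb Z$ with $n,p\in\mathbb Z$, $p\neq 0$. For $n\ge 1$ let $\mathcal A \bmod n$ be the set of those $r\in\{0,\dots,n-1\}$ for which there is $x\in\mathcal A$ with $x\equiv r \pmod n$. **Proposition.** Let $\mathcal A$ be a subset of $\mathbb Z$. 1. $L(\mathcal A)$ is recursively presented if and only if $\mathcal A$ is recursively enumerable; $L(\mathcal A)$ is co-re if and only if $\mathbb Z\setminus\mathcal A$ is recursively enumerable; $L(\mathcal A)$ has solvable word problem if and only if $\mathcal A$ is recursive. 2. $L(\mathcal A)$ is residually finite if and only if $\mathcal A$ is closed in $\mathcal{PT}(\mathbb Z)$. More precisely, if $\overline{\mathcal A}$ denotes the closure of $\mathcal A$ in $\mathcal{PT}(\mathbb Z)$, the finitary image of $L(\mathcal A)$ is $L(\overline{\mathcal A})$: there is an isomorphism from the finitary image of $L(\mathcal A)$ onto $L(\overline{\mathcal A})$ that is compatible with the maps of $L$ and of $\hat L$ into the two groups. 3. $L(\mathcal A)$ has CFQ if and only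 if the function $n\mapsto\mathcal A \bmod n$ is computable. -/

import Mathlib

namespace Dyson

/-! ### Algorithmic properties of finitely generated groups -/

section Algorithms

/-- A word over an alphabet `α` and its formal inverses: the letter `(i, true)` stands for `i`,
the letter `(i, false)` for its inverse. -/
abbrev Word (α : Type*) := List (α × Bool)

/-- The tuple `S` generates the group `G`. -/
def Generates {G : Type*} [Group G] {n : ℕ} (S : Fin n → G) : Prop :=
  Subgroup.closure (Set.range S) = ⊤

/-- The element of `G` represented by a word in the letters `S` and their inverses. -/
def wordValue {G : Type*} [Group G] {n : ℕ} (S : Fin n → G) (w : Word (Fin n)) : G :=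
  FreeGroup.lift S (FreeGroup.mk w)

/-- `G` is recursively presented (re): it has a presentation with finitely many generators and a
recursively enumerable set of relators. -/
def IsRecursivelyPresented (G : Type*) [Group G] : Prop :=
  ∃ (n : ℕ) (R : Set (Word (Fin n))), REPred (fun w => w ∈ R) ∧
    Nonempty (PresentedGroup (FreeGroup.mk '' R) ≃* G)

/-- `G` is co-re: it is finitely generated and the words in its generators that represent a
nontrivial element can be recursively enumerated. -/
def IsCoRE (G : Type*) [Group G] : Prop :=
  ∃ (n : ℕ) (S : Fin n → G), Generates S ∧ REPred (fun w => wordValue S w ≠ 1)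

/-- `G` has solvable word problem: it is finitely generated and there is an algorithm that decides
which words in its generators represent the identity. -/
def HasSolvableWordProblem (G : Type*) [Group G] : Prop :=
  ∃ (n : ℕ) (S : Fin n → G), Generates S ∧ ComputablePred (fun w => wordValue S w = 1)

/-- The group given by the finite presentation with generators `0, …, k - 1` and the relators in
the list `R`. -/
abbrev FinPresGroup (k : ℕ) (R : List (Word (Fin k))) :=
  PresentedGroup {x : FreeGroup (Fin k) | ∃ r ∈ R, x = FreeGroup.mk r}

/-- The element of a finitely presented group represented by a word. -/
def FinPresGroup.ofWord {k : ℕ} (R : List (Word (Fin k))) (w : Word (Fin k)) :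
    FinPresGroup k R :=
  PresentedGroup.mk _ (FreeGroup.mk w)

/-- The function `f : S → F` extends to a group morphism `G → F`. -/
def ExtendsToHom {G F : Type*} [Group G] [Group F] {n : ℕ} (S : Fin n → G) (f : Fin n → F) :
    Prop :=
  ∃ φ : G →* F, ∀ s, φ (S s) = f s

/-- A word in the letters `0, …, k - 1`, written down as a word in natural numbers, so that
presentations with different numbers of generators can be inputs of one algorithm. -/
def rawWord {k : ℕ} (w : Word (Fin k)) : Word ℕ :=
  w.map fun l => (l.1.val, l.2)

/-- `G` has computable finite quotients (CFQ): it has a finite generating family `S` for which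
there is an algorithm that, given a pair `(F, f)`, where `F` is a finite group given by a finite
presentation (number of generators and list of relators) and `f` is a function from `S` to `F`
(given by words in the generators of `F`), halts and determines whether `f` extends to a group
morphism `G → F`. Nothing is required of the algorithm on inputs that are not of this form. -/
def HasCFQ (G : Type*) [Group G] : Prop :=
  ∃ (n : ℕ) (S : Fin n → G), Generates S ∧
    ∃ alg : ℕ × List (Word ℕ) × List (Word ℕ) →. Bool, Partrec alg ∧
      ∀ (k : ℕ) (R : List (Word (Fin k))) (f : Fin n → Word (Fin k)),
        Finite (FinPresGroup k R) →
        ∃ b ∈ alg (k, R.map rawWord, (List.ofFn f).map rawWord),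
          (b = true ↔ ExtendsToHom S fun s => FinPresGroup.ofWord R (f s))

end Algorithms

/-! ### The finitary image of a group -/

section Finitary

/-- The finite residual of `G`: the intersection of all subgroups of finite index. -/
def finiteResidual (G : Type*) [Group G] : Subgroup G :=
  sInf {H : Subgroup G | H.FiniteIndex}

instance finiteResidual_normal (G : Type*) [Group G] : (finiteResidual G).Normal where
  conj_mem x hx g := by
    rw [finiteResidual, Subgroup.mem_sInf] at hx ⊢
    intro H hH
    have hH' : H.FiniteIndex := hH
    have h : (H.comap (MulAut.conj g).toMonoidHom).FiniteIndex :=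
      ⟨by
        rw [Subgroup.index_comap_of_surjective H (MulAut.conj g).surjective]
        exact hH'.index_ne_zero⟩
    exact hx _ h

/-- The finitary image of `G`: its quotient by the finite residual. -/
abbrev FinitaryImage (G : Type*) [Group G] := G ⧸ finiteResidual G

end Finitary

/-! ### The lamplighter group and Dyson's groups -/

section Groups

/-- The direct sum of copies of `ℤ/2ℤ` indexed by `ℤ`, written multiplicatively. -/
abbrev LampBase := Multiplicative (ℤ →₀ ZMod 2)

/-- The automorphism of the base group that moves the coordinate `i` to the position `i + n`. -/
noncomputable def shift (n : ℤ) : MulAut LampBase :=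
  AddEquiv.toMultiplicative (Finsupp.domCongr (Equiv.addRight n))

/-- The action of `ℤ` on the base group by shifts. -/
noncomputable def shiftHom : Multiplicative ℤ →* MulAut LampBase where
  toFun n := shift n.toAdd
  map_one' := by
    ext x i
    change (Multiplicative.toAdd x) (i - 0) = (Multiplicative.toAdd x) i
    rw [sub_zero]
  map_mul' m n := by
    ext x i
    change (Multiplicative.toAdd x) (i - (m.toAdd + n.toAdd)) =
      (Multiplicative.toAdd x) (i - m.toAdd - n.toAdd)
    rw [sub_sub]

/-- The lamplighter group: the (restricted) wreath product of `ℤ` and of the group of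
order two. -/
abbrev Lamplighter := LampBase ⋊[shiftHom] Multiplicative ℤ

/-- The generator `a` of the lamplighter group (a generator of `ℤ`). -/
noncomputable def lampA : Lamplighter :=
  SemidirectProduct.inr (Multiplicative.ofAdd 1)

/-- The generator `ε` of the lamplighter group (the nontrivial element in position `0`). -/
noncomputable def lampEps : Lamplighter :=
  SemidirectProduct.inl (Multiplicative.ofAdd (Finsupp.single 0 1))

/-- The element `u i = a ^ i * ε * a ^ (-i)`. -/
noncomputable def lampU (i : ℤ) : Lamplighter := lampA ^ i * lampEps * lampA ^ (-i)

/-- The subgroup of the lamplighter group generated by the `u i`, for `i` in `A`. -/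
noncomputable def lampSubgroup (A : Set ℤ) : Subgroup Lamplighter := Subgroup.closure (lampU '' A)

/-- Dyson's group `L(A)`: the amalgamated product of two copies of the lamplighter group, in which
the two copies of `u i` are identified for each `i` in `A`. -/
abbrev DysonGroup (A : Set ℤ) :=
  Monoid.PushoutI (fun _ : Fin 2 => (lampSubgroup A).subtype)

/-- The inclusion of the first (`c = 0`) or of the second (`c = 1`) copy of the lamplighter group
into `L(A)`. -/
noncomputable def DysonGroup.incl (A : Set ℤ) (c : Fin 2) : Lamplighter →* DysonGroup A :=
  Monoid.PushoutI.of (φ := fun _ : Fin 2 => (lampSubgroup A).subtype) c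

end Groups

/-! ### Sets of integers -/

section Integers

/-- The profinite topology on `ℤ`, generated by the residue classes `n + p ℤ` with `p ≠ 0`. -/
@[reducible] def profiniteTopology : TopologicalSpace ℤ :=
  TopologicalSpace.generateFrom {U | ∃ n p : ℤ, p ≠ 0 ∧ U = {x | x ≡ n [ZMOD p]}}

/-- The closure of a set of integers in the profinite topology. -/
def profiniteClosure (A : Set ℤ) : Set ℤ := @closure ℤ profiniteTopology A

open Classical in
/-- The finite set `A mod n` of those `r` in `{0, …, n - 1}` that are congruent to an element
of `A` modulo `n`. -/
noncomputable def residues (A : Set ℤ) (n : ℕ) : Finset ℕ :=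
  (Finset.range n).filter fun r => ∃ a ∈ A, a ≡ (r : ℤ) [ZMOD (n : ℤ)]

end Integers

end Dyson

namespace Dyson

/-! ### Primitive recursive arithmetic of the integers -/

section IntPrimrec

variable {α : Type*} [Primcodable α]

/-! Everything rests on a concrete model of a double $G *_H G$: the semidirect product of the free
group on letters $t_{xH}$, one for each coset, with $G$. The second copy of $G$ is the first one
conjugated by $t_H^{-1}$. An element of $G$ has the same image in both copies exactly when it lies
in $H$, and the map from the double is injective (`doubleEmbedding_injective`). For the lamplighter
group and the subgroup generated by the $u_i$ with $i \in A$, this shows that $u_i = \hat u_i$ if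
and only if $i \in A$ (`incl_lampU_eq_iff`).

Word problem. The words $u_i \hat u_i^{-1}$ reduce membership in $A$ to the word problem, for every
generating family. Conversely, the model can be computed: a word becomes a word in coset letters
together with an element of the lamplighter group. Only the equalities between the cosets that occur
matter, and they amount to finitely many questions about $A$ (`trivialTest_iff`). Since a larger $A$
gives a quotient (`wordValue_eq_one_mono`), an enumeration of $A$ yields one of the trivial words,
and an enumeration of the complement yields one of the nontrivial words.

Finite quotients. In a finite group $a$ and $\hat a$ have finite order, so $u_i = \hat u_i$ depends
only on a residue of $i$; every finite quotient of $L(A)$ therefore factors through $L(\overline A)$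
(`ker_dysonMap_le`). If $A$ is closed, the amalgamated subgroup is an intersection of subgroups of
finite index (`exists_separating_subgroup`). Finitely many cosets then stay distinct in a finite
quotient of the lamplighter group, and a nontrivial element of the double survives in a semidirect
product of a free group and a finite group (`residuallyFinite_double`).

CFQ. Once $a^N = \hat a^N = 1$, the relations of $L(A)$ become a finite list determined by $A \bmod
N$ (`relWords_iff`). For a finite group $F$ one searches at the same time for a derivation of these
relations from the presentation and for a permutation representation in which one of them fails.
Conversely, the permutations `testPerm n r` satisfy the relations of $L(A)$ exactly when $r \notin A
\bmod n$. A finite presentation of the group that they generate is computable, so an algorithm for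
finite quotients recovers $A \bmod n$ (`notMem_residues_iff`). -/

theorem encode_int_ofNat (n : ℕ) : Encodable.encode (Int.ofNat n) = 2 * n := rfl

theorem encode_int_negSucc (n : ℕ) : Encodable.encode (Int.negSucc n) = 2 * n + 1 := rfl

theorem primrec_int_toNat : Primrec Int.toNat := by
  have h : Primrec fun z : ℤ =>
      if (Encodable.encode z).bodd = true then 0 else (Encodable.encode z).div2 :=
    Primrec.ite
      (Primrec.eq.comp (Primrec.nat_bodd.comp Primrec.encode) (Primrec.const true))
      (Primrec.const 0) (Primrec.nat_div2.comp Primrec.encode)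
  refine h.of_eq fun z => ?_
  rcases z with n | n
  · rw [encode_int_ofNat]
    simp [Nat.div2_val]
  · rw [encode_int_negSucc]
    simp

theorem primrec_int_natAbs : Primrec Int.natAbs := by
  have h : Primrec fun z : ℤ =>
      if (Encodable.encode z).bodd = true then (Encodable.encode z).div2 + 1
        else (Encodable.encode z).div2 :=
    Primrec.ite
      (Primrec.eq.comp (Primrec.nat_bodd.comp Primrec.encode) (Primrec.const true))
      (Primrec.succ.comp (Primrec.nat_div2.comp Primrec.encode))
      (Primrec.nat_div2.comp Primrec.encode)
  refine h.of_eq fun z => ?_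
  rcases z with n | n
  · rw [encode_int_ofNat]
    simp [Nat.div2_val]
  · rw [encode_int_negSucc]
    simp [Nat.div2_val]

theorem primrec_int_ofNat : Primrec (fun n : ℕ => (n : ℤ)) := by
  refine Primrec.encode_iff.1 ((Primrec.nat_mul.comp (Primrec.const 2) Primrec.id).of_eq fun n => ?_)
  rfl

theorem primrec_int_subNat : Primrec₂ (fun m n : ℕ => (m : ℤ) - n) := by
  refine Primrec.encode_iff.1 ?_
  have h : Primrec fun p : ℕ × ℕ =>
      if p.2 ≤ p.1 then 2 * (p.1 - p.2) else 2 * (p.2 - p.1 - 1) + 1 :=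
    Primrec.ite (Primrec.nat_le.comp Primrec.snd Primrec.fst)
      (Primrec.nat_mul.comp (Primrec.const 2) Primrec.nat_sub)
      (Primrec.succ.comp (Primrec.nat_mul.comp (Primrec.const 2)
        (Primrec.nat_sub.comp (Primrec.nat_sub.comp Primrec.snd Primrec.fst) (Primrec.const 1))))
  refine h.of_eq fun p => ?_
  split_ifs with hp
  · have : (p.1 : ℤ) - p.2 = Int.ofNat (p.1 - p.2) := by simp; omega
    exact (congrArg Encodable.encode this).symm
  · have : (p.1 : ℤ) - p.2 = Int.negSucc (p.2 - p.1 - 1) := by rw [Int.negSucc_eq]; omega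
    exact (congrArg Encodable.encode this).symm

theorem primrec_int_neg : Primrec (fun z : ℤ => -z) := by
  -- This truncated difference is the negative part of `z`.
  have hn : Primrec fun z : ℤ => z.natAbs - z.toNat :=
    Primrec.nat_sub.comp primrec_int_natAbs primrec_int_toNat
  refine (primrec_int_subNat.comp hn primrec_int_toNat).of_eq fun z => ?_
  omega

theorem primrec_int_add : Primrec₂ (fun a b : ℤ => a + b) := by
  have hp := primrec_int_toNat
  have hn : Primrec fun z : ℤ => (-z).toNat := primrec_int_toNat.comp primrec_int_neg
  refine (primrec_int_subNat.comp
    (Primrec.nat_add.comp (hp.comp Primrec.fst) (hp.comp Primrec.snd))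
    (Primrec.nat_add.comp (hn.comp Primrec.fst) (hn.comp Primrec.snd))).of_eq fun z => ?_
  push_cast
  omega

theorem primrec_int_sub : Primrec₂ (fun a b : ℤ => a - b) :=
  (primrec_int_add.comp Primrec.fst (primrec_int_neg.comp Primrec.snd)).of_eq
    fun p => (sub_eq_add_neg p.1 p.2).symm

end IntPrimrec

/-! ### Closure properties of recursively enumerable predicates -/

section RE

variable {α β : Type*} [Primcodable α] [Primcodable β]

theorem rePred_of_exists_nat {q : α → ℕ → Bool} (hq : Computable₂ q) :
    REPred fun a => ∃ n, q a n = true := by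
  have h : Partrec fun a => Nat.rfind fun n => (q a n : Part Bool) :=
    Partrec.rfind hq.partrec₂
  refine h.dom_re.of_eq fun a => ?_
  refine Nat.rfind_dom'.trans ?_
  constructor
  · rintro ⟨n, hn, -⟩
    exact ⟨n, by simpa using hn⟩
  · rintro ⟨n, hn⟩
    exact ⟨n, by simpa using hn, fun _ => trivial⟩

/-- A recursively enumerable predicate is a union of an increasing computable sequence of
primitive recursive predicates. -/
theorem exists_stages {p : α → Prop} (hp : REPred p) :
    ∃ q : α → ℕ → Bool, Primrec₂ q ∧ (∀ a, p a ↔ ∃ n, q a n = true) ∧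
      ∀ a m n, m ≤ n → q a m = true → q a n = true := by
  obtain ⟨c, hc⟩ := Nat.Partrec.Code.exists_code.1 hp
  refine ⟨fun a n => (Nat.Partrec.Code.evaln n c (Encodable.encode a)).isSome, ?_, ?_, ?_⟩
  · exact Primrec.option_isSome.comp (Nat.Partrec.Code.primrec_evaln.comp
      (Primrec.pair (Primrec.pair Primrec.snd (Primrec.const c))
        (Primrec.encode.comp Primrec.fst)))
  · intro a
    have h1 : p a ↔ ∃ x, x ∈ Nat.Partrec.Code.eval c (Encodable.encode a) := by
      rw [hc]
      simp
    rw [h1]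
    constructor
    · rintro ⟨x, hx⟩
      obtain ⟨k, hk⟩ := Nat.Partrec.Code.evaln_complete.1 hx
      exact ⟨k, Option.isSome_iff_exists.2 ⟨x, hk⟩⟩
    · rintro ⟨k, hk⟩
      obtain ⟨x, hx⟩ := Option.isSome_iff_exists.1 hk
      exact ⟨x, Nat.Partrec.Code.evaln_sound hx⟩
  · intro a m n hmn h
    obtain ⟨x, hx⟩ := Option.isSome_iff_exists.1 h
    exact Option.isSome_iff_exists.2 ⟨x, Nat.Partrec.Code.evaln_mono hmn hx⟩

theorem rePred_comp {p : β → Prop} (hp : REPred p) {f : α → β} (hf : Computable f) :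
    REPred fun a => p (f a) :=
  Partrec.comp hp hf

/-- Dovetailing: a single search runs over coded pairs of a witness and a stage of its enumeration.
-/
theorem rePred_exists {p : α → β → Prop} (hp : REPred fun x : α × β => p x.1 x.2) :
    REPred fun a => ∃ b, p a b := by
  obtain ⟨q, hq, h, -⟩ := exists_stages hp
  have hq' : Primrec₂ fun (a : α) (n : ℕ) =>
      ((Encodable.decode (α := β) n.unpair.1).map fun b => q (a, b) n.unpair.2).getD false := by
    refine Primrec.option_getD.comp (Primrec.option_map
      (Primrec.decode.comp (Primrec.fst.comp (Primrec.unpair.comp Primrec.snd))) ?_)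
      (Primrec.const false)
    exact hq.comp (Primrec.pair (Primrec.fst.comp Primrec.fst) Primrec.snd)
      (Primrec.snd.comp (Primrec.unpair.comp (Primrec.snd.comp Primrec.fst)))
  refine (rePred_of_exists_nat hq'.to_comp).of_eq fun a => ?_
  constructor
  · rintro ⟨n, hn⟩
    cases hd : Encodable.decode (α := β) n.unpair.1 with
    | none => simp [hd] at hn
    | some b =>
      refine ⟨b, (h (a, b)).2 ⟨n.unpair.2, ?_⟩⟩
      simpa [hd] using hn
  · rintro ⟨b, hb⟩
    obtain ⟨n, hn⟩ := (h (a, b)).1 hb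
    exact ⟨Nat.pair (Encodable.encode b) n, by simpa using hn⟩

theorem rePred_and {p r : α → Prop} (hp : REPred p) (hr : REPred r) :
    REPred fun a => p a ∧ r a := by
  obtain ⟨q, hq, h, hm⟩ := exists_stages hp
  obtain ⟨q', hq', h', hm'⟩ := exists_stages hr
  have hc : Primrec₂ fun (a : α) (n : ℕ) => q a n && q' a n :=
    Primrec.and.comp hq hq'
  refine (rePred_of_exists_nat hc.to_comp).of_eq fun a => ?_
  rw [h, h']
  constructor
  · rintro ⟨n, hn⟩
    rw [Bool.and_eq_true] at hn
    exact ⟨⟨n, hn.1⟩, ⟨n, hn.2⟩⟩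
  · rintro ⟨⟨m, hm1⟩, ⟨n, hn1⟩⟩
    refine ⟨max m n, ?_⟩
    rw [Bool.and_eq_true]
    exact ⟨hm _ _ _ (le_max_left _ _) hm1, hm' _ _ _ (le_max_right _ _) hn1⟩

theorem rePred_or {p r : α → Prop} (hp : REPred p) (hr : REPred r) :
    REPred fun a => p a ∨ r a := by
  obtain ⟨q, hq, h, -⟩ := exists_stages hp
  obtain ⟨q', hq', h', -⟩ := exists_stages hr
  have hc : Primrec₂ fun (a : α) (n : ℕ) => q a n || q' a n :=
    Primrec.or.comp hq hq'
  refine (rePred_of_exists_nat hc.to_comp).of_eq fun a => ?_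
  rw [h, h']
  simp only [Bool.or_eq_true, exists_or]

theorem rePred_forall_mem {p : α → Prop} (hp : REPred p) :
    REPred fun l : List α => ∀ a ∈ l, p a := by
  obtain ⟨q, hq, h, hm⟩ := exists_stages hp
  have hc : PrimrecRel fun (l : List α) (n : ℕ) => ∀ a ∈ l, q a n = true :=
    PrimrecRel.forall_mem_list (Primrec.eq.comp hq (Primrec.const true))
  refine (rePred_of_exists_nat hc.decide.to_comp).of_eq fun l => ?_
  simp only [decide_eq_true_eq]
  constructor
  · rintro ⟨n, hn⟩ a ha
    exact (h a).2 ⟨n, hn a ha⟩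
  · intro hl
    choose! f hf using fun a (ha : a ∈ l) => (h a).1 (hl a ha)
    -- The sum bounds the stages of all entries of the list, and later stages accept more.
    refine ⟨(l.map f).sum, fun a ha => hm a _ _ ?_ (hf a ha)⟩
    exact List.single_le_sum (by simp) _ (List.mem_map_of_mem ha)

theorem rePred_of_primrecPred {p : α → Prop} (hp : PrimrecPred p) : REPred p :=
  hp.computablePred.to_re

theorem computablePred_comp {p : β → Prop} (hp : ComputablePred p) {f : α → β}
    (hf : Computable f) : ComputablePred fun a => p (f a) := by
  classical
  exact (hp.decide.comp hf).computablePred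

/-- Two disjoint recursively enumerable predicates can be told apart by an algorithm. -/
theorem exists_separating_algorithm {p r : α → Prop} (hp : REPred p) (hr : REPred r) :
    ∃ alg : α →. Bool, Partrec alg ∧
      ∀ a, ¬(p a ∧ r a) → (p a ∨ r a) → ∃ b ∈ alg a, (b = true ↔ p a) := by
  -- The two semi-decision procedures run in parallel, the first answering `true` and the second
  -- `false`.
  obtain ⟨k, hk, H⟩ := Partrec.merge' (hp.map (Computable.const true).to₂)
    (hr.map (Computable.const false).to₂)
  refine ⟨k, hk, fun a hn hor => ?_⟩
  have hd : (k a).Dom := by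
    rw [(H a).2]
    simpa [Part.assert] using hor
  refine ⟨(k a).get hd, Part.get_mem hd, ?_⟩
  have h := (H a).1 _ (Part.get_mem hd)
  simp only [Part.mem_map_iff, Part.mem_assert_iff, Part.mem_some_iff, exists_prop, and_true,
    exists_const] at h
  rcases h with ⟨h1, h2⟩ | ⟨h1, h2⟩
  · simp [← h2, h1]
  · simp only [← h2, Bool.false_eq_true, false_iff]
    exact fun h => hn ⟨h, h1⟩

end RE

/-! ### Words, and the consequences of a finite list of relators -/

section Words

theorem exists_list_of_mem_subgroupClosure {G : Type*} [Group G] {s : Set G} {x : G}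
    (hx : x ∈ Subgroup.closure s) : ∃ L : List G, (∀ y ∈ L, y ∈ s ∨ y⁻¹ ∈ s) ∧ L.prod = x := by
  rw [← Subgroup.mem_toSubmonoid, Subgroup.closure_toSubmonoid] at hx
  exact Submonoid.exists_list_of_mem_closure hx

variable {α : Type*}

theorem mk_eq_one_iff [DecidableEq α] (w : Word α) :
    FreeGroup.mk w = 1 ↔ FreeGroup.reduce w = [] := by
  rw [← FreeGroup.toWord_mk, FreeGroup.toWord_eq_nil_iff]

/-- The product of the conjugates of relators from `l` that are listed in a certificate. -/
def conjugateProduct (l : List (Word α)) (c : List (Word α × ℕ × Bool)) : Word α :=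
  c.flatMap fun x => x.1 ++
    ((if x.2.2 = true then l.getD x.2.1 [] else FreeGroup.invRev (l.getD x.2.1 [])) ++
      FreeGroup.invRev x.1)

/-- An index out of range selects the empty word, which is harmless. Every certificate is therefore
valid and none has to be checked for well-formedness. -/
theorem mk_conjugateProduct_mem (l : List (Word α)) (c : List (Word α × ℕ × Bool)) :
    FreeGroup.mk (conjugateProduct l c) ∈
      Subgroup.normalClosure {x : FreeGroup α | ∃ r ∈ l, x = FreeGroup.mk r} := by
  set N := Subgroup.normalClosure {x : FreeGroup α | ∃ r ∈ l, x = FreeGroup.mk r}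
  induction c with
  | nil => exact N.one_mem
  | cons x c ih =>
    have h : FreeGroup.mk (l.getD x.2.1 []) ∈ N := by
      rw [List.getD_eq_getElem?_getD]
      cases hx : l[x.2.1]? with
      | none => exact N.one_mem
      | some r => exact Subgroup.subset_normalClosure ⟨r, List.mem_of_getElem? hx, rfl⟩
    have h2 : FreeGroup.mk (if x.2.2 = true then l.getD x.2.1 []
        else FreeGroup.invRev (l.getD x.2.1 [])) ∈ N := by
      split_ifs
      · exact h
      · rw [← FreeGroup.inv_mk]
        exact N.inv_mem h
    rw [conjugateProduct, List.flatMap_cons, ← FreeGroup.mul_mk, ← FreeGroup.mul_mk,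
      ← FreeGroup.mul_mk, ← FreeGroup.inv_mk, ← mul_assoc]
    exact N.mul_mem (Subgroup.normalClosure_normal.conj_mem _ h2 _) ih

theorem exists_conjugateProduct (l : List (Word α)) {x : FreeGroup α}
    (hx : x ∈ Subgroup.normalClosure {x : FreeGroup α | ∃ r ∈ l, x = FreeGroup.mk r}) :
    ∃ c, x = FreeGroup.mk (conjugateProduct l c) := by
  obtain ⟨L, hL, rfl⟩ := exists_list_of_mem_subgroupClosure hx
  clear hx
  have key : ∀ y ∈ Group.conjugatesOfSet {x : FreeGroup α | ∃ r ∈ l, x = FreeGroup.mk r},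
      ∃ (g : Word α) (i : ℕ),
        y = FreeGroup.mk g * FreeGroup.mk (l.getD i []) * (FreeGroup.mk g)⁻¹ := by
    intro y hy
    obtain ⟨_, ⟨r, hr, rfl⟩, hc⟩ := Group.mem_conjugatesOfSet_iff.1 hy
    obtain ⟨g, rfl⟩ := isConj_iff.1 hc
    obtain ⟨i, hi, rfl⟩ := List.getElem_of_mem hr
    refine ⟨Quot.out g, i, ?_⟩
    have hg : FreeGroup.mk (Quot.out g) = g := Quot.out_eq g
    rw [hg, List.getD_eq_getElem _ _ hi]
  induction L with
  | nil => exact ⟨[], rfl⟩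
  | cons y L ih =>
    obtain ⟨c, hc⟩ := ih fun z hz => hL z (List.mem_cons_of_mem _ hz)
    rw [List.prod_cons, hc]
    rcases hL y List.mem_cons_self with h | h
    · obtain ⟨g, i, rfl⟩ := key _ h
      refine ⟨(g, i, true) :: c, ?_⟩
      simp [conjugateProduct, ← FreeGroup.mul_mk, ← FreeGroup.inv_mk, mul_assoc]
    · obtain ⟨g, i, h⟩ := key _ h
      refine ⟨(g, i, false) :: c, ?_⟩
      rw [inv_eq_iff_eq_inv] at h
      simp [h, conjugateProduct, ← FreeGroup.mul_mk, ← FreeGroup.inv_mk, mul_assoc]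

variable [Primcodable α]

theorem primrec_reduce [DecidableEq α] : Primrec (FreeGroup.reduce : Word α → Word α) := by
  have hstep : Primrec₂ fun (_ : Word α) (p : (α × Bool) × Word α × Word α) =>
      (List.casesOn p.2.2 [p.1] fun y t => if p.1.1 = y.1 ∧ p.1.2 = !y.2 then t else p.1 :: y :: t :
        Word α) := by
    refine Primrec.list_casesOn (f := fun x : Word α × ((α × Bool) × Word α × Word α) => x.2.2.2)
      (g := fun x => [x.2.1])
      (h := fun x y => if x.2.1.1 = y.1.1 ∧ x.2.1.2 = !y.1.2 then y.2 else x.2.1 :: y.1 :: y.2)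
      (Primrec.snd.comp (Primrec.snd.comp Primrec.snd))
      (Primrec.list_cons.comp (Primrec.fst.comp Primrec.snd) (Primrec.const [])) ?_
    have hx : Primrec fun z : (Word α × ((α × Bool) × Word α × Word α)) × ((α × Bool) × Word α) =>
        z.1.2.1 := Primrec.fst.comp (Primrec.snd.comp Primrec.fst)
    have hy : Primrec fun z : (Word α × ((α × Bool) × Word α × Word α)) × ((α × Bool) × Word α) =>
        z.2.1 := Primrec.fst.comp Primrec.snd
    have ht : Primrec fun z : (Word α × ((α × Bool) × Word α × Word α)) × ((α × Bool) × Word α) =>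
        z.2.2 := Primrec.snd.comp Primrec.snd
    exact Primrec.ite
      (PrimrecPred.and (Primrec.eq.comp (Primrec.fst.comp hx) (Primrec.fst.comp hy))
        (Primrec.eq.comp (Primrec.snd.comp hx) (Primrec.not.comp (Primrec.snd.comp hy))))
      ht (Primrec.list_cons.comp hx (Primrec.list_cons.comp hy ht))
  refine (Primrec.list_rec (f := fun w : Word α => w) (g := fun _ => ([] : Word α))
    Primrec.id (Primrec.const []) hstep).of_eq fun w => ?_
  rfl

theorem primrec_mk_eq_one [DecidableEq α] : PrimrecPred fun w : Word α => FreeGroup.mk w = 1 :=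
  (Primrec.eq.comp primrec_reduce (Primrec.const [])).of_eq fun w => (mk_eq_one_iff w).symm

theorem primrec_mk_eq [DecidableEq α] :
    PrimrecRel fun v w : Word α => FreeGroup.mk v = FreeGroup.mk w := by
  refine (Primrec.eq.comp (primrec_reduce.comp Primrec.fst)
    (primrec_reduce.comp Primrec.snd) : PrimrecPred fun p : Word α × Word α => _).of_eq fun p => ?_
  exact ⟨FreeGroup.reduce.exact, FreeGroup.reduce.sound⟩

theorem primrec_invRev : Primrec (FreeGroup.invRev : Word α → Word α) :=
  Primrec.list_reverse.comp (Primrec.list_map Primrec.id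
    (Primrec.pair (Primrec.fst.comp Primrec.snd)
      (Primrec.not.comp (Primrec.snd.comp Primrec.snd))))

theorem primrec_conjugateProduct : Primrec₂ (conjugateProduct (α := α)) := by
  refine Primrec.list_flatMap Primrec.snd ?_
  have hg : Primrec fun z : (List (Word α) × List (Word α × ℕ × Bool)) × (Word α × ℕ × Bool) =>
      z.1.1.getD z.2.2.1 [] :=
    (Primrec.list_getD ([] : Word α)).comp (Primrec.fst.comp Primrec.fst)
      (Primrec.fst.comp (Primrec.snd.comp Primrec.snd))
  exact Primrec.list_append.comp (Primrec.fst.comp Primrec.snd)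
    (Primrec.list_append.comp
      (Primrec.ite (Primrec.eq.comp (Primrec.snd.comp (Primrec.snd.comp Primrec.snd))
        (Primrec.const true)) hg (primrec_invRev.comp hg))
      (primrec_invRev.comp (Primrec.fst.comp Primrec.snd)))

/-- The consequences of a finite list of relators can be enumerated, uniformly in the list. -/
theorem rePred_mem_normalClosure [DecidableEq α] :
    REPred fun p : List (Word α) × Word α => FreeGroup.mk p.2 ∈
      Subgroup.normalClosure {x : FreeGroup α | ∃ r ∈ p.1, x = FreeGroup.mk r} := by
  have h : REPred fun p : List (Word α) × Word α =>
      ∃ c, FreeGroup.mk p.2 = FreeGroup.mk (conjugateProduct p.1 c) :=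
    rePred_exists (rePred_of_primrecPred (primrec_mk_eq.comp (Primrec.snd.comp Primrec.fst)
      (primrec_conjugateProduct.comp (Primrec.fst.comp Primrec.fst) Primrec.snd)))
  refine h.of_eq fun p => ⟨?_, exists_conjugateProduct p.1⟩
  rintro ⟨c, hc⟩
  rw [hc]
  exact mk_conjugateProduct_mem p.1 c

end Words

/-! ### Values of words; recursive presentations and enumeration of trivial words -/

section WordValue

variable {G : Type*} [Group G] {n : ℕ} (S : Fin n → G)

theorem wordValue_nil : wordValue S [] = 1 := rfl

theorem wordValue_append (v w : Word (Fin n)) :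
    wordValue S (v ++ w) = wordValue S v * wordValue S w := by
  rw [wordValue, ← FreeGroup.mul_mk, map_mul]
  rfl

theorem wordValue_invRev (w : Word (Fin n)) :
    wordValue S (FreeGroup.invRev w) = (wordValue S w)⁻¹ := by
  rw [wordValue, ← FreeGroup.inv_mk, map_inv]
  rfl

theorem wordValue_singleton (i : Fin n) : wordValue S [(i, true)] = S i := by
  simp [wordValue]

theorem exists_wordValue_eq (hS : Generates S) (g : G) : ∃ w, wordValue S w = g := by
  have h : g ∈ (FreeGroup.lift S).range := by
    rw [FreeGroup.range_lift_eq_closure, hS]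
    trivial
  obtain ⟨x, rfl⟩ := h
  exact ⟨x.toWord, by rw [wordValue, FreeGroup.mk_toWord]⟩

theorem map_wordValue {H : Type*} [Group H] (φ : G →* H) (w : Word (Fin n)) :
    φ (wordValue S w) = wordValue (fun i => φ (S i)) w := by
  have h : φ.comp (FreeGroup.lift S) = FreeGroup.lift fun i => φ (S i) := by
    ext; simp
  exact DFunLike.congr_fun h _

/-- The word obtained from a word in `m` letters by replacing each letter by a word. -/
def substWord {m n : ℕ} (W : Fin m → Word (Fin n)) (w : Word (Fin m)) : Word (Fin n) :=
  w.flatMap fun l => if l.2 = true then W l.1 else FreeGroup.invRev (W l.1)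

theorem wordValue_substWord {m : ℕ} (W : Fin m → Word (Fin n)) (w : Word (Fin m)) :
    wordValue S (substWord W w) = wordValue (fun i => wordValue S (W i)) w := by
  induction w with
  | nil => rfl
  | cons l w ih =>
    have h1 : substWord W (l :: w) = (if l.2 = true then W l.1 else FreeGroup.invRev (W l.1)) ++
      substWord W w := rfl
    rw [h1, wordValue_append, ih]
    change _ = wordValue _ ([l] ++ w)
    rw [wordValue_append]
    congr 1
    obtain ⟨i, b⟩ := l
    cases b
    · rw [if_neg (by simp), wordValue_invRev]
      simp [wordValue]
    · simp [wordValue]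

variable {S}

/-- All trivial words together serve as relators: they represent the kernel, which is its own normal
closure. -/
theorem isRecursivelyPresented_of_rePred (hS : Generates S)
    (h : REPred fun w => wordValue S w = 1) : IsRecursivelyPresented G := by
  refine ⟨n, {w | wordValue S w = 1}, h, ?_⟩
  have hk : FreeGroup.mk '' {w | wordValue S w = 1} = ((FreeGroup.lift S).ker : Set _) := by
    ext x
    constructor
    · rintro ⟨w, hw, rfl⟩
      exact hw
    · intro hx
      refine ⟨x.toWord, ?_, FreeGroup.mk_toWord⟩
      change FreeGroup.lift S (FreeGroup.mk x.toWord) = 1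
      rw [FreeGroup.mk_toWord]
      exact hx
  have hn : Subgroup.normalClosure (FreeGroup.mk '' {w | wordValue S w = 1}) =
      (FreeGroup.lift S).ker := by
    rw [hk, Subgroup.normalClosure_eq_self]
  have hs : Function.Surjective (FreeGroup.lift S) := fun g => by
    obtain ⟨w, hw⟩ := exists_wordValue_eq S hS g
    exact ⟨_, hw⟩
  exact ⟨(QuotientGroup.quotientMulEquivOfEq hn).trans
    (QuotientGroup.quotientKerEquivOfSurjective _ hs)⟩

/-- A consequence of the relators uses only finitely many of them. The search is for a finite list
of enumerated relators together with a derivation from this list. -/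
theorem exists_rePred_of_isRecursivelyPresented (h : IsRecursivelyPresented G) :
    ∃ (n : ℕ) (S : Fin n → G), Generates S ∧ REPred fun w => wordValue S w = 1 := by
  obtain ⟨n, R, hR, ⟨e⟩⟩ := h
  set ψ : FreeGroup (Fin n) →* G :=
    e.toMonoidHom.comp (PresentedGroup.mk (FreeGroup.mk '' R)) with hψ
  have hker : ∀ x, ψ x = 1 ↔ x ∈ Subgroup.normalClosure (FreeGroup.mk '' R) := by
    intro x
    have h1 : ψ x = e (PresentedGroup.mk (FreeGroup.mk '' R) x) := rfl
    rw [h1, EmbeddingLike.map_eq_one_iff]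
    exact QuotientGroup.eq_one_iff _
  have hsurj : Function.Surjective ψ :=
    e.surjective.comp (PresentedGroup.mk_surjective _)
  have hval : ∀ w : Word (Fin n), wordValue (fun i => ψ (FreeGroup.of i)) w =
      ψ (FreeGroup.mk w) := by
    intro w
    rw [← map_wordValue, wordValue, FreeGroup.lift_of_eq_id]
    rfl
  clear_value ψ
  refine ⟨n, fun i => ψ (FreeGroup.of i), ?_, ?_⟩
  · have h2 := congrArg (Subgroup.map ψ) (FreeGroup.closure_range_of (Fin n))
    rw [MonoidHom.map_closure, ← Set.range_comp, Subgroup.map_top_of_surjective _ hsurj] at h2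
    exact h2
  · have hv : ∀ w : Word (Fin n), wordValue (fun i => ψ (FreeGroup.of i)) w = 1 ↔
          FreeGroup.mk w ∈ Subgroup.normalClosure (FreeGroup.mk '' R) := by
      intro w
      rw [hval, hker]
    have h1 : REPred fun x : Word (Fin n) × List (Word (Fin n)) => ∀ r ∈ x.2, r ∈ R :=
      rePred_comp (rePred_forall_mem hR) Computable.snd
    have h2 : REPred fun x : Word (Fin n) × List (Word (Fin n)) =>
        FreeGroup.mk x.1 ∈ Subgroup.normalClosure {y | ∃ r ∈ x.2, y = FreeGroup.mk r} :=
      rePred_comp (f := fun x : Word (Fin n) × List (Word (Fin n)) => (x.2, x.1))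
        rePred_mem_normalClosure (Computable.pair Computable.snd Computable.fst)
    have hre : REPred fun w : Word (Fin n) => ∃ l : List (Word (Fin n)), (∀ r ∈ l, r ∈ R) ∧
        FreeGroup.mk w ∈ Subgroup.normalClosure {x | ∃ r ∈ l, x = FreeGroup.mk r} :=
      rePred_exists (p := fun w l => (∀ r ∈ l, r ∈ R) ∧
        FreeGroup.mk w ∈ Subgroup.normalClosure {x | ∃ r ∈ l, x = FreeGroup.mk r})
        (rePred_and h1 h2)
    refine hre.of_eq fun w => ?_
    rw [hv]
    constructor
    · rintro ⟨l, hl, hw⟩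
      refine Subgroup.normalClosure_mono ?_ hw
      rintro _ ⟨r, hr, rfl⟩
      exact ⟨r, hl r hr, rfl⟩
    · intro hw
      obtain ⟨L, hL, hw⟩ := exists_list_of_mem_subgroupClosure hw
      have : ∀ y ∈ L, ∃ r ∈ R, ∀ N : Subgroup (FreeGroup (Fin n)), N.Normal →
          FreeGroup.mk r ∈ N → y ∈ N := by
        intro y hy
        have hc : ∀ z ∈ Group.conjugatesOfSet (FreeGroup.mk '' R), ∃ r ∈ R,
            ∀ N : Subgroup (FreeGroup (Fin n)), N.Normal → FreeGroup.mk r ∈ N → z ∈ N := by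
          intro z hz
          obtain ⟨_, ⟨r, hr, rfl⟩, hc⟩ := Group.mem_conjugatesOfSet_iff.1 hz
          obtain ⟨g, hg⟩ := isConj_iff.1 hc
          exact ⟨r, hr, fun N hN h => hg ▸ hN.conj_mem _ h _⟩
        rcases hL y hy with h | h
        · exact hc _ h
        · obtain ⟨r, hr, h⟩ := hc _ h
          exact ⟨r, hr, fun N hN h' => N.inv_mem_iff.1 (h N hN h')⟩
      choose! f hf hf' using this
      refine ⟨L.map f, ?_, ?_⟩
      · intro r hr
        obtain ⟨y, hy, rfl⟩ := List.mem_map.1 hr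
        exact hf y hy
      · rw [← hw]
        refine Subgroup.list_prod_mem _ fun y hy => hf' y hy _ Subgroup.normalClosure_normal ?_
        exact Subgroup.subset_normalClosure ⟨f y, List.mem_map_of_mem hy, rfl⟩

end WordValue

/-! ### Doubles of a group and their embedding into a semidirect product -/

section Double

variable {G : Type*} [Group G]

/-- The amalgamated product of two copies of `G` along the subgroup `H`. -/
abbrev Double (H : Subgroup G) := Monoid.PushoutI (fun _ : Fin 2 => H.subtype)

/-- The inclusion of one of the two copies of `G`. -/
def Double.of (H : Subgroup G) (c : Fin 2) : G →* Double H :=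
  Monoid.PushoutI.of (φ := fun _ : Fin 2 => H.subtype) c

theorem Double.of_eq_of {H : Subgroup G} {x : G} (hx : x ∈ H) (c d : Fin 2) :
    Double.of H c x = Double.of H d x :=
  (Monoid.PushoutI.of_apply_eq_base (fun _ : Fin 2 => H.subtype) c ⟨x, hx⟩).trans
    (Monoid.PushoutI.of_apply_eq_base (fun _ : Fin 2 => H.subtype) d ⟨x, hx⟩).symm

/-- A pair of morphisms that agree on `H` defines a morphism on the double. -/
def Double.lift {H : Subgroup G} {K : Type*} [Group K] (f : Fin 2 → G →* K)
    (h : ∀ x ∈ H, f 0 x = f 1 x) : Double H →* K :=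
  Monoid.PushoutI.lift f ((f 0).comp H.subtype) (by
    intro i
    fin_cases i
    · rfl
    · ext x
      exact (h x x.2).symm)

@[simp]
theorem Double.lift_of {H : Subgroup G} {K : Type*} [Group K] (f : Fin 2 → G →* K)
    (h : ∀ x ∈ H, f 0 x = f 1 x) (c : Fin 2) (x : G) :
    Double.lift f h (Double.of H c x) = f c x :=
  Monoid.PushoutI.lift_of _ _ _ _

theorem Double.hom_ext {H : Subgroup G} {K : Type*} [Group K] {f g : Double H →* K}
    (h : ∀ c x, f (Double.of H c x) = g (Double.of H c x)) : f = g :=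
  Monoid.PushoutI.hom_ext_nonempty fun c => MonoidHom.ext fun x => h c x

/-- The action of `G` on the free group on `G ⧸ H`. -/
def cosetAction (H : Subgroup G) : G →* MulAut (FreeGroup (G ⧸ H)) where
  toFun g := FreeGroup.freeGroupCongr (MulAction.toPerm g)
  map_one' := by
    refine MulEquiv.toMonoidHom_injective (FreeGroup.ext_hom _ _ fun a => ?_)
    simp
  map_mul' x y := by
    refine MulEquiv.toMonoidHom_injective (FreeGroup.ext_hom _ _ fun a => ?_)
    simp [mul_smul]

@[simp]
theorem cosetAction_of (H : Subgroup G) (g : G) (q : G ⧸ H) :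
    cosetAction H g (FreeGroup.of q) = FreeGroup.of (g • q) := by
  simp [cosetAction]

/-- The semidirect product of the free group on `G ⧸ H` and of `G`. -/
abbrev CosetProduct (H : Subgroup G) := FreeGroup (G ⧸ H) ⋊[cosetAction H] G

/-- The letter of the trivial coset. -/
def cosetLetter (H : Subgroup G) : CosetProduct H :=
  SemidirectProduct.inl (FreeGroup.of ((1 : G) : G ⧸ H))

theorem cosetLetter_conj (H : Subgroup G) (x : G) :
    SemidirectProduct.inr x * cosetLetter H * (SemidirectProduct.inr x)⁻¹ =
      SemidirectProduct.inl (FreeGroup.of (x : G ⧸ H)) := by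
  rw [cosetLetter, ← map_inv, ← SemidirectProduct.inl_aut, cosetAction_of]
  congr 2
  rw [MulAction.Quotient.smul_coe, smul_eq_mul, mul_one]

/-- The second copy of `G` in the semidirect product. -/
def cosetConj (H : Subgroup G) : G →* CosetProduct H :=
  (MulAut.conj (cosetLetter H)⁻¹).toMonoidHom.comp SemidirectProduct.inr

theorem cosetConj_apply (H : Subgroup G) (x : G) :
    cosetConj H x = (cosetLetter H)⁻¹ * SemidirectProduct.inr x * cosetLetter H := by
  simp [cosetConj]

/-- With $t$ the letter of the trivial coset, $t^{-1} x t = t^{-1}(x t x^{-1})\,x$. This separates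
the free component from the component in `G`. -/
theorem cosetConj_eq_inl_mul_inr (H : Subgroup G) (x : G) :
    cosetConj H x = SemidirectProduct.inl ((FreeGroup.of ((1 : G) : G ⧸ H))⁻¹ *
      FreeGroup.of (x : G ⧸ H)) * SemidirectProduct.inr x := by
  rw [cosetConj_apply, map_mul, map_inv, ← cosetLetter_conj H x, cosetLetter]
  group

/-- The free component $t_H^{-1} t_{xH}$ vanishes exactly when $xH = H$. One direction makes the map
from the double well defined, the other one separates the two copies outside `H`. -/
theorem cosetConj_eq_inr_iff (H : Subgroup G) (x : G) :
    SemidirectProduct.inr x = cosetConj H x ↔ x ∈ H := by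
  rw [cosetConj_eq_inl_mul_inr, eq_comm, mul_eq_right, ← map_one SemidirectProduct.inl,
    SemidirectProduct.inl_inj, inv_mul_eq_one, FreeGroup.of_injective.eq_iff, QuotientGroup.eq]
  simp

/-- The morphism from a double to the semidirect product defined by a morphism of the factors. -/
def doubleHom {L : Type*} [Group L] {H : Subgroup L} {K : Subgroup G} (g : L →* G)
    (hg : ∀ x ∈ H, g x ∈ K) : Double H →* CosetProduct K :=
  Double.lift ![SemidirectProduct.inr.comp g, (cosetConj K).comp g]
    fun x hx => (cosetConj_eq_inr_iff K (g x)).2 (hg x hx)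

theorem doubleHom_of_zero {L : Type*} [Group L] {H : Subgroup L} {K : Subgroup G} (g : L →* G)
    (hg : ∀ x ∈ H, g x ∈ K) (x : L) :
    doubleHom g hg (Double.of H 0 x) = SemidirectProduct.inr (g x) :=
  Double.lift_of _ _ _ _

theorem doubleHom_of_one {L : Type*} [Group L] {H : Subgroup L} {K : Subgroup G} (g : L →* G)
    (hg : ∀ x ∈ H, g x ∈ K) (x : L) :
    doubleHom g hg (Double.of H 1 x) = cosetConj K (g x) :=
  Double.lift_of _ _ _ _

/-- The embedding of the double into the semidirect product. -/
def doubleEmbedding (H : Subgroup G) : Double H →* CosetProduct H :=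
  doubleHom (MonoidHom.id G) fun _ hx => hx

theorem Double.of_zero_eq_of_one_iff {H : Subgroup G} (x : G) :
    Double.of H 0 x = Double.of H 1 x ↔ x ∈ H := by
  refine ⟨fun h => ?_, fun hx => Double.of_eq_of hx 0 1⟩
  have h2 := congrArg (doubleEmbedding H) h
  rw [doubleEmbedding, doubleHom_of_zero, doubleHom_of_one] at h2
  exact (cosetConj_eq_inr_iff H x).1 h2

/-- The automorphism of the double that exchanges the two factors. -/
def doubleSwap (H : Subgroup G) : Double H →* Double H :=
  Double.lift (fun c => Double.of H (Equiv.swap 0 1 c)) fun _ hx => Double.of_eq_of hx _ _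

theorem doubleSwap_doubleSwap (H : Subgroup G) (x : Double H) :
    doubleSwap H (doubleSwap H x) = x := by
  have h : (doubleSwap H).comp (doubleSwap H) = MonoidHom.id _ :=
    Double.hom_ext fun c x => by simp [doubleSwap]
  exact DFunLike.congr_fun h x

/-- The exchange of the two factors, as a permutation of the double. -/
def doubleSwapPerm (H : Subgroup G) : Equiv.Perm (Double H) :=
  Function.Involutive.toPerm (doubleSwap H) (doubleSwap_doubleSwap H)

theorem doubleSwapPerm_conj (H : Subgroup G) (d : Double H) :
    doubleSwapPerm H * MulAction.toPermHom (Double H) (Double H) d * (doubleSwapPerm H)⁻¹ =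
      MulAction.toPermHom (Double H) (Double H) (doubleSwap H d) := by
  rw [mul_inv_eq_iff_eq_mul]
  ext x
  exact map_mul (doubleSwap H) d x

theorem doubleSwapPerm_inv (H : Subgroup G) : (doubleSwapPerm H)⁻¹ = doubleSwapPerm H :=
  rfl

/-- A morphism from the semidirect product that restricts to the left regular representation of
the double. -/
theorem exists_perm_hom (H : Subgroup G) : ∃ ψ : CosetProduct H →* Equiv.Perm (Double H),
    ψ.comp (doubleEmbedding H) = MulAction.toPermHom (Double H) (Double H) := by
  -- Elements of `G` act by left multiplication through the first copy; the coset letters will act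
  -- through the exchange of the factors.
  set ρ : G →* Equiv.Perm (Double H) :=
    (MulAction.toPermHom (Double H) (Double H)).comp (Double.of H 0) with hρ
  have hcomm : ∀ h ∈ H, ρ h * doubleSwapPerm H * (ρ h)⁻¹ = doubleSwapPerm H := by
    intro h hh
    have h1 := doubleSwapPerm_conj H (Double.of H 0 h)
    have h2 : doubleSwap H (Double.of H 0 h) = Double.of H 0 h := by
      rw [doubleSwap, Double.lift_of]
      exact Double.of_eq_of hh _ _
    rw [h2, mul_inv_eq_iff_eq_mul] at h1
    rw [mul_inv_eq_iff_eq_mul]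
    exact h1.symm
  -- The letter of $xH$ acts as the exchange conjugated by $x$. The representative does not matter
  -- because the exchange commutes with the action of `H`. Conjugation by the exchange itself turns
  -- the action of the first copy into that of the second.
  let t : G ⧸ H → Equiv.Perm (Double H) := fun q =>
    Quotient.liftOn' q (fun x => ρ x * doubleSwapPerm H * (ρ x)⁻¹) (by
      intro x y hxy
      have hxy : x⁻¹ * y ∈ H := QuotientGroup.leftRel_apply.1 hxy
      have h3 := hcomm _ hxy
      simp only [map_mul, map_inv, mul_inv_rev, inv_inv] at h3
      calc ρ x * doubleSwapPerm H * (ρ x)⁻¹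
          = ρ x * ((ρ x)⁻¹ * ρ y * doubleSwapPerm H * ((ρ y)⁻¹ * ρ x)) * (ρ x)⁻¹ := by rw [h3]
        _ = _ := by group)
  have ht : ∀ x : G, t (x : G ⧸ H) = ρ x * doubleSwapPerm H * (ρ x)⁻¹ := fun x => rfl
  have hcompat : ∀ g : G, (FreeGroup.lift t).comp (cosetAction H g).toMonoidHom =
      (MulAut.conj (ρ g)).toMonoidHom.comp (FreeGroup.lift t) := by
    intro g
    refine FreeGroup.ext_hom _ _ fun q => ?_
    induction q using QuotientGroup.induction_on with
    | H x =>
      simp only [MonoidHom.comp_apply, MulEquiv.toMonoidHom_eq_coe, MonoidHom.coe_coe,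
        cosetAction_of, FreeGroup.lift_apply_of, MulAut.conj_apply, ht,
        MulAction.Quotient.smul_coe, smul_eq_mul, map_mul]
      group
  refine ⟨SemidirectProduct.lift (FreeGroup.lift t) ρ hcompat, Double.hom_ext fun c x => ?_⟩
  fin_cases c
  · simp only [MonoidHom.comp_apply, doubleEmbedding, Fin.zero_eta, doubleHom_of_zero,
      SemidirectProduct.lift_inr]
    rfl
  · simp only [MonoidHom.comp_apply, doubleEmbedding, Fin.mk_one, doubleHom_of_one,
      cosetConj_apply, map_mul, map_inv, SemidirectProduct.lift_inr, cosetLetter,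
      SemidirectProduct.lift_inl, FreeGroup.lift_apply_of, ht, map_one, MonoidHom.id_apply, one_mul,
      inv_one, mul_one]
    have h1 := doubleSwapPerm_conj H (Double.of H 0 x)
    rw [doubleSwapPerm_inv] at h1 ⊢
    refine h1.trans ?_
    simp [doubleSwap]

/-- The left regular representation of the double is faithful and factors through this map. The
argument takes the place of the normal form theorem for amalgamated products. -/
theorem doubleEmbedding_injective (H : Subgroup G) : Function.Injective (doubleEmbedding H) := by
  obtain ⟨ψ, hψ⟩ := exists_perm_hom H
  have h : Function.Injective (MulAction.toPermHom (Double H) (Double H)) :=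
    MulAction.toPerm_injective
  rw [← hψ, MonoidHom.coe_comp] at h
  exact h.of_comp

end Double

/-! ### The lamplighter group: universal property and subgroups of lamps -/

section Lamps

theorem lampA_zpow (n : ℤ) : lampA ^ n = SemidirectProduct.inr (Multiplicative.ofAdd n) := by
  rw [lampA, ← map_zpow, ← ofAdd_zsmul]
  simp

theorem shiftHom_apply (n : Multiplicative ℤ) (b : LampBase) (i : ℤ) :
    Multiplicative.toAdd (shiftHom n b) i = Multiplicative.toAdd b (i - n.toAdd) := rfl

theorem shiftHom_single (n i : ℤ) (x : ZMod 2) :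
    shiftHom (Multiplicative.ofAdd n) (Multiplicative.ofAdd (Finsupp.single i x)) =
      Multiplicative.ofAdd (Finsupp.single (i + n) x) :=
  congrArg Multiplicative.ofAdd (Finsupp.equivMapDomain_single _ _ _)

theorem lampU_eq (i : ℤ) :
    lampU i = SemidirectProduct.inl (Multiplicative.ofAdd (Finsupp.single i 1)) := by
  rw [lampU, zpow_neg, lampA_zpow, lampEps, ← map_inv, ← SemidirectProduct.inl_aut,
    shiftHom_single, zero_add]

theorem lampBase_hom_ext {G : Type*} [Group G] {f g : LampBase →* G}
    (h : ∀ i, f (Multiplicative.ofAdd (Finsupp.single i 1)) =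
      g (Multiplicative.ofAdd (Finsupp.single i 1))) : f = g := by
  refine MonoidHom.toAdditive.injective (Finsupp.addHom_ext fun i y => ?_)
  have hy : y = 0 ∨ y = 1 := by revert y; decide
  rcases hy with rfl | rfl
  · rw [Finsupp.single_zero]
    exact (map_one f).trans (map_one g).symm
  · exact h i

theorem lamp_hom_ext {G : Type*} [Group G] {f g : Lamplighter →* G} (ha : f lampA = g lampA)
    (he : f lampEps = g lampEps) : f = g := by
  refine SemidirectProduct.hom_ext (lampBase_hom_ext fun i => ?_) ?_
  · simp only [MonoidHom.comp_apply]
    rw [← lampU_eq, lampU]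
    simp only [map_mul, map_zpow, ha, he]
  · refine MonoidHom.ext fun n => ?_
    simp only [MonoidHom.comp_apply]
    rw [← ofAdd_toAdd n, ← lampA_zpow, map_zpow, map_zpow, ha]

/-- Commuting elements of order two define a morphism on the base group. -/
theorem exists_lampBase_hom {G : Type*} [Group G] (u : ℤ → G) (h2 : ∀ i, u i ^ 2 = 1)
    (hc : ∀ i j, u i * u j = u j * u i) :
    ∃ f : LampBase →* G, ∀ i, f (Multiplicative.ofAdd (Finsupp.single i 1)) = u i := by
  have hcomm : IsMulCommutative (Subgroup.closure (Set.range u)) :=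
    Subgroup.isMulCommutative_closure (by
      rintro _ ⟨i, rfl⟩ _ ⟨j, rfl⟩
      exact hc i j)
  -- The universal property of the direct sum needs a commutative target, so the morphism is built
  -- into the subgroup generated by the commuting elements.
  let inst : CommGroup (Subgroup.closure (Set.range u)) :=
    { (inferInstance : Group (Subgroup.closure (Set.range u))) with
      mul_comm := hcomm.is_comm.comm }
  let v : ℤ → Additive (Subgroup.closure (Set.range u)) := fun i =>
    Additive.ofMul ⟨u i, Subgroup.subset_closure ⟨i, rfl⟩⟩
  have hv : ∀ i, (2 : ℤ) • v i = 0 := by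
    intro i
    refine congrArg Additive.ofMul (Subtype.ext ?_)
    exact (zpow_ofNat (u i) 2).trans (h2 i)
  let f : (ℤ →₀ ZMod 2) →+ Additive (Subgroup.closure (Set.range u)) :=
    Finsupp.liftAddHom fun i => ZMod.lift 2 ⟨zmultiplesHom _ (v i), by
      simpa using hv i⟩
  refine ⟨(Subgroup.subtype _).comp (AddMonoidHom.toMultiplicativeLeft f), fun i => ?_⟩
  have h1 : f (Finsupp.single i 1) = v i := by
    have h3 : (1 : ZMod 2) = ((1 : ℤ) : ZMod 2) := by simp
    simp only [f, Finsupp.liftAddHom_apply_single]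
    rw [h3, ZMod.lift_coe]
    simp
  change ((f (Finsupp.single i 1)).toMul : G) = u i
  rw [h1]
  rfl

/-- The relations of the lamplighter group. -/
def LampRel {G : Type*} [Group G] (a e : G) : Prop :=
  e ^ 2 = 1 ∧ ∀ i : ℤ, e * (a ^ i * e * a ^ (-i)) = a ^ i * e * a ^ (-i) * e

/-- The universal property of the lamplighter group. -/
theorem exists_lamp_hom {G : Type*} [Group G] {a e : G} (h : LampRel a e) :
    ∃ f : Lamplighter →* G, f lampA = a ∧ f lampEps = e := by
  obtain ⟨h2, hc⟩ := h
  obtain ⟨f, hf⟩ := exists_lampBase_hom (fun i : ℤ => a ^ i * e * a ^ (-i))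
    (fun i => by
      rw [zpow_neg, ← MulAut.conj_apply, ← map_pow, h2, map_one])
    -- Conjugation by $a^i$ reduces the commutation of the $i$-th and $j$-th conjugates to that of
    -- `e` with the conjugate of exponent $j - i$.
    (fun i j => by
      have h1 := congrArg (MulAut.conj (a ^ i)) (hc (j - i))
      have h3 : MulAut.conj (a ^ i) (a ^ (j - i) * e * a ^ (-(j - i))) = a ^ j * e * a ^ (-j) := by
        rw [MulAut.conj_apply]
        group
      rw [map_mul (MulAut.conj (a ^ i)) e, map_mul (MulAut.conj (a ^ i)) _ e, h3,
        MulAut.conj_apply] at h1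
      rw [zpow_neg a i]
      exact h1)
  refine ⟨SemidirectProduct.lift f (zpowersHom G a) fun g => ?_, ?_, ?_⟩
  · refine lampBase_hom_ext fun i => ?_
    obtain ⟨n, rfl⟩ := Multiplicative.ofAdd.surjective g
    have h1 : (shiftHom (Multiplicative.ofAdd n)).toMonoidHom
        (Multiplicative.ofAdd (Finsupp.single i 1)) =
          Multiplicative.ofAdd (Finsupp.single (i + n) 1) := shiftHom_single n i 1
    rw [MonoidHom.comp_apply, MonoidHom.comp_apply, h1, hf, hf]
    simp only [MulEquiv.toMonoidHom_eq_coe, MonoidHom.coe_coe, MulAut.conj_apply,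
      zpowersHom_apply, toAdd_ofAdd]
    group
  · simp [lampA]
  · rw [lampEps, SemidirectProduct.lift_inl, hf]
    simp

theorem lampU_conj (i : ℤ) : lampU i = lampA ^ i * lampEps * lampA ^ (-i) := rfl

theorem lampRel_lamp : LampRel lampA lampEps := by
  constructor
  · rw [lampEps, ← map_pow]
    have : (Multiplicative.ofAdd (Finsupp.single (0 : ℤ) (1 : ZMod 2))) ^ 2 = 1 := by
      rw [← ofAdd_nsmul, Finsupp.smul_single]
      have : (2 : ℕ) • (1 : ZMod 2) = 0 := by decide
      rw [this, Finsupp.single_zero, ofAdd_zero]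
    rw [this, map_one]
  · intro i
    rw [← lampU_conj, lampU_eq, lampEps]
    exact (map_mul SemidirectProduct.inl _ _).symm.trans
      ((congrArg SemidirectProduct.inl (mul_comm _ _)).trans (map_mul SemidirectProduct.inl _ _))

theorem LampRel.map {G K : Type*} [Group G] [Group K] {a e : G} (h : LampRel a e) (f : G →* K) :
    LampRel (f a) (f e) := by
  refine ⟨by rw [← map_pow, h.1, map_one], fun i => ?_⟩
  simpa using congrArg f (h.2 i)

theorem mem_lampSubgroup {A : Set ℤ} {x : Lamplighter} :
    x ∈ lampSubgroup A ↔ x.right = 1 ∧ ∀ i ∉ A, Multiplicative.toAdd x.left i = 0 := by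
  constructor
  · intro hx
    induction hx using Subgroup.closure_induction with
    | mem x hx =>
      obtain ⟨j, hj, rfl⟩ := hx
      rw [lampU_eq]
      refine ⟨rfl, fun i hi => ?_⟩
      exact Finsupp.single_eq_of_ne fun h => hi (h ▸ hj)
    | one => exact ⟨rfl, fun i _ => rfl⟩
    | mul x y _ _ hx hy =>
      refine ⟨by rw [SemidirectProduct.mul_right, hx.1, hy.1, one_mul], fun i hi => ?_⟩
      rw [SemidirectProduct.mul_left, hx.1, map_one, MulAut.one_apply, toAdd_mul,
        Finsupp.add_apply, hx.2 i hi, hy.2 i hi, add_zero]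
    | inv x _ hx =>
      refine ⟨by rw [SemidirectProduct.inv_right, hx.1, inv_one], fun i hi => ?_⟩
      rw [SemidirectProduct.inv_left, hx.1, inv_one, map_one, MulAut.one_apply, toAdd_inv,
        Finsupp.neg_apply, hx.2 i hi, neg_zero]
  · rintro ⟨hr, hl⟩
    obtain ⟨b, n⟩ := x
    obtain ⟨b, rfl⟩ := Multiplicative.ofAdd.surjective b
    simp only at hr
    subst hr
    change Multiplicative.ofAdd b ∈ (lampSubgroup A).comap SemidirectProduct.inl
    rw [← Finsupp.sum_single b, Finsupp.sum, ofAdd_sum]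
    refine Subgroup.prod_mem _ fun i hi => ?_
    have hb : b i = 1 := by
      have h0 := Finsupp.mem_support_iff.1 hi
      generalize b i = y at h0
      revert y; decide
    rw [hb, Subgroup.mem_comap, ← lampU_eq]
    refine Subgroup.subset_closure ⟨i, ?_, rfl⟩
    by_contra h
    exact Finsupp.mem_support_iff.1 hi (hl i h)

theorem lampU_mem_iff {A : Set ℤ} {i : ℤ} : lampU i ∈ lampSubgroup A ↔ i ∈ A := by
  rw [mem_lampSubgroup, lampU_eq]
  constructor
  · rintro ⟨-, h⟩
    by_contra hi
    have := h i hi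
    simp at this
  · intro hi
    exact (mem_lampSubgroup.1 (by
      rw [← lampU_eq]
      exact Subgroup.subset_closure ⟨i, hi, rfl⟩))

end Lamps

/-! ### Generators and relations of Dyson's groups -/

section DysonGroups

variable {A : Set ℤ}

/-- The four generators of Dyson's group. -/
noncomputable def dysonGen (A : Set ℤ) : Fin 4 → DysonGroup A :=
  ![DysonGroup.incl A 0 lampA, DysonGroup.incl A 0 lampEps,
    DysonGroup.incl A 1 lampA, DysonGroup.incl A 1 lampEps]

/-- The relations of Dyson's group. -/
def DysonRel {G : Type*} [Group G] (A : Set ℤ) (f : Fin 4 → G) : Prop :=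
  LampRel (f 0) (f 1) ∧ LampRel (f 2) (f 3) ∧
    ∀ i ∈ A, f 0 ^ i * f 1 * f 0 ^ (-i) = f 2 ^ i * f 3 * f 2 ^ (-i)

theorem incl_lampU (c : Fin 2) (i : ℤ) : DysonGroup.incl A c (lampU i) =
    DysonGroup.incl A c lampA ^ i * DysonGroup.incl A c lampEps *
      DysonGroup.incl A c lampA ^ (-i) := by
  simp [lampU]

/-- Amalgamating the lamps of `A` identifies no further lamp, because the subgroup generated by
these lamps contains no other $u_i$. Both the reduction to the word problem and the failure of
residual finiteness use this. -/
theorem incl_lampU_eq_iff {i : ℤ} :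
    DysonGroup.incl A 0 (lampU i) = DysonGroup.incl A 1 (lampU i) ↔ i ∈ A :=
  (Double.of_zero_eq_of_one_iff (H := lampSubgroup A) (lampU i)).trans lampU_mem_iff

theorem dysonGen_eq_iff {i : ℤ} :
    dysonGen A 0 ^ i * dysonGen A 1 * dysonGen A 0 ^ (-i) =
      dysonGen A 2 ^ i * dysonGen A 3 * dysonGen A 2 ^ (-i) ↔ i ∈ A := by
  rw [← incl_lampU_eq_iff, incl_lampU, incl_lampU]
  rfl

theorem dysonRel_dysonGen : DysonRel A (dysonGen A) :=
  ⟨lampRel_lamp.map _, lampRel_lamp.map _, fun _ hi => dysonGen_eq_iff.2 hi⟩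

theorem DysonRel.map {G K : Type*} [Group G] [Group K] {f : Fin 4 → G} (h : DysonRel A f)
    (φ : G →* K) : DysonRel A fun i => φ (f i) :=
  ⟨h.1.map φ, h.2.1.map φ, fun i hi => by simpa using congrArg φ (h.2.2 i hi)⟩

theorem dyson_hom_ext {K : Type*} [Group K] {φ ψ : DysonGroup A →* K}
    (h : ∀ i, φ (dysonGen A i) = ψ (dysonGen A i)) : φ = ψ := by
  refine Monoid.PushoutI.hom_ext_nonempty fun c => ?_
  fin_cases c
  · exact lamp_hom_ext (h 0) (h 1)
  · exact lamp_hom_ext (h 2) (h 3)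

/-- The universal property of Dyson's group. -/
theorem exists_dyson_hom {G : Type*} [Group G] {f : Fin 4 → G} (h : DysonRel A f) :
    ∃ φ : DysonGroup A →* G, ∀ i, φ (dysonGen A i) = f i := by
  obtain ⟨φ, ha, he⟩ := exists_lamp_hom h.1
  obtain ⟨ψ, ha', he'⟩ := exists_lamp_hom h.2.1
  have hagree : ∀ x ∈ lampSubgroup A, φ x = ψ x := by
    intro x hx
    induction hx using Subgroup.closure_induction with
    | mem x hx =>
      obtain ⟨i, hi, rfl⟩ := hx
      simp only [lampU, map_mul, map_zpow, ha, he, ha', he']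
      exact h.2.2 i hi
    | one => simp
    | mul x y _ _ hx hy => rw [map_mul, map_mul, hx, hy]
    | inv x _ hx => rw [map_inv, map_inv, hx]
  refine ⟨Double.lift ![φ, ψ] hagree, fun i => ?_⟩
  fin_cases i
  · exact (Double.lift_of _ _ 0 lampA).trans ha
  · exact (Double.lift_of _ _ 0 lampEps).trans he
  · exact (Double.lift_of _ _ 1 lampA).trans ha'
  · exact (Double.lift_of _ _ 1 lampEps).trans he'

theorem extendsToHom_dysonGen_iff {G : Type*} [Group G] {f : Fin 4 → G} :
    ExtendsToHom (dysonGen A) f ↔ DysonRel A f := by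
  refine ⟨?_, exists_dyson_hom⟩
  rintro ⟨φ, hφ⟩
  rw [← funext hφ]
  exact dysonRel_dysonGen.map φ

/-- The relations already hold in the subgroup generated by the four elements. The universal
property gives a morphism into it, and composing with the inclusion gives the identity. -/
theorem generates_dysonGen : Generates (dysonGen A) := by
  set K := Subgroup.closure (Set.range (dysonGen A)) with hK
  have hm : ∀ i, dysonGen A i ∈ K := fun i => Subgroup.subset_closure ⟨i, rfl⟩
  have hrel : DysonRel A (fun i => (⟨dysonGen A i, hm i⟩ : K)) := by
    have h := dysonRel_dysonGen (A := A)
    exact ⟨⟨Subtype.ext h.1.1, fun i => Subtype.ext (h.1.2 i)⟩,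
      ⟨Subtype.ext h.2.1.1, fun i => Subtype.ext (h.2.1.2 i)⟩,
      fun i hi => Subtype.ext (h.2.2 i hi)⟩
  obtain ⟨φ, hφ⟩ := exists_dyson_hom hrel
  have h : K.subtype.comp φ = MonoidHom.id _ :=
    dyson_hom_ext fun i => congrArg Subtype.val (hφ i)
  rw [Generates, ← hK, eq_top_iff]
  intro x _
  have h1 : (φ x : DysonGroup A) = x := DFunLike.congr_fun h x
  rw [← h1]
  exact (φ x).2

end DysonGroups

/-! ### Computable words for powers, conjugates and comparisons -/

section PowerWords

variable {α : Type*}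

/-- The word that repeats `w` the given number of times. -/
def powWord (w : Word α) (n : ℕ) : Word α := (List.range n).flatMap fun _ => w

theorem mk_powWord (w : Word α) (n : ℕ) :
    FreeGroup.mk (powWord w n) = FreeGroup.mk w ^ n := by
  induction n with
  | zero => rfl
  | succ n ih =>
    rw [powWord, List.range_succ, List.flatMap_append, ← FreeGroup.mul_mk, ← powWord, ih, pow_succ]
    simp

/-- The power of a word with an integral exponent. -/
def zpowWord (w : Word α) (z : ℤ) : Word α :=
  powWord w z.toNat ++ powWord (FreeGroup.invRev w) (-z).toNat

theorem mk_zpowWord (w : Word α) (z : ℤ) :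
    FreeGroup.mk (zpowWord w z) = FreeGroup.mk w ^ z := by
  rw [zpowWord, ← FreeGroup.mul_mk, mk_powWord, mk_powWord, ← FreeGroup.inv_mk, inv_pow,
    ← zpow_natCast, ← zpow_natCast, ← zpow_neg, ← zpow_add]
  congr 1
  omega

/-- The conjugate of `e` by the `z`-th power of `a`. -/
def conjWord (a e : Word α) (z : ℤ) : Word α := zpowWord a z ++ (e ++ zpowWord a (-z))

theorem mk_conjWord (a e : Word α) (z : ℤ) : FreeGroup.mk (conjWord a e z) =
    FreeGroup.mk a ^ z * FreeGroup.mk e * FreeGroup.mk a ^ (-z) := by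
  rw [conjWord, ← FreeGroup.mul_mk, ← FreeGroup.mul_mk, mk_zpowWord, mk_zpowWord, mul_assoc]

/-- The word that compares the conjugates in the two copies. -/
def compareWord (a e b d : Word α) (z : ℤ) : Word α :=
  conjWord a e z ++ FreeGroup.invRev (conjWord b d z)

theorem mk_compareWord (a e b d : Word α) (z : ℤ) : FreeGroup.mk (compareWord a e b d z) =
    FreeGroup.mk (conjWord a e z) * (FreeGroup.mk (conjWord b d z))⁻¹ := by
  rw [compareWord, ← FreeGroup.mul_mk, FreeGroup.inv_mk]

theorem wordValue_compareWord {G : Type*} [Group G] {n : ℕ} (S : Fin n → G)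
    (a e b d : Word (Fin n)) (z : ℤ) :
    wordValue S (compareWord a e b d z) = 1 ↔
      wordValue S a ^ z * wordValue S e * wordValue S a ^ (-z) =
        wordValue S b ^ z * wordValue S d * wordValue S b ^ (-z) := by
  simp only [wordValue, mk_compareWord, mk_conjWord, map_mul, map_zpow, map_inv]
  rw [mul_inv_eq_one]

variable [Primcodable α]

theorem primrec_powWord : Primrec₂ (powWord (α := α)) :=
  Primrec.list_flatMap (Primrec.list_range.comp Primrec.snd)
    (Primrec.fst.comp Primrec.fst).to₂

theorem primrec_zpowWord : Primrec₂ (zpowWord (α := α)) :=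
  Primrec.list_append.comp
    (primrec_powWord.comp Primrec.fst (primrec_int_toNat.comp Primrec.snd))
    (primrec_powWord.comp (primrec_invRev.comp Primrec.fst)
      (primrec_int_toNat.comp (primrec_int_neg.comp Primrec.snd)))

theorem primrec_conjWord : Primrec fun x : (Word α × Word α) × ℤ => conjWord x.1.1 x.1.2 x.2 :=
  Primrec.list_append.comp
    (primrec_zpowWord.comp (Primrec.fst.comp Primrec.fst) Primrec.snd)
    (Primrec.list_append.comp (Primrec.snd.comp Primrec.fst)
      (primrec_zpowWord.comp (Primrec.fst.comp Primrec.fst)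
        (primrec_int_neg.comp Primrec.snd)))

theorem primrec_compareWord : Primrec fun x : ((Word α × Word α) × Word α × Word α) × ℤ =>
    compareWord x.1.1.1 x.1.1.2 x.1.2.1 x.1.2.2 x.2 :=
  Primrec.list_append.comp
    (primrec_conjWord.comp (Primrec.pair (Primrec.fst.comp Primrec.fst) Primrec.snd))
    (primrec_invRev.comp (primrec_conjWord.comp
      (Primrec.pair (Primrec.snd.comp Primrec.fst) Primrec.snd)))

end PowerWords

/-! ### Reduction of membership in the set to the word problem -/

section Reductions

variable {A : Set ℤ}

/-- Membership in `A` reduces to the word problem of Dyson's group, for every generating family. -/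
theorem exists_reduction_to_wordProblem {n : ℕ} {S : Fin n → DysonGroup A} (hS : Generates S) :
    ∃ f : ℤ → Word (Fin n), Primrec f ∧ ∀ z, wordValue S (f z) = 1 ↔ z ∈ A := by
  choose W hW using fun i => exists_wordValue_eq S hS (dysonGen A i)
  refine ⟨compareWord (W 0) (W 1) (W 2) (W 3), ?_, fun z => ?_⟩
  · exact primrec_compareWord.comp (Primrec.pair (Primrec.const ((W 0, W 1), W 2, W 3)) Primrec.id)
  · rw [wordValue_compareWord, hW, hW, hW, hW, dysonGen_eq_iff]

end Reductions

/-! ### Computing the image of a word in the semidirect product -/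

section NormalForm

/-- A description of an element of the lamplighter group: the list of the lamps that are switched,
and a shift. -/
abbrev LampCode := List ℤ × ℤ

/-- The element of the lamplighter group with the given description. -/
noncomputable def LampCode.elem (x : LampCode) : Lamplighter :=
  (x.1.map lampU).prod * lampA ^ x.2

/-- Right multiplication of the described element by `a`, `ε` or an inverse. -/
def LampCode.move (x : LampCode) (i : Fin 4) (b : Bool) : LampCode :=
  if i = 0 ∨ i = 2 then (x.1, if b = true then x.2 + 1 else x.2 - 1) else (x.1 ++ [x.2], x.2)

/-- The element of the lamplighter group that corresponds to a letter. -/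
noncomputable def letterElem (i : Fin 4) (b : Bool) : Lamplighter :=
  (fun x => if b = true then x else x⁻¹) (if i = 0 ∨ i = 2 then lampA else lampEps)

theorem LampCode.elem_move (x : LampCode) (i : Fin 4) (b : Bool) :
    (x.move i b).elem = x.elem * letterElem i b := by
  rw [move, letterElem]
  split_ifs with hi hb hb
  · simp only [elem, zpow_add_one, mul_assoc]
  · simp only [elem, zpow_sub_one, mul_assoc]
  · simp [elem, lampU, mul_assoc]
  · have h : lampEps⁻¹ = lampEps := by
      rw [inv_eq_iff_mul_eq_one, ← sq]
      exact lampRel_lamp.1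
    simp [elem, lampU, mul_assoc, h]

theorem LampCode.elem_right (x : LampCode) : x.elem.right = Multiplicative.ofAdd x.2 := by
  have h : ∀ T : List ℤ, ((T.map lampU).prod).right = 1 := by
    intro T
    induction T with
    | nil => rfl
    | cons i T ih =>
      rw [List.map_cons, List.prod_cons, SemidirectProduct.mul_right, ih, lampU_eq, mul_one]
      rfl
  rw [elem, SemidirectProduct.mul_right, h, one_mul, lampA_zpow]
  rfl

theorem LampCode.elem_left (x : LampCode) (i : ℤ) :
    Multiplicative.toAdd x.elem.left i = (x.1.count i : ZMod 2) := by
  obtain ⟨T, n⟩ := x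
  have h : (elem (T, n)).left = ((T.map lampU).prod).left := by
    rw [elem, SemidirectProduct.mul_left, lampA_zpow, SemidirectProduct.left_inr, map_one, mul_one]
  rw [h]
  induction T with
  | nil => rfl
  | cons j T ih =>
    rw [List.map_cons, List.prod_cons, SemidirectProduct.mul_left, lampU_eq]
    change Finsupp.single j (1 : ZMod 2) i +
      Multiplicative.toAdd (shiftHom 1 (List.map lampU T).prod.left) i = _
    rw [map_one, MulAut.one_apply, ih (by
      rw [elem, SemidirectProduct.mul_left, lampA_zpow, SemidirectProduct.left_inr, map_one,
        mul_one]), List.count_cons, add_comm]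
    by_cases hij : j = i
    · subst hij; simp
    · rw [Finsupp.single_eq_of_ne (Ne.symm hij)]
      simp [hij]

/-- The image of a word in the generators of Dyson's group: the product of the cosets of the listed
elements, and an element of the lamplighter group. -/
def runStep (s : List (LampCode × Bool) × LampCode) (l : Fin 4 × Bool) :
    List (LampCode × Bool) × LampCode :=
  (if l.1 = 0 ∨ l.1 = 1 then s.1 else s.1 ++ [(s.2, false), (s.2.move l.1 l.2, true)],
    s.2.move l.1 l.2)

/-- The image of a word in the generators of Dyson's group. -/
def run (w : Word (Fin 4)) : List (LampCode × Bool) × LampCode :=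
  w.foldl runStep ([], ([], 0))

/-- The value of a list of formal cosets. -/
noncomputable def cosetValue (A : Set ℤ) (v : List (LampCode × Bool)) :
    FreeGroup (Lamplighter ⧸ lampSubgroup A) :=
  FreeGroup.mk (v.map fun y => ((y.1.elem : Lamplighter ⧸ lampSubgroup A), y.2))

theorem doubleEmbedding_letter (A : Set ℤ) (i : Fin 4) (b : Bool) :
    doubleEmbedding (lampSubgroup A) (wordValue (dysonGen A) [(i, b)]) =
      if i = 0 ∨ i = 1 then SemidirectProduct.inr (letterElem i b)
        else cosetConj (lampSubgroup A) (letterElem i b) := by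
  have h : wordValue (dysonGen A) [(i, b)] =
      DysonGroup.incl A (if i = 0 ∨ i = 1 then 0 else 1) (letterElem i b) := by
    cases b <;> fin_cases i <;> simp [wordValue, dysonGen, letterElem]
  rw [h]
  split_ifs
  · exact doubleHom_of_zero (H := lampSubgroup A) _ _ _
  · exact doubleHom_of_one (H := lampSubgroup A) _ _ _

/-- Moving `x` to the right past the letters gives $x \cdot t^{-1} y t = t_{xH}^{-1} t_{xyH} \cdot
xy$. This is why a letter of the second copy appends two coset letters in `runStep`, while a letter
of the first copy appends none. -/
theorem inr_mul_cosetConj {G : Type*} [Group G] (H : Subgroup G) (x y : G) :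
    SemidirectProduct.inr x * cosetConj H y =
      SemidirectProduct.inl ((FreeGroup.of (x : G ⧸ H))⁻¹ * FreeGroup.of ((x * y : G) : G ⧸ H)) *
        SemidirectProduct.inr (x * y) := by
  rw [map_mul, map_inv, ← cosetLetter_conj, ← cosetLetter_conj, cosetConj_apply, map_mul]
  group

theorem doubleEmbedding_foldl (A : Set ℤ) (w : Word (Fin 4))
    (s : List (LampCode × Bool) × LampCode) (g : DysonGroup A)
    (h : doubleEmbedding (lampSubgroup A) g =
      SemidirectProduct.inl (cosetValue A s.1) * SemidirectProduct.inr s.2.elem) :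
    doubleEmbedding (lampSubgroup A) (g * wordValue (dysonGen A) w) =
      SemidirectProduct.inl (cosetValue A (w.foldl runStep s).1) *
        SemidirectProduct.inr (w.foldl runStep s).2.elem := by
  induction w generalizing s g with
  | nil => rw [wordValue_nil, mul_one, h]; rfl
  | cons l w ih =>
    have h1 : wordValue (dysonGen A) (l :: w) =
        wordValue (dysonGen A) [l] * wordValue (dysonGen A) w := wordValue_append _ [l] w
    rw [h1, ← mul_assoc, List.foldl_cons]
    refine ih _ _ ?_
    obtain ⟨i, b⟩ := l
    rw [map_mul, h, doubleEmbedding_letter, runStep]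
    dsimp only
    split_ifs with hi
    · rw [LampCode.elem_move, map_mul, mul_assoc]
    · rw [mul_assoc, inr_mul_cosetConj, LampCode.elem_move, ← mul_assoc, ← map_mul]
      congr 2
      simp only [cosetValue, List.map_append, List.map_cons, List.map_nil, ← FreeGroup.mul_mk]
      congr 1
      rw [LampCode.elem_move]
      rfl

theorem doubleEmbedding_wordValue (A : Set ℤ) (w : Word (Fin 4)) :
    doubleEmbedding (lampSubgroup A) (wordValue (dysonGen A) w) =
      SemidirectProduct.inl (cosetValue A (run w).1) * SemidirectProduct.inr (run w).2.elem := by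
  have h := doubleEmbedding_foldl A w ([], ([], 0)) 1 (by
    have h1 : LampCode.elem ([], 0) = 1 := by simp [LampCode.elem]
    rw [map_one, h1, map_one, mul_one]
    rfl)
  rwa [one_mul] at h

theorem wordValue_dysonGen_eq_one_iff (A : Set ℤ) (w : Word (Fin 4)) :
    wordValue (dysonGen A) w = 1 ↔ cosetValue A (run w).1 = 1 ∧ (run w).2.elem = 1 := by
  rw [← map_eq_one_iff _ (doubleEmbedding_injective (lampSubgroup A))]
  refine (Eq.congr_left (doubleEmbedding_wordValue A w)).trans ?_
  rw [SemidirectProduct.ext_iff]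
  simp

end NormalForm

/-! ### The word problem relative to the set -/

section Check

/-- The lists of switched lamps are only extended and never cancelled. The last list can thus serve
as a common window for all cosets that occur. -/
theorem foldl_runStep_subset (w : Word (Fin 4)) (s : List (LampCode × Bool) × LampCode)
    (hs : ∀ y ∈ s.1, y.1.1 ⊆ s.2.1) :
    ∀ y ∈ (w.foldl runStep s).1, y.1.1 ⊆ (w.foldl runStep s).2.1 := by
  induction w generalizing s with
  | nil => exact hs
  | cons l w ih =>
    refine ih _ ?_
    have hmove : s.2.1 ⊆ (s.2.move l.1 l.2).1 := by
      rw [LampCode.move]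
      split_ifs <;> simp
    intro y hy
    change y.1.1 ⊆ (s.2.move l.1 l.2).1
    rw [runStep] at hy
    dsimp only at hy
    split_ifs at hy
    · exact List.Subset.trans (hs y hy) hmove
    · simp only [List.mem_append, List.mem_cons, List.not_mem_nil, or_false] at hy
      rcases hy with hy | rfl | rfl
      · exact List.Subset.trans (hs y hy) hmove
      · exact hmove
      · exact List.Subset.refl _

theorem run_subset (w : Word (Fin 4)) : ∀ y ∈ (run w).1, y.1.1 ⊆ (run w).2.1 :=
  foldl_runStep_subset w _ (by simp)

/-- A normal form of the coset of an element whose lamps belong to the list `W`. -/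
def cosetCode (χ : ℤ → Prop) [DecidablePred χ] (W : List ℤ) (x : LampCode) : List ℕ × ℤ :=
  (W.map fun i => if χ (i - x.2) then 0 else x.1.count i % 2, x.2)

/-- Right multiplication of `x` by $u_j$ switches the lamp $j$ + `x.2`. The coset therefore
remembers the shift and the parities at those positions `i` for which `i - x.2` is outside `A`.
Positions outside `W` carry no lamp of either element. -/
theorem cosetCode_eq_iff {A : Set ℤ} [DecidablePred (· ∈ A)] {W : List ℤ} {x y : LampCode}
    (hx : x.1 ⊆ W) (hy : y.1 ⊆ W) :
    cosetCode (· ∈ A) W x = cosetCode (· ∈ A) W y ↔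
      (x.elem : Lamplighter ⧸ lampSubgroup A) = y.elem := by
  have hleft : ∀ i, Multiplicative.toAdd (x.elem⁻¹ * y.elem).left i =
      (y.1.count (i + x.2) : ZMod 2) - x.1.count (i + x.2) := by
    intro i
    rw [SemidirectProduct.mul_left, SemidirectProduct.inv_left, SemidirectProduct.inv_right,
      ← map_mul, shiftHom_apply, toAdd_mul, toAdd_inv, Finsupp.add_apply, Finsupp.neg_apply,
      LampCode.elem_left, LampCode.elem_left, LampCode.elem_right]
    simp only [toAdd_inv, toAdd_ofAdd, sub_neg_eq_add]
    ring
  have hright : (x.elem⁻¹ * y.elem).right = 1 ↔ x.2 = y.2 := by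
    rw [SemidirectProduct.mul_right, SemidirectProduct.inv_right, LampCode.elem_right,
      LampCode.elem_right, inv_mul_eq_one, Multiplicative.ofAdd.injective.eq_iff]
  rw [QuotientGroup.eq, mem_lampSubgroup, hright]
  simp only [hleft, cosetCode, Prod.mk.injEq, List.map_inj_left]
  rw [and_comm]
  refine and_congr_right fun h2 => ?_
  rw [← h2]
  have hz : ∀ a b : ℕ, (b : ZMod 2) - a = 0 ↔ a % 2 = b % 2 := by
    intro a b
    rw [sub_eq_zero, ZMod.natCast_eq_natCast_iff', eq_comm]
  constructor
  · intro h i hi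
    rw [hz]
    by_cases hW : i + x.2 ∈ W
    · have := h _ hW
      rwa [add_sub_cancel_right, if_neg hi, if_neg hi] at this
    · rw [List.count_eq_zero_of_not_mem fun h => hW (hx h),
        List.count_eq_zero_of_not_mem fun h => hW (hy h)]
  · intro h i _
    split_ifs with hi
    · rfl
    · have := h _ hi
      rwa [hz, sub_add_cancel] at this

/-- A relabelling of letters is a morphism of free groups. The hypothesis makes the relabelling
consistent on the letters that occur, and its other values are arbitrary. -/
theorem mk_map_eq_one_of {α β γ : Type*} {f : α → β} {g : α → γ} {v : List (α × Bool)}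
    (h : ∀ x ∈ v, ∀ y ∈ v, f x.1 = f y.1 → g x.1 = g y.1)
    (hf : FreeGroup.mk (v.map fun x => (f x.1, x.2)) = 1) :
    FreeGroup.mk (v.map fun x => (g x.1, x.2)) = 1 := by
  classical
  rcases v with _ | ⟨z, v⟩
  · rfl
  set v' := z :: v
  have hk : ∃ k : β → γ, ∀ x ∈ v', k (f x.1) = g x.1 := by
    refine ⟨fun b => if hb : ∃ x ∈ v', f x.1 = b then g hb.choose.1 else g z.1, fun x hx => ?_⟩
    have hb : ∃ y ∈ v', f y.1 = f x.1 := ⟨x, hx, rfl⟩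
    refine (dif_pos hb).trans ?_
    exact h _ hb.choose_spec.1 _ hx hb.choose_spec.2
  obtain ⟨k, hk⟩ := hk
  have h1 := congrArg (FreeGroup.map k) hf
  rw [FreeGroup.map.mk, map_one, List.map_map] at h1
  rw [← h1]
  congr 1
  exact List.map_congr_left fun x hx => by simp [hk x hx]

theorem mk_map_eq_one_iff {α β γ : Type*} {f : α → β} {g : α → γ} {v : List (α × Bool)}
    (h : ∀ x ∈ v, ∀ y ∈ v, (f x.1 = f y.1 ↔ g x.1 = g y.1)) :
    FreeGroup.mk (v.map fun x => (f x.1, x.2)) = 1 ↔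
      FreeGroup.mk (v.map fun x => (g x.1, x.2)) = 1 :=
  ⟨mk_map_eq_one_of fun x hx y hy => (h x hx y hy).1,
    mk_map_eq_one_of fun x hx y hy => (h x hx y hy).2⟩

theorem LampCode.elem_eq_one_iff (x : LampCode) :
    x.elem = 1 ↔ x.2 = 0 ∧ ∀ i ∈ x.1, x.1.count i % 2 = 0 := by
  rw [SemidirectProduct.ext_iff, elem_right, and_comm]
  refine and_congr ⟨fun h => h, fun h => congrArg Multiplicative.ofAdd h⟩ ?_
  have hz : ∀ a : ℕ, (a : ZMod 2) = 0 ↔ a % 2 = 0 := fun a => by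
    rw [ZMod.natCast_eq_zero_iff, Nat.dvd_iff_mod_eq_zero]
  constructor
  · intro h i _
    rw [← hz, ← elem_left, h]
    rfl
  · intro h
    refine Multiplicative.toAdd.injective (Finsupp.ext fun i => ?_)
    rw [elem_left]
    change _ = (0 : ZMod 2)
    rw [hz]
    by_cases hi : i ∈ x.1
    · exact h i hi
    · rw [List.count_eq_zero_of_not_mem hi]

/-- The test that decides the word problem of Dyson's group when it is given the characteristic
function of the set. -/
def TrivialTest (χ : ℤ → Prop) [DecidablePred χ] (w : Word (Fin 4)) : Prop :=
  FreeGroup.mk ((run w).1.map fun y => (cosetCode χ (run w).2.1 y.1, y.2)) = 1 ∧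
    (run w).2.2 = 0 ∧ ∀ i ∈ (run w).2.1, (run w).2.1.count i % 2 = 0

theorem trivialTest_iff (A : Set ℤ) [DecidablePred (· ∈ A)] (w : Word (Fin 4)) :
    TrivialTest (· ∈ A) w ↔ wordValue (dysonGen A) w = 1 := by
  rw [wordValue_dysonGen_eq_one_iff, LampCode.elem_eq_one_iff, TrivialTest, cosetValue]
  refine and_congr_left fun _ => mk_map_eq_one_iff
    (f := cosetCode (· ∈ A) (run w).2.1)
    (g := fun y : LampCode => (y.elem : Lamplighter ⧸ lampSubgroup A)) fun x hx y hy => ?_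
  exact cosetCode_eq_iff (run_subset w x hx) (run_subset w y hy)

/-- The integers on which the test depends. -/
def window (w : Word (Fin 4)) : List ℤ :=
  (run w).1.flatMap fun y => (run w).2.1.map fun i => i - y.1.2

theorem trivialTest_congr {χ χ' : ℤ → Prop} [DecidablePred χ] [DecidablePred χ'] {w : Word (Fin 4)}
    (h : ∀ i ∈ window w, (χ i ↔ χ' i)) : TrivialTest χ w ↔ TrivialTest χ' w := by
  have h1 : (run w).1.map (fun y => (cosetCode χ (run w).2.1 y.1, y.2)) =
      (run w).1.map fun y => (cosetCode χ' (run w).2.1 y.1, y.2) := by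
    refine List.map_congr_left fun y hy => ?_
    congr 1
    rw [cosetCode, cosetCode]
    congr 1
    refine List.map_congr_left fun i hi => ?_
    have := h (i - y.1.2) (List.mem_flatMap.2 ⟨y, hy, List.mem_map.2 ⟨i, hi, rfl⟩⟩)
    simp only [this]
  rw [TrivialTest, TrivialTest, h1]

/-- More identifications give a quotient: the generators of $L(B)$ satisfy the relations of $L(A)$.
-/
theorem wordValue_eq_one_mono {A B : Set ℤ} (hAB : A ⊆ B) {w : Word (Fin 4)}
    (h : wordValue (dysonGen A) w = 1) : wordValue (dysonGen B) w = 1 := by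
  have hrel : DysonRel A (dysonGen B) := by
    obtain ⟨h1, h2, h3⟩ := dysonRel_dysonGen (A := B)
    exact ⟨h1, h2, fun i hi => h3 i (hAB hi)⟩
  obtain ⟨φ, hφ⟩ := exists_dyson_hom hrel
  have h1 := map_wordValue (dysonGen A) φ w
  rw [h, map_one] at h1
  rw [h1]
  congr 1
  exact (funext hφ).symm

/-- The test asks only about the window, so the elements of `A` in the window are a sufficient
certificate. Any other list inside `A` is sound by monotonicity. -/
theorem wordValue_eq_one_iff_exists (A : Set ℤ) (w : Word (Fin 4)) :
    wordValue (dysonGen A) w = 1 ↔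
      ∃ l : List ℤ, (∀ i ∈ l, i ∈ A) ∧ TrivialTest (fun z => z ∈ l) w := by
  classical
  constructor
  · intro h
    refine ⟨(window w).filter fun i => i ∈ A, by simp, ?_⟩
    rw [← trivialTest_iff] at h
    refine (trivialTest_congr fun i hi => ?_).1 h
    simp [hi]
  · rintro ⟨l, hl, h⟩
    exact wordValue_eq_one_mono hl ((trivialTest_iff {z | z ∈ l} w).1 h)

/-- The certificate `l` must contain the part of `A` in the window, and it may be too large. This is
harmless: a word trivial in $L(A)$ would be trivial in $L(A \cap l)$, which gives the same test, and
then in its quotient $L(l)$. Only non-membership in `A` has to be confirmed, so an enumeration of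
the complement suffices. -/
theorem wordValue_ne_one_iff_exists (A : Set ℤ) (w : Word (Fin 4)) :
    wordValue (dysonGen A) w ≠ 1 ↔
      ∃ l : List ℤ, (∀ i ∈ window w, i ∈ l ∨ i ∉ A) ∧ ¬TrivialTest (fun z => z ∈ l) w := by
  classical
  constructor
  · intro h
    refine ⟨(window w).filter fun i => i ∈ A, fun i hi => ?_, ?_⟩
    · by_cases hA : i ∈ A
      · exact Or.inl (by simp [hi, hA])
      · exact Or.inr hA
    · rw [Ne, ← trivialTest_iff] at h
      refine fun h' => h ((trivialTest_congr fun i hi => ?_).1 h')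
      simp [hi]
  · rintro ⟨l, hl, h⟩ hw
    refine h ?_
    rw [← trivialTest_iff] at hw
    have h1 : TrivialTest (fun z => z ∈ {i | i ∈ A ∧ i ∈ l}) w := by
      refine (trivialTest_congr fun i hi => ?_).1 hw
      simp only [Set.mem_ofPred_eq]
      rcases hl i hi with h | h <;> tauto
    rw [trivialTest_iff] at h1
    exact (trivialTest_iff {z | z ∈ l} w).2 (wordValue_eq_one_mono (fun i hi => hi.2) h1)

end Check

/-! ### Primitive recursiveness of the test, and the first part of the theorem -/

section Primrec

theorem primrec_move : Primrec fun p : LampCode × Fin 4 × Bool => p.1.move p.2.1 p.2.2 := by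
  have hn : Primrec fun p : LampCode × Fin 4 × Bool => p.1.2 := Primrec.snd.comp Primrec.fst
  have hT : Primrec fun p : LampCode × Fin 4 × Bool => p.1.1 := Primrec.fst.comp Primrec.fst
  have hi : Primrec fun p : LampCode × Fin 4 × Bool => p.2.1 := Primrec.fst.comp Primrec.snd
  refine Primrec.ite
    (PrimrecPred.or (Primrec.eq.comp hi (Primrec.const 0)) (Primrec.eq.comp hi (Primrec.const 2)))
    (Primrec.pair hT (Primrec.ite (Primrec.eq.comp (Primrec.snd.comp Primrec.snd)
      (Primrec.const true)) (primrec_int_add.comp hn (Primrec.const 1))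
      (primrec_int_sub.comp hn (Primrec.const 1))))
    (Primrec.pair (Primrec.list_concat.comp hT hn) hn)

theorem primrec_runStep : Primrec₂ runStep := by
  have hi : Primrec fun p : (List (LampCode × Bool) × LampCode) × Fin 4 × Bool => p.2.1 :=
    Primrec.fst.comp Primrec.snd
  have hv : Primrec fun p : (List (LampCode × Bool) × LampCode) × Fin 4 × Bool => p.1.1 :=
    Primrec.fst.comp Primrec.fst
  have hx : Primrec fun p : (List (LampCode × Bool) × LampCode) × Fin 4 × Bool => p.1.2 :=
    Primrec.snd.comp Primrec.fst
  have hm : Primrec fun p : (List (LampCode × Bool) × LampCode) × Fin 4 × Bool =>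
      p.1.2.move p.2.1 p.2.2 := primrec_move.comp (Primrec.pair hx Primrec.snd)
  exact Primrec.pair (Primrec.ite
    (PrimrecPred.or (Primrec.eq.comp hi (Primrec.const 0)) (Primrec.eq.comp hi (Primrec.const 1)))
    hv (Primrec.list_append.comp hv (Primrec.list_cons.comp (Primrec.pair hx (Primrec.const false))
      (Primrec.list_cons.comp (Primrec.pair hm (Primrec.const true)) (Primrec.const []))))) hm

theorem primrec_run : Primrec run :=
  Primrec.list_foldl Primrec.id (Primrec.const ([], ([], 0)))
    (primrec_runStep.comp (Primrec.fst.comp Primrec.snd) (Primrec.snd.comp Primrec.snd)).to₂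

theorem primrec_count : Primrec₂ fun (l : List ℤ) (i : ℤ) => l.count i := by
  have h : PrimrecRel fun a b : ℤ => a = b := Primrec.eq
  refine (Primrec.list_length.comp h.listFilter).of_eq fun p => ?_
  simp only [List.count_eq_length_filter]
  congr 2

theorem primrec_mem : PrimrecRel fun (l : List ℤ) (i : ℤ) => i ∈ l := by
  have h : PrimrecRel fun a b : ℤ => a = b := Primrec.eq
  refine (PrimrecRel.exists_mem_list h).of_eq fun l i => ?_
  simp

theorem primrec_cosetCode : Primrec fun p : (List ℤ × List ℤ) × LampCode =>
    cosetCode (fun z => z ∈ p.1.1) p.1.2 p.2 := by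
  refine Primrec.pair (Primrec.list_map (Primrec.snd.comp Primrec.fst) ?_)
    (Primrec.snd.comp Primrec.snd)
  refine Primrec.ite (c := fun p : ((List ℤ × List ℤ) × LampCode) × ℤ => p.2 - p.1.2.2 ∈ p.1.1.1)
    ?_ (Primrec.const 0) ?_
  · exact primrec_mem.comp (Primrec.fst.comp (Primrec.fst.comp Primrec.fst))
      (primrec_int_sub.comp Primrec.snd (Primrec.snd.comp (Primrec.snd.comp Primrec.fst)))
  · exact Primrec.nat_mod.comp (primrec_count.comp
      (Primrec.fst.comp (Primrec.snd.comp Primrec.fst)) Primrec.snd) (Primrec.const 2)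

theorem primrec_window : Primrec window :=
  Primrec.list_flatMap (Primrec.fst.comp primrec_run)
    (Primrec.list_map (Primrec.fst.comp (Primrec.snd.comp (primrec_run.comp Primrec.fst)))
      (primrec_int_sub.comp Primrec.snd
        (Primrec.snd.comp (Primrec.fst.comp (Primrec.snd.comp Primrec.fst)))).to₂).to₂

theorem primrec_trivialTest :
    PrimrecPred fun p : Word (Fin 4) × List ℤ => TrivialTest (fun z => z ∈ p.2) p.1 := by
  have hr : Primrec fun p : Word (Fin 4) × List ℤ => run p.1 := primrec_run.comp Primrec.fst
  have hT : Primrec fun p : Word (Fin 4) × List ℤ => (run p.1).2.1 :=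
    Primrec.fst.comp (Primrec.snd.comp hr)
  refine PrimrecPred.and ?_ (PrimrecPred.and
    (Primrec.eq.comp (Primrec.snd.comp (Primrec.snd.comp hr)) (Primrec.const 0)) ?_)
  · refine primrec_mk_eq_one.comp (Primrec.list_map (Primrec.fst.comp hr) ?_)
    exact Primrec.pair (primrec_cosetCode.comp (Primrec.pair (Primrec.pair
      (Primrec.snd.comp Primrec.fst) (hT.comp Primrec.fst)) (Primrec.fst.comp Primrec.snd)))
      (Primrec.snd.comp Primrec.snd)
  · have h : PrimrecRel fun (i : ℤ) (T : List ℤ) => T.count i % 2 = 0 :=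
      Primrec.eq.comp (Primrec.nat_mod.comp (primrec_count.comp Primrec.snd Primrec.fst)
        (Primrec.const 2)) (Primrec.const 0)
    exact (PrimrecRel.forall_mem_list h).comp hT hT

theorem rePred_wordValue_eq_one {A : Set ℤ} (hA : REPred fun z : ℤ => z ∈ A) :
    REPred fun w => wordValue (dysonGen A) w = 1 := by
  have h1 : REPred fun p : Word (Fin 4) × List ℤ => ∀ i ∈ p.2, i ∈ A :=
    rePred_comp (rePred_forall_mem hA) Computable.snd
  exact (rePred_exists (p := fun w l => (∀ i ∈ l, i ∈ A) ∧ TrivialTest (fun z => z ∈ l) w)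
    (rePred_and h1 (rePred_of_primrecPred primrec_trivialTest))).of_eq
      fun w => (wordValue_eq_one_iff_exists A w).symm

theorem rePred_wordValue_ne_one {A : Set ℤ} (hA : REPred fun z : ℤ => z ∉ A) :
    REPred fun w => wordValue (dysonGen A) w ≠ 1 := by
  have h0 : REPred fun x : ℤ × List ℤ => x.1 ∈ x.2 ∨ x.1 ∉ A :=
    rePred_or (rePred_of_primrecPred (primrec_mem.comp Primrec.snd Primrec.fst))
      (rePred_comp hA Computable.fst)
  have h1 : REPred fun p : Word (Fin 4) × List ℤ => ∀ i ∈ window p.1, i ∈ p.2 ∨ i ∉ A := by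
    have hc : Primrec fun p : Word (Fin 4) × List ℤ => (window p.1).map fun i => (i, p.2) :=
      Primrec.list_map (primrec_window.comp Primrec.fst)
        (Primrec.pair Primrec.snd (Primrec.snd.comp Primrec.fst))
    refine (rePred_comp (rePred_forall_mem h0) hc.to_comp).of_eq fun p => ?_
    simp
  exact (rePred_exists (p := fun w l =>
    (∀ i ∈ window w, i ∈ l ∨ i ∉ A) ∧ ¬TrivialTest (fun z => z ∈ l) w)
    (rePred_and h1 (rePred_of_primrecPred primrec_trivialTest.not))).of_eq
      fun w => (wordValue_ne_one_iff_exists A w).symm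

theorem isRecursivelyPresented_iff (A : Set ℤ) :
    IsRecursivelyPresented (DysonGroup A) ↔ REPred fun z : ℤ => z ∈ A := by
  refine ⟨fun h => ?_, fun h => isRecursivelyPresented_of_rePred generates_dysonGen
    (rePred_wordValue_eq_one h)⟩
  obtain ⟨n, S, hS, h⟩ := exists_rePred_of_isRecursivelyPresented h
  obtain ⟨f, hf, hfA⟩ := exists_reduction_to_wordProblem hS
  exact (rePred_comp h hf.to_comp).of_eq hfA

theorem isCoRE_iff (A : Set ℤ) :
    IsCoRE (DysonGroup A) ↔ REPred fun z : ℤ => z ∉ A := by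
  refine ⟨fun ⟨n, S, hS, h⟩ => ?_, fun h => ⟨4, dysonGen A, generates_dysonGen,
    rePred_wordValue_ne_one h⟩⟩
  obtain ⟨f, hf, hfA⟩ := exists_reduction_to_wordProblem hS
  exact (rePred_comp h hf.to_comp).of_eq fun z => not_congr (hfA z)

theorem hasSolvableWordProblem_iff (A : Set ℤ) :
    HasSolvableWordProblem (DysonGroup A) ↔ ComputablePred fun z : ℤ => z ∈ A := by
  refine ⟨fun ⟨n, S, hS, h⟩ => ?_, fun h => ⟨4, dysonGen A, generates_dysonGen, ?_⟩⟩
  · obtain ⟨f, hf, hfA⟩ := exists_reduction_to_wordProblem hS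
    exact (computablePred_comp h hf.to_comp).of_eq hfA
  -- Post's theorem, applied to the set and to the trivial words.
  · rw [ComputablePred.computable_iff_re_compl_re'] at h ⊢
    exact ⟨rePred_wordValue_eq_one h.1, rePred_wordValue_ne_one h.2⟩

end Primrec

/-! ### Residual finiteness of free groups and of semidirect products -/

section ResiduallyFiniteGroups

/-- A partial injection of a finite set extends to a permutation. -/
theorem exists_perm_extending {X : Type*} [Finite X] (r : X → X → Prop)
    (h1 : ∀ x y y', r x y → r x y' → y = y') (h2 : ∀ x x' y, r x y → r x' y → x = x') :
    ∃ σ : Equiv.Perm X, ∀ x y, r x y → σ x = y := by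
  classical
  have := Fintype.ofFinite X
  choose f hf using fun x : {x // ∃ y, r x y} => x.2
  let e : {x // ∃ y, r x y} ≃ {y // ∃ x, r x y} :=
    Equiv.ofBijective (fun x => ⟨f x, x, hf x⟩) (by
      constructor
      · intro x x' h
        have h3 : f x = f x' := congrArg Subtype.val h
        exact Subtype.ext (h2 _ _ _ (hf x) (h3 ▸ hf x'))
      · rintro ⟨y, x, hxy⟩
        exact ⟨⟨x, y, hxy⟩, Subtype.ext (h1 _ _ _ (hf _) hxy)⟩)
  refine ⟨e.extendSubtype, fun x y hxy => ?_⟩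
  rw [Equiv.extendSubtype_apply_of_mem e x ⟨y, hxy⟩]
  exact h1 _ _ _ (hf _) hxy

theorem isReduced_getElem? {X : Type*} {w : List (X × Bool)} (hw : FreeGroup.IsReduced w) {i : ℕ}
    {a : X} {b c : Bool} (h1 : w[i]? = some (a, b)) (h2 : w[i + 1]? = some (a, c)) : b = c := by
  obtain ⟨hi, h1⟩ := List.getElem?_eq_some_iff.1 h1
  obtain ⟨hj, h2⟩ := List.getElem?_eq_some_iff.1 h2
  have h := List.isChain_iff_getElem.1 hw i hj
  rw [h1, h2] at h
  exact h rfl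

/-- Free groups are residually finite: the permutations that describe the motion along a reduced
word extend to a morphism to a finite symmetric group. -/
theorem exists_perm_ne_one {X : Type*} {x : FreeGroup X} (hx : x ≠ 1) :
    ∃ (n : ℕ) (φ : FreeGroup X →* Equiv.Perm (Fin n)), φ x ≠ 1 := by
  classical
  set w := x.toWord with hw
  have hred : FreeGroup.IsReduced w := FreeGroup.isReduced_toWord
  have hpos : w.length ≠ 0 := by
    rw [Ne, List.length_eq_zero_iff, hw, FreeGroup.toWord_eq_nil_iff]
    exact hx
  -- The points are the gaps of the word. The letter at position `j` has to move `j + 1` to `j`,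
  -- which for an inverse letter means that its generator moves `j` to `j + 1`. Two clashing demands
  -- on one generator would come from adjacent cancelling letters.
  let r : X → Fin (w.length + 1) → Fin (w.length + 1) → Prop := fun a p q =>
    (w[(q : ℕ)]? = some (a, true) ∧ (p : ℕ) = q + 1) ∨
      (w[(p : ℕ)]? = some (a, false) ∧ (q : ℕ) = p + 1)
  have hr : ∀ a, ∃ σ : Equiv.Perm (Fin (w.length + 1)), ∀ p q, r a p q → σ p = q := by
    intro a
    refine exists_perm_extending (r a) ?_ ?_
    · rintro p q q' (⟨h, e⟩ | ⟨h, e⟩) (⟨h', e'⟩ | ⟨h', e'⟩)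
      · exact Fin.ext (by omega)
      · rw [e] at h'
        exact absurd (isReduced_getElem? hred h h') (by simp)
      · rw [e'] at h
        exact absurd (isReduced_getElem? hred h' h) (by simp)
      · exact Fin.ext (by omega)
    · rintro p p' q (⟨h, e⟩ | ⟨h, e⟩) (⟨h', e'⟩ | ⟨h', e'⟩)
      · exact Fin.ext (by omega)
      · rw [e'] at h
        exact absurd (isReduced_getElem? hred h' h) (by simp)
      · rw [e] at h'
        exact absurd (isReduced_getElem? hred h h') (by simp)
      · exact Fin.ext (by omega)
  choose σ hσ using hr
  refine ⟨w.length + 1, FreeGroup.lift σ, fun h => ?_⟩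
  -- Words act from the right end, so the suffix that starts at `j` carries the last point to `j`.
  -- The case `j = 0` shows that `x` moves the last point.
  have key : ∀ k j (hj : j < w.length + 1), j + k = w.length →
      FreeGroup.lift σ (FreeGroup.mk (w.drop j)) (Fin.last _) = ⟨j, hj⟩ := by
    intro k
    induction k with
    | zero =>
      intro j hj hk
      have h1 : w.drop j = [] := List.drop_eq_nil_of_le (by omega)
      rw [h1]
      exact Fin.ext hk.symm
    | succ k ih =>
      intro j hj hk
      have hlt : j < w.length := by omega
      rw [List.drop_eq_getElem_cons hlt]
      change FreeGroup.lift σ (FreeGroup.mk ([w[j]] ++ w.drop (j + 1))) _ = _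
      rw [← FreeGroup.mul_mk, map_mul, Equiv.Perm.mul_apply, ih (j + 1) (by omega) (by omega)]
      have h2 : w[j]? = some w[j] := List.getElem?_eq_getElem hlt
      generalize w[j] = l at h2
      obtain ⟨a, b⟩ := l
      cases b
      · have h3 : σ a ⟨j, hj⟩ = ⟨j + 1, by omega⟩ := hσ _ _ _ (Or.inr ⟨h2, rfl⟩)
        simp only [FreeGroup.lift_mk, List.map_cons, List.map_nil, List.prod_singleton, cond_false]
        rw [Equiv.Perm.inv_eq_iff_eq]
        exact h3.symm
      · simp only [FreeGroup.lift_mk, List.map_cons, List.map_nil, List.prod_singleton, cond_true]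
        exact hσ _ _ _ (Or.inl ⟨h2, rfl⟩)
  have h0 := key w.length 0 (by omega) (by omega)
  have h1 : FreeGroup.mk w = x := FreeGroup.mk_toWord
  rw [List.drop_zero, h1, h, Equiv.Perm.one_apply] at h0
  exact hpos (congrArg Fin.val h0)

instance residuallyFinite_freeGroup (X : Type*) : Group.ResiduallyFinite (FreeGroup X) := by
  rw [Group.residuallyFinite_iff_exists_finiteIndex]
  intro x hx
  obtain ⟨n, φ, hφ⟩ := exists_perm_ne_one hx
  exact ⟨φ.ker, Subgroup.finiteIndex_ker φ, hφ⟩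

theorem exists_finiteIndex_of_hom {G K : Type*} [Group G] [Group K] [Group.ResiduallyFinite K]
    (φ : G →* K) {g : G} (hg : φ g ≠ 1) : ∃ N : Subgroup G, N.FiniteIndex ∧ g ∉ N := by
  obtain ⟨N, hN, h⟩ := Group.residuallyFinite_iff_exists_finiteIndex.1 ‹_› _ hg
  refine ⟨N.comap φ, ⟨?_⟩, h⟩
  rw [Subgroup.index_comap]
  exact (inferInstance : (N.subgroupOf φ.range).FiniteIndex).index_ne_zero

/-- A semidirect product of a residually finite group and a finite group is residually finite. -/
theorem residuallyFinite_semidirectProduct {N G : Type*} [Group N] [Group G]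
    [Group.ResiduallyFinite N] [Finite G] (φ : G →* MulAut N) :
    Group.ResiduallyFinite (N ⋊[φ] G) := by
  rw [Group.residuallyFinite_iff_exists_finiteIndex]
  intro x hx
  by_cases hr : x.right = 1
  · have hl : x.left ≠ 1 := fun hl => hx (SemidirectProduct.ext hl hr)
    obtain ⟨K, hK, h⟩ := Group.residuallyFinite_iff_exists_finiteIndex.1 ‹_› _ hl
    refine ⟨K.map SemidirectProduct.inl, ⟨?_⟩, ?_⟩
    · rw [Subgroup.index_map_of_injective _ SemidirectProduct.inl_injective,
        SemidirectProduct.range_inl_eq_ker_rightHom]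
      exact mul_ne_zero hK.index_ne_zero
        (Subgroup.finiteIndex_ker (SemidirectProduct.rightHom (φ := φ))).index_ne_zero
    · rintro ⟨y, hy, rfl⟩
      exact h hy
  · exact exists_finiteIndex_of_hom SemidirectProduct.rightHom hr

end ResiduallyFiniteGroups

/-! ### Residual finiteness of doubles -/

section DoubleResiduallyFinite

variable {G G' : Type*} [Group G] [Group G']

/-- The map of cosets induced by a morphism. -/
def cosetMap {H : Subgroup G} {K : Subgroup G'} (g : G →* G') (hg : ∀ x ∈ H, g x ∈ K) :
    G ⧸ H → G' ⧸ K :=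
  Quotient.map' g fun x y hxy => by
    rw [QuotientGroup.leftRel_apply] at hxy ⊢
    rw [← map_inv, ← map_mul]
    exact hg _ hxy

theorem cosetMap_mk {H : Subgroup G} {K : Subgroup G'} (g : G →* G') (hg : ∀ x ∈ H, g x ∈ K)
    (x : G) : cosetMap g hg (x : G ⧸ H) = (g x : G' ⧸ K) := rfl

/-- Passing to a quotient of the factor acts on the free component by relabelling the cosets. A
nontrivial free component thus survives when the relabelling keeps its letters apart. -/
theorem doubleHom_eq_map {H : Subgroup G} {K : Subgroup G'} (g : G →* G')
    (hg : ∀ x ∈ H, g x ∈ K) : ∃ Ψ : CosetProduct H →* CosetProduct K,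
      Ψ.comp (doubleEmbedding H) = doubleHom g hg ∧
        ∀ x, (Ψ x).left = FreeGroup.map (cosetMap g hg) x.left := by
  refine ⟨SemidirectProduct.map (FreeGroup.map (cosetMap g hg)) g fun x =>
    FreeGroup.ext_hom _ _ fun q => ?_, Double.hom_ext fun c x => ?_, fun x => rfl⟩
  · induction q using QuotientGroup.induction_on with
    | H y =>
      simp only [MonoidHom.comp_apply, MulEquiv.toMonoidHom_eq_coe, MonoidHom.coe_coe,
        cosetAction_of, FreeGroup.map.of, MulAction.Quotient.smul_coe, smul_eq_mul, cosetMap_mk,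
        map_mul]
  · fin_cases c
    · simp only [MonoidHom.comp_apply, doubleEmbedding, Fin.zero_eta, doubleHom_of_zero,
        SemidirectProduct.map_inr]
      rfl
    · simp only [MonoidHom.comp_apply, doubleEmbedding, Fin.mk_one, doubleHom_of_one,
        cosetConj_eq_inl_mul_inr, map_mul, SemidirectProduct.map_inr, SemidirectProduct.map_inl,
        map_inv, FreeGroup.map.of, cosetMap_mk, map_one, MonoidHom.id_apply]

/-- The double of a residually finite group along a subgroup that is closed in the profinite
topology is residually finite. -/
theorem residuallyFinite_double [Group.ResiduallyFinite G] (H : Subgroup G)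
    (hH : ∀ x ∉ H, ∃ N : Subgroup G, N.FiniteIndex ∧ H ≤ N ∧ x ∉ N) :
    Group.ResiduallyFinite (Double H) := by
  classical
  have hfin : ∀ s : Finset G, (∀ x ∈ s, x ∉ H) →
      ∃ N : Subgroup G, N.FiniteIndex ∧ H ≤ N ∧ ∀ x ∈ s, x ∉ N := by
    intro s
    induction s using Finset.induction_on with
    | empty => exact fun _ => ⟨⊤, inferInstance, le_top, by simp⟩
    | insert a s _ ih =>
      intro hs
      obtain ⟨N, hN, hHN, hx⟩ := ih fun x hx => hs x (Finset.mem_insert_of_mem hx)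
      obtain ⟨N', hN', hHN', hx'⟩ := hH a (hs a (Finset.mem_insert_self _ _))
      refine ⟨N ⊓ N', inferInstance, le_inf hHN hHN', fun x hxs => ?_⟩
      rcases Finset.mem_insert.1 hxs with rfl | hxs
      · exact fun h => hx' h.2
      · exact fun h => hx x hxs h.1
  rw [Group.residuallyFinite_iff_exists_finiteIndex]
  intro d hd
  have hd' : doubleEmbedding H d ≠ 1 := by
    rwa [Ne, map_eq_one_iff _ (doubleEmbedding_injective H)]
  by_cases hr : (doubleEmbedding H d).right = 1
  · have hl : (doubleEmbedding H d).left ≠ 1 := fun hl => hd' (SemidirectProduct.ext hl hr)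
    set v := (doubleEmbedding H d).left.toWord with hv
    -- The elements $x^{-1}y$, for representatives of two distinct cosets in the word: keeping these
    -- outside a subgroup containing `H` keeps the cosets apart.
    let s : Finset G := ((v.flatMap fun p => v.map fun q => p.1.out⁻¹ * q.1.out).toFinset).filter
      fun x => x ∉ H
    obtain ⟨N, hN, hHN, hs⟩ := hfin s fun x hx => (Finset.mem_filter.1 hx).2
    -- The normal core makes the quotient finite and is contained in `N`, so two letters with equal
    -- images would have representatives differing by an element of `N`.
    let g : G →* G ⧸ N.normalCore := QuotientGroup.mk' N.normalCore
    have hg : ∀ x ∈ H, g x ∈ N.map g := fun x hx => Subgroup.mem_map_of_mem g (hHN hx)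
    obtain ⟨Ψ, hΨ, hΨl⟩ := doubleHom_eq_map g hg
    have := residuallyFinite_semidirectProduct (cosetAction (N.map g))
    refine exists_finiteIndex_of_hom (doubleHom g hg) (g := d) fun h1 => hl ?_
    have h2 : FreeGroup.map (cosetMap g hg) (FreeGroup.mk v) = 1 := by
      rw [hv, FreeGroup.mk_toWord, ← hΨl, ← MonoidHom.comp_apply, hΨ, h1]
      rfl
    rw [FreeGroup.map.mk] at h2
    have h3 := mk_map_eq_one_of (f := cosetMap g hg) (g := id) (v := v) ?_ h2
    · simp only [id, List.map_id'] at h3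
      rwa [hv, FreeGroup.mk_toWord] at h3
    · intro p hp q hq hpq
      by_contra hne
      have hout : ∀ r : G ⧸ H, ((r.out : G) : G ⧸ H) = r := fun r => QuotientGroup.out_eq' r
      have hmem : p.1.out⁻¹ * q.1.out ∈ s := by
        refine Finset.mem_filter.2 ⟨List.mem_toFinset.2 (List.mem_flatMap.2
          ⟨p, hp, List.mem_map.2 ⟨q, hq, rfl⟩⟩), fun h => hne ?_⟩
        have := QuotientGroup.eq.2 h
        rwa [hout, hout] at this
      refine hs _ hmem ?_
      rw [← hout p.1, ← hout q.1, cosetMap_mk, cosetMap_mk, QuotientGroup.eq, ← map_inv,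
        ← map_mul] at hpq
      obtain ⟨y, hy, hyx⟩ := hpq
      have h4 : y⁻¹ * (p.1.out⁻¹ * q.1.out) ∈ N.normalCore := QuotientGroup.eq.1 hyx
      have h5 := N.mul_mem hy (N.normalCore_le h4)
      rwa [mul_inv_cancel_left] at h5
  · exact exists_finiteIndex_of_hom (SemidirectProduct.rightHom.comp (doubleEmbedding H)) hr

end DoubleResiduallyFinite

/-! ### The profinite closure in terms of congruences -/

section ProfiniteTopology

theorem mem_profiniteClosure_iff {A : Set ℤ} {i : ℤ} :
    i ∈ profiniteClosure A ↔ ∀ p : ℤ, p ≠ 0 → ∃ j ∈ A, j ≡ i [ZMOD p] := by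
  let _ := profiniteTopology
  have hnhds : ∀ U : Set ℤ, IsOpen U → ∀ x ∈ U, ∃ p : ℤ, p ≠ 0 ∧ ∀ y, y ≡ x [ZMOD p] → y ∈ U := by
    intro U hU
    induction hU with
    | basic s hs =>
      obtain ⟨n, p, hp, rfl⟩ := hs
      exact fun x hx => ⟨p, hp, fun y hy => hy.trans hx⟩
    | univ => exact fun x _ => ⟨1, one_ne_zero, fun _ _ => trivial⟩
    | inter s t _ _ ihs iht =>
      intro x hx
      obtain ⟨p, hp, h⟩ := ihs x hx.1
      obtain ⟨q, hq, h'⟩ := iht x hx.2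
      exact ⟨p * q, mul_ne_zero hp hq, fun y hy =>
        ⟨h y (hy.of_mul_right q), h' y (hy.of_mul_left p)⟩⟩
    | sUnion S _ ih =>
      rintro x ⟨s, hs, hx⟩
      obtain ⟨p, hp, h⟩ := ih s hs x hx
      exact ⟨p, hp, fun y hy => ⟨s, hs, h y hy⟩⟩
  rw [profiniteClosure, mem_closure_iff]
  constructor
  · intro h p hp
    obtain ⟨j, hj, hA⟩ := h {x | x ≡ i [ZMOD p]}
      (TopologicalSpace.isOpen_generateFrom_of_mem ⟨i, p, hp, rfl⟩) (Int.ModEq.refl i)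
    exact ⟨j, hA, hj⟩
  · intro h U hU hi
    obtain ⟨p, hp, hpU⟩ := hnhds U hU i hi
    obtain ⟨j, hA, hj⟩ := h p hp
    exact ⟨j, hpU j hj, hA⟩

theorem subset_profiniteClosure (A : Set ℤ) : A ⊆ profiniteClosure A :=
  fun i hi => mem_profiniteClosure_iff.2 fun _ _ => ⟨i, hi, Int.ModEq.refl i⟩

theorem isClosed_iff_profiniteClosure_subset {A : Set ℤ} :
    @IsClosed ℤ profiniteTopology A ↔ profiniteClosure A ⊆ A :=
  letI := profiniteTopology
  ⟨fun h => h.closure_subset, isClosed_of_closure_subset⟩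

theorem profiniteClosure_profiniteClosure (A : Set ℤ) :
    profiniteClosure (profiniteClosure A) = profiniteClosure A :=
  letI := profiniteTopology
  closure_closure

end ProfiniteTopology

/-! ### Separating subgroups of lamps in finite quotients of the lamplighter group -/

section Separation

/-- The rotation of a cycle of lamps. -/
def cycleRotation (p : ℕ) : Equiv.Perm (ZMod p × ZMod 2) :=
  (Equiv.addRight 1).prodCongr (Equiv.refl _)

/-- The change of one of the lamps of the cycle. -/
def cycleFlip (p : ℕ) : Equiv.Perm (ZMod p × ZMod 2) :=
  Function.Involutive.toPerm (fun x => (x.1, if x.1 = 0 then x.2 + 1 else x.2)) (by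
    rintro ⟨r, s⟩
    by_cases hr : r = 0
    · simp [hr, add_assoc, CharTwo.add_self_eq_zero]
    · simp [hr])

theorem cycleFlip_apply (p : ℕ) (x : ZMod p × ZMod 2) :
    cycleFlip p x = (x.1, if x.1 = 0 then x.2 + 1 else x.2) := rfl

theorem cycleRotation_zpow (p : ℕ) (i : ℤ) (x : ZMod p × ZMod 2) :
    (cycleRotation p ^ i) x = (x.1 + i, x.2) := by
  induction i generalizing x with
  | zero => simp
  | succ i ih =>
    rw [zpow_add_one, Equiv.Perm.mul_apply, ih]
    refine Prod.ext ?_ rfl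
    simp only [cycleRotation, Equiv.prodCongr_apply, Prod.map_fst, Equiv.coe_addRight]
    push_cast
    ring
  | pred i ih =>
    rw [zpow_sub_one, Equiv.Perm.mul_apply, ih]
    have h : (cycleRotation p)⁻¹ x = (x.1 - 1, x.2) := by
      rw [Equiv.Perm.inv_eq_iff_eq]
      simp [cycleRotation]
    rw [h]
    refine Prod.ext ?_ rfl
    push_cast
    ring

/-- Rotating back by `i`, changing the lamp over `0` and rotating forward again changes the lamp
over the residue of `i`. -/
theorem cycleFlip_conj (p : ℕ) (i : ℤ) (x : ZMod p × ZMod 2) :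
    (cycleRotation p ^ i * cycleFlip p * cycleRotation p ^ (-i)) x =
      (x.1, if x.1 = i then x.2 + 1 else x.2) := by
  rw [Equiv.Perm.mul_apply, Equiv.Perm.mul_apply, cycleRotation_zpow, cycleRotation_zpow]
  have h : x.1 + ((-i : ℤ) : ZMod p) = 0 ↔ x.1 = i := by
    rw [Int.cast_neg, add_neg_eq_zero]
  rw [cycleFlip_apply]
  simp only [h]
  simp

theorem lampRel_cycle (p : ℕ) : LampRel (cycleRotation p) (cycleFlip p) := by
  constructor
  · ext x : 1
    rw [sq, Equiv.Perm.mul_apply]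
    exact Function.Involutive.toPerm_involutive _ x
  · intro i
    ext x : 1
    rw [Equiv.Perm.mul_apply (cycleFlip p), Equiv.Perm.mul_apply _ (cycleFlip p), cycleFlip_conj,
      cycleFlip_conj, cycleFlip_apply, cycleFlip_apply]
    dsimp only
    split_ifs <;> rfl

theorem exists_separating_subgroup_of_right (A : Set ℤ) {x : Lamplighter} (hr : x.right ≠ 1) :
    ∃ N : Subgroup Lamplighter, N.FiniteIndex ∧ lampSubgroup A ≤ N ∧ x ∉ N := by
  obtain ⟨n, hn⟩ := Multiplicative.ofAdd.surjective x.right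
  have hn0 : n ≠ 0 := by
    rintro rfl
    exact hr hn.symm
  -- The nonzero integer `n` is smaller in absolute value than the modulus, so its residue is
  -- nonzero. All lamps have trivial image.
  let φ : Lamplighter →* Multiplicative (ZMod (n.natAbs + 1)) :=
    (AddMonoidHom.toMultiplicative (Int.castAddHom (ZMod (n.natAbs + 1)))).comp
      SemidirectProduct.rightHom
  refine ⟨φ.ker, Subgroup.finiteIndex_ker φ, fun y hy => ?_, fun h => hn0 ?_⟩
  · have h1 : φ y = AddMonoidHom.toMultiplicative (Int.castAddHom _) y.right := rfl
    rw [MonoidHom.mem_ker, h1, (mem_lampSubgroup.1 hy).1, map_one]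
  · have h1 : φ x = Multiplicative.ofAdd ((n : ℤ) : ZMod (n.natAbs + 1)) := by
      change AddMonoidHom.toMultiplicative (Int.castAddHom _) x.right = _
      rw [← hn]
      rfl
    rw [MonoidHom.mem_ker, h1] at h
    have h2 : ((n : ℤ) : ZMod (n.natAbs + 1)) = 0 := h
    rw [ZMod.intCast_zmod_eq_zero_iff_dvd, Int.natCast_dvd] at h2
    by_contra h3
    exact absurd (Nat.le_of_dvd (Int.natAbs_pos.2 h3) h2) (by omega)

/-- In the action on a cycle of `p` lamps with two states, $u_j$ moves the point `(i, 0)` exactly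
when $j \equiv i$. The subgroup is the preimage of its stabilizer. -/
theorem exists_cycle_subgroup (p : ℕ) [NeZero p] (i : ℤ) : ∃ N : Subgroup Lamplighter,
    N.FiniteIndex ∧ ∀ j, lampU j ∈ N ↔ ¬i ≡ j [ZMOD p] := by
  obtain ⟨f, hfa, hfe⟩ := exists_lamp_hom (lampRel_cycle p)
  set K : Subgroup (Equiv.Perm (ZMod p × ZMod 2)) :=
    MulAction.stabilizer _ ((i : ZMod p), (0 : ZMod 2)) with hK
  refine ⟨K.comap f, ⟨?_⟩, fun j => ?_⟩
  · rw [Subgroup.index_comap]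
    exact (inferInstance : (K.subgroupOf f.range).FiniteIndex).index_ne_zero
  · have h1 : f (lampU j) = cycleRotation p ^ j * cycleFlip p * cycleRotation p ^ (-j) := by
      rw [lampU, map_mul, map_mul, map_zpow, map_zpow, hfa, hfe]
    rw [Subgroup.mem_comap, hK, MulAction.mem_stabilizer_iff, h1, Equiv.Perm.smul_def,
      cycleFlip_conj, ← ZMod.intCast_eq_intCast_iff]
    by_cases hij : (i : ZMod p) = j <;> simp [hij]

theorem exists_modulus {A : Set ℤ} (hA : profiniteClosure A ⊆ A) {i : ℤ} (hi : i ∉ A)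
    (s : Finset ℤ) : ∃ p : ℕ, p ≠ 0 ∧ (∀ j ∈ A, ¬i ≡ j [ZMOD p]) ∧
      ∀ j ∈ s, i ≡ j [ZMOD p] → j = i := by
  obtain ⟨q, hq, hqA⟩ : ∃ q : ℤ, q ≠ 0 ∧ ∀ j ∈ A, ¬j ≡ i [ZMOD q] := by
    have h := mt (fun h => hA h) hi
    rw [mem_profiniteClosure_iff] at h
    push Not at h
    exact h
  -- This exceeds every distance from `i` to an element of `s`, so divisibility by it forces
  -- equality. The other factor of the modulus keeps `i` away from `A`.
  set M : ℕ := 1 + ∑ j ∈ s, (j - i).natAbs with hM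
  refine ⟨q.natAbs * M, mul_ne_zero (Int.natAbs_ne_zero.2 hq) (by omega), ?_, ?_⟩
  · intro j hj hij
    have hqp : q ∣ ((q.natAbs * M : ℕ) : ℤ) := by
      rw [Nat.cast_mul]
      exact (Int.dvd_natAbs.2 dvd_rfl).mul_right _
    exact hqA j hj (hij.of_dvd hqp).symm
  · intro j hj hij
    by_contra hji
    have h3 : q.natAbs * M ∣ (j - i).natAbs := Int.natCast_dvd.1 (Int.modEq_iff_dvd.1 hij)
    have h4 : M ∣ (j - i).natAbs := (Dvd.intro_left _ rfl).trans h3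
    have h5 := Nat.le_of_dvd (by omega) h4
    have h6 : (j - i).natAbs ≤ ∑ j ∈ s, (j - i).natAbs :=
      Finset.single_le_sum (f := fun j => (j - i).natAbs) (fun _ _ => Nat.zero_le _) hj
    omega

/-- The subgroup generated by the lamps in a set that is closed in the profinite topology is
closed in the profinite topology. -/
theorem exists_separating_subgroup {A : Set ℤ} (hA : profiniteClosure A ⊆ A) {x : Lamplighter}
    (hx : x ∉ lampSubgroup A) :
    ∃ N : Subgroup Lamplighter, N.FiniteIndex ∧ lampSubgroup A ≤ N ∧ x ∉ N := by
  by_cases hr : x.right = 1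
  · obtain ⟨i, hi, hxi⟩ : ∃ i ∉ A, Multiplicative.toAdd x.left i ≠ 0 := by
      by_contra h
      push Not at h
      exact hx (mem_lampSubgroup.2 ⟨hr, h⟩)
    set b : ℤ →₀ ZMod 2 := Multiplicative.toAdd x.left with hb
    obtain ⟨p, hp, hpA, hpb⟩ := exists_modulus hA hi b.support
    have : NeZero p := ⟨hp⟩
    obtain ⟨N, hN, hu⟩ := exists_cycle_subgroup p i
    have hle : lampSubgroup {j | ¬i ≡ j [ZMOD p]} ≤ N := by
      refine (Subgroup.closure_le _).2 ?_
      rintro _ ⟨j, hj, rfl⟩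
      exact (hu j).2 hj
    -- By the choice of the modulus, `i` is the only lit lamp of `x` in its residue class. Hence `x`
    -- is $u_i$ times an element of `N`, while $u_i$ is not in `N`.
    have hy : (lampU i)⁻¹ * x ∈ lampSubgroup {j | ¬i ≡ j [ZMOD p]} := by
      rw [mem_lampSubgroup, lampU_eq]
      refine ⟨by rw [SemidirectProduct.mul_right, hr]; rfl, fun j hj => ?_⟩
      have hij : i ≡ j [ZMOD p] := not_not.1 hj
      have hl : Multiplicative.toAdd ((SemidirectProduct.inl (φ := shiftHom)
          (Multiplicative.ofAdd (Finsupp.single i (1 : ZMod 2))))⁻¹ * x).left j =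
            -Finsupp.single i (1 : ZMod 2) j + b j := by
        rw [← map_inv, SemidirectProduct.mul_left, SemidirectProduct.right_inl, map_one]
        rfl
      rw [hl]
      by_cases hji : j = i
      · rw [hji, Finsupp.single_eq_same]
        generalize b i = y at hxi
        revert y; decide
      · rw [Finsupp.single_eq_of_ne hji, neg_zero, zero_add]
        by_contra hbj
        exact hji (hpb j (Finsupp.mem_support_iff.2 hbj) hij)
    refine ⟨N, hN, ?_, fun hxN => ?_⟩
    · exact le_trans (Subgroup.closure_mono (Set.image_mono fun j hj => hpA j hj)) hle
    · have h7 := N.mul_mem hxN (N.inv_mem (hle hy))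
      rw [mul_inv_rev, inv_inv, mul_inv_cancel_left] at h7
      exact (hu i).1 h7 rfl
  · exact exists_separating_subgroup_of_right A hr

theorem profiniteClosure_empty : profiniteClosure ∅ = ∅ :=
  letI := profiniteTopology
  closure_empty

/-- The case of the empty set, which is closed and whose lamps generate the trivial subgroup. -/
instance residuallyFinite_lamplighter : Group.ResiduallyFinite Lamplighter := by
  rw [Group.residuallyFinite_iff_exists_finiteIndex]
  intro x hx
  obtain ⟨N, hN, -, h⟩ := exists_separating_subgroup (A := ∅) profiniteClosure_empty.le (x := x) (by
    rw [lampSubgroup, Set.image_empty, Subgroup.closure_empty]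
    exact hx)
  exact ⟨N, hN, h⟩

theorem residuallyFinite_of_profiniteClosure_subset {A : Set ℤ} (hA : profiniteClosure A ⊆ A) :
    Group.ResiduallyFinite (DysonGroup A) :=
  residuallyFinite_double (lampSubgroup A) fun _ hx => exists_separating_subgroup hA hx

end Separation

/-! ### Residual finiteness and finitary images of Dyson's groups -/

section FinitaryImages

/-- The morphism between Dyson's groups of a set and of a larger set. -/
noncomputable def dysonMap {A B : Set ℤ} (h : A ⊆ B) : DysonGroup A →* DysonGroup B :=
  Double.lift (H := lampSubgroup A) (DysonGroup.incl B) fun _ hx =>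
    Double.of_eq_of (H := lampSubgroup B) (Subgroup.closure_mono (Set.image_mono h) hx) 0 1

theorem dysonMap_incl {A B : Set ℤ} (h : A ⊆ B) (c : Fin 2) (x : Lamplighter) :
    dysonMap h (DysonGroup.incl A c x) = DysonGroup.incl B c x :=
  Double.lift_of _ _ c x

theorem dysonMap_dysonGen {A B : Set ℤ} (h : A ⊆ B) (i : Fin 4) :
    dysonMap h (dysonGen A i) = dysonGen B i := by
  fin_cases i <;> exact dysonMap_incl h _ _

theorem dysonMap_surjective {A B : Set ℤ} (h : A ⊆ B) : Function.Surjective (dysonMap h) := by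
  intro y
  obtain ⟨w, rfl⟩ := exists_wordValue_eq _ generates_dysonGen y
  refine ⟨wordValue (dysonGen A) w, ?_⟩
  rw [map_wordValue, funext (dysonMap_dysonGen h)]

theorem conj_zpow_eq_of_modEq {G : Type*} [Group G] {a e : G} {n : ℕ} (ha : a ^ n = 1) {i j : ℤ}
    (h : i ≡ j [ZMOD n]) : a ^ i * e * a ^ (-i) = a ^ j * e * a ^ (-j) := by
  have h1 : a ^ i = a ^ j := by
    obtain ⟨k, hk⟩ := Int.modEq_iff_dvd.1 h
    have h2 : j = i + n * k := by omega
    rw [h2, zpow_add, zpow_mul, zpow_natCast, ha, one_zpow, mul_one]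
  rw [zpow_neg, zpow_neg, h1]

/-- Relations of `L(A)` in a finite group are relations of `L(B)`, for `B` the closure of `A`. -/
theorem DysonRel.profiniteClosure {G : Type*} [Group G] [Finite G] {A : Set ℤ} {f : Fin 4 → G}
    (h : DysonRel A f) : DysonRel (profiniteClosure A) f := by
  refine ⟨h.1, h.2.1, fun i hi => ?_⟩
  obtain ⟨j, hj, hij⟩ := mem_profiniteClosure_iff.1 hi (Nat.card G)
    (by exact_mod_cast Nat.card_pos.ne')
  rw [conj_zpow_eq_of_modEq pow_card_eq_one' hij.symm, h.2.2 j hj,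
    conj_zpow_eq_of_modEq pow_card_eq_one' hij.symm]

/-- The quotient by the normal core of `N` is finite, so it satisfies the relations for the closure
as well. The projection onto it then factors through Dyson's group of the closure. -/
theorem ker_dysonMap_le {A : Set ℤ} (N : Subgroup (DysonGroup A)) (hN : N.FiniteIndex) :
    (dysonMap (subset_profiniteClosure A)).ker ≤ N := by
  let g : DysonGroup A →* DysonGroup A ⧸ N.normalCore := QuotientGroup.mk' N.normalCore
  have hrel : DysonRel A fun i => g (dysonGen A i) := dysonRel_dysonGen.map g
  obtain ⟨ψ, hψ⟩ := exists_dyson_hom hrel.profiniteClosure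
  have h : ψ.comp (dysonMap (subset_profiniteClosure A)) = g :=
    dyson_hom_ext fun i => by rw [MonoidHom.comp_apply, dysonMap_dysonGen, hψ]
  intro x hx
  have h1 : g x = 1 := by
    rw [← h, MonoidHom.comp_apply, MonoidHom.mem_ker.1 hx, map_one]
  exact N.normalCore_le ((QuotientGroup.eq_one_iff x).1 h1)

theorem residuallyFinite_dysonGroup_iff (A : Set ℤ) :
    Group.ResiduallyFinite (DysonGroup A) ↔ @IsClosed ℤ profiniteTopology A := by
  rw [isClosed_iff_profiniteClosure_subset]
  refine ⟨fun h i hi => ?_, residuallyFinite_of_profiniteClosure_subset⟩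
  -- For $i$ in the closure, $u_i \hat u_i^{-1}$ dies in $L(\overline A)$ and so lies in every
  -- subgroup of finite index.
  rw [← incl_lampU_eq_iff, ← mul_inv_eq_one]
  refine Group.residuallyFinite_iff_forall_finiteIndex.1 h _ fun N hN => ker_dysonMap_le N hN ?_
  rw [MonoidHom.mem_ker, map_mul, map_inv, dysonMap_incl, dysonMap_incl, mul_inv_eq_one,
    incl_lampU_eq_iff]
  exact hi

/-- Every subgroup of finite index contains the kernel. Conversely, an element outside the kernel is
detected by a finite quotient of $L(\overline A)$, which is residually finite because the closure is
closed. -/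
theorem finiteResidual_dysonGroup (A : Set ℤ) :
    finiteResidual (DysonGroup A) = (dysonMap (subset_profiniteClosure A)).ker := by
  refine le_antisymm (fun x hx => ?_) (le_sInf fun N hN => ker_dysonMap_le N hN)
  have hrf : Group.ResiduallyFinite (DysonGroup (profiniteClosure A)) :=
    residuallyFinite_of_profiniteClosure_subset (profiniteClosure_profiniteClosure A).le
  by_contra h
  obtain ⟨N, hN, hxN⟩ := exists_finiteIndex_of_hom (dysonMap (subset_profiniteClosure A)) (g := x) h
  exact hxN (Subgroup.mem_sInf.1 hx N hN)

theorem exists_finitaryImage_equiv (A : Set ℤ) :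
    ∃ e : FinitaryImage (DysonGroup A) ≃* DysonGroup (profiniteClosure A),
      ∀ (c : Fin 2) (x : Lamplighter),
        e (QuotientGroup.mk (DysonGroup.incl A c x)) =
          DysonGroup.incl (profiniteClosure A) c x :=
  ⟨(QuotientGroup.quotientMulEquivOfEq (finiteResidual_dysonGroup A)).trans
    (QuotientGroup.quotientKerEquivOfSurjective _ (dysonMap_surjective _)),
    fun c x => dysonMap_incl (subset_profiniteClosure A) c x⟩

end FinitaryImages

/-! ### The relations of Dyson's groups modulo an exponent -/

section FiniteRelations

/-- The word that expresses that two words commute. -/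
def commWord {α : Type*} (u v : Word α) : Word α := (u ++ v) ++ FreeGroup.invRev (v ++ u)

/-- Finitely many relators that express, for letters whose `N`-th powers are trivial, the relations
of Dyson's group of a set with the list `L` of residues modulo `N`. -/
def relWords {α : Type*} (q : (Word α × Word α) × Word α × Word α) (N : ℕ) (L : List ℕ) :
    List (Word α) :=
  [powWord q.1.1 N, powWord q.2.1 N, q.1.2 ++ q.1.2, q.2.2 ++ q.2.2] ++
    (((List.range N).map fun i : ℕ => commWord q.1.2 (conjWord q.1.1 q.1.2 i)) ++
      (((List.range N).map fun i : ℕ => commWord q.2.2 (conjWord q.2.1 q.2.2 i)) ++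
        L.map fun r : ℕ => compareWord q.1.1 q.1.2 q.2.1 q.2.2 r))

/-- The images of four words. -/
def quadValue {α G : Type*} [Group G] (ψ : FreeGroup α →* G)
    (q : (Word α × Word α) × Word α × Word α) : Fin 4 → G :=
  ![ψ (FreeGroup.mk q.1.1), ψ (FreeGroup.mk q.1.2), ψ (FreeGroup.mk q.2.1), ψ (FreeGroup.mk q.2.2)]

theorem lampRel_iff_of_pow_eq_one {G : Type*} [Group G] {a e : G} {N : ℕ} (hN : N ≠ 0)
    (ha : a ^ N = 1) : LampRel a e ↔ e * e = 1 ∧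
      ∀ i < N, e * (a ^ (i : ℤ) * e * a ^ (-(i : ℤ))) = a ^ (i : ℤ) * e * a ^ (-(i : ℤ)) * e := by
  rw [LampRel, sq]
  refine and_congr_right fun _ => ⟨fun h i _ => h i, fun h z => ?_⟩
  have h1 : (((z % N).toNat : ℕ) : ℤ) = z % N :=
    Int.toNat_of_nonneg (Int.emod_nonneg _ (by exact_mod_cast hN))
  have h2 : (z % N).toNat < N := by
    have := Int.emod_lt_of_pos z (b := N) (by omega)
    omega
  have h3 := h _ h2
  rw [h1, conj_zpow_eq_of_modEq ha (Int.mod_modEq z N)] at h3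
  exact h3

theorem dysonRel_iff_of_pow_eq_one {G : Type*} [Group G] {A : Set ℤ} {f : Fin 4 → G} {N : ℕ}
    (hN : N ≠ 0) (ha : f 0 ^ N = 1) (hb : f 2 ^ N = 1) :
    (∀ i ∈ A, f 0 ^ i * f 1 * f 0 ^ (-i) = f 2 ^ i * f 3 * f 2 ^ (-i)) ↔
      ∀ r ∈ (residues A N).sort (· ≤ ·), f 0 ^ (r : ℤ) * f 1 * f 0 ^ (-(r : ℤ)) =
        f 2 ^ (r : ℤ) * f 3 * f 2 ^ (-(r : ℤ)) := by
  simp only [Finset.mem_sort, residues, Finset.mem_filter, Finset.mem_range]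
  constructor
  · rintro h r ⟨-, j, hj, hjr⟩
    rw [← conj_zpow_eq_of_modEq ha hjr, ← conj_zpow_eq_of_modEq hb hjr]
    exact h j hj
  · intro h z hz
    have h1 : (((z % N).toNat : ℕ) : ℤ) = z % N :=
      Int.toNat_of_nonneg (Int.emod_nonneg _ (by exact_mod_cast hN))
    have h2 : (z % N).toNat < N := by
      have := Int.emod_lt_of_pos z (b := N) (by omega)
      omega
    have h3 := h _ ⟨h2, z, hz, by rw [h1]; exact (Int.mod_modEq z N).symm⟩
    rw [h1, conj_zpow_eq_of_modEq ha (Int.mod_modEq z N),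
      conj_zpow_eq_of_modEq hb (Int.mod_modEq z N)] at h3
    exact h3

/-- When the `N`-th powers of both shifts are trivial, a conjugate depends only on its exponent
modulo `N`. Exponents below `N` then express all commutations, and the residues of `A` express all
identifications. -/
theorem relWords_iff {α G : Type*} [Group G] (ψ : FreeGroup α →* G) (A : Set ℤ)
    (q : (Word α × Word α) × Word α × Word α) {N : ℕ} (hN : N ≠ 0) :
    (∀ w ∈ relWords q N ((residues A N).sort (· ≤ ·)), ψ (FreeGroup.mk w) = 1) ↔
      quadValue ψ q 0 ^ N = 1 ∧ quadValue ψ q 2 ^ N = 1 ∧ DysonRel A (quadValue ψ q) := by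
  have hcomm : ∀ u v : Word α, ψ (FreeGroup.mk (commWord u v)) = 1 ↔
      ψ (FreeGroup.mk u) * ψ (FreeGroup.mk v) = ψ (FreeGroup.mk v) * ψ (FreeGroup.mk u) := by
    intro u v
    rw [commWord, ← FreeGroup.mul_mk, ← FreeGroup.inv_mk, map_mul, map_inv, mul_inv_eq_one,
      ← FreeGroup.mul_mk, ← FreeGroup.mul_mk, map_mul, map_mul]
  have hconj : ∀ (a e : Word α) (z : ℤ), ψ (FreeGroup.mk (conjWord a e z)) =
      ψ (FreeGroup.mk a) ^ z * ψ (FreeGroup.mk e) * ψ (FreeGroup.mk a) ^ (-z) := by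
    intro a e z
    rw [mk_conjWord, map_mul, map_mul, map_zpow, map_zpow]
  have hcompare : ∀ (a e b d : Word α) (z : ℤ), ψ (FreeGroup.mk (compareWord a e b d z)) = 1 ↔
      ψ (FreeGroup.mk a) ^ z * ψ (FreeGroup.mk e) * ψ (FreeGroup.mk a) ^ (-z) =
        ψ (FreeGroup.mk b) ^ z * ψ (FreeGroup.mk d) * ψ (FreeGroup.mk b) ^ (-z) := by
    intro a e b d z
    rw [mk_compareWord, map_mul, map_inv, mul_inv_eq_one, hconj, hconj]
  have hpow : ∀ w : Word α, ψ (FreeGroup.mk (powWord w N)) = ψ (FreeGroup.mk w) ^ N := by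
    intro w
    rw [mk_powWord, map_pow]
  have hsq : ∀ w : Word α, ψ (FreeGroup.mk (w ++ w)) = ψ (FreeGroup.mk w) * ψ (FreeGroup.mk w) := by
    intro w
    rw [← FreeGroup.mul_mk, map_mul]
  have key : (∀ w ∈ relWords q N ((residues A N).sort (· ≤ ·)), ψ (FreeGroup.mk w) = 1) ↔
      (quadValue ψ q 0 ^ N = 1 ∧ quadValue ψ q 2 ^ N = 1 ∧
        quadValue ψ q 1 * quadValue ψ q 1 = 1 ∧ quadValue ψ q 3 * quadValue ψ q 3 = 1) ∧
      (∀ i < N, quadValue ψ q 1 * (quadValue ψ q 0 ^ (i : ℤ) * quadValue ψ q 1 *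
        quadValue ψ q 0 ^ (-(i : ℤ))) = quadValue ψ q 0 ^ (i : ℤ) * quadValue ψ q 1 *
        quadValue ψ q 0 ^ (-(i : ℤ)) * quadValue ψ q 1) ∧
      (∀ i < N, quadValue ψ q 3 * (quadValue ψ q 2 ^ (i : ℤ) * quadValue ψ q 3 *
        quadValue ψ q 2 ^ (-(i : ℤ))) = quadValue ψ q 2 ^ (i : ℤ) * quadValue ψ q 3 *
        quadValue ψ q 2 ^ (-(i : ℤ)) * quadValue ψ q 3) ∧
      ∀ r ∈ (residues A N).sort (· ≤ ·), quadValue ψ q 0 ^ (r : ℤ) * quadValue ψ q 1 *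
        quadValue ψ q 0 ^ (-(r : ℤ)) = quadValue ψ q 2 ^ (r : ℤ) * quadValue ψ q 3 *
        quadValue ψ q 2 ^ (-(r : ℤ)) := by
    simp only [relWords, List.forall_mem_append, List.forall_mem_cons, List.forall_mem_map,
      List.mem_range, hcomm, hconj, hcompare, hpow, hsq]
    simp [quadValue]
  rw [key]
  constructor
  · rintro ⟨⟨ha, hb, he, hd⟩, h1, h2, h3⟩
    exact ⟨ha, hb, (lampRel_iff_of_pow_eq_one hN ha).2 ⟨he, h1⟩,
      (lampRel_iff_of_pow_eq_one hN hb).2 ⟨hd, h2⟩, (dysonRel_iff_of_pow_eq_one hN ha hb).2 h3⟩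
  · rintro ⟨ha, hb, h1, h2, h3⟩
    obtain ⟨he, h1⟩ := (lampRel_iff_of_pow_eq_one hN ha).1 h1
    obtain ⟨hd, h2⟩ := (lampRel_iff_of_pow_eq_one hN hb).1 h2
    exact ⟨⟨ha, hb, he, hd⟩, h1, h2, (dysonRel_iff_of_pow_eq_one hN ha hb).1 h3⟩

theorem primrec_commWord {α : Type*} [Primcodable α] : Primrec₂ (commWord (α := α)) :=
  Primrec.list_append.comp Primrec.list_append
    (primrec_invRev.comp (Primrec.list_append.comp Primrec.snd Primrec.fst))

theorem primrec_relWords {α : Type*} [Primcodable α] :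
    Primrec fun x : ((Word α × Word α) × Word α × Word α) × ℕ × List ℕ =>
      relWords x.1 x.2.1 x.2.2 := by
  have ha : Primrec fun x : ((Word α × Word α) × Word α × Word α) => x.1.1 :=
    Primrec.fst.comp Primrec.fst
  have he : Primrec fun x : ((Word α × Word α) × Word α × Word α) => x.1.2 :=
    Primrec.snd.comp Primrec.fst
  have hb : Primrec fun x : ((Word α × Word α) × Word α × Word α) => x.2.1 :=
    Primrec.fst.comp Primrec.snd
  have hd : Primrec fun x : ((Word α × Word α) × Word α × Word α) => x.2.2 :=
    Primrec.snd.comp Primrec.snd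
  have hN : Primrec fun x : ((Word α × Word α) × Word α × Word α) × ℕ × List ℕ => x.2.1 :=
    Primrec.fst.comp Primrec.snd
  have hq : Primrec fun x : ((Word α × Word α) × Word α × Word α) × ℕ × List ℕ => x.1 :=
    Primrec.fst
  have hc : Primrec fun x : (Word α × Word α) × ℕ => commWord x.1.2 (conjWord x.1.1 x.1.2 x.2) :=
    primrec_commWord.comp (Primrec.snd.comp Primrec.fst)
      (primrec_conjWord.comp (Primrec.pair Primrec.fst (primrec_int_ofNat.comp Primrec.snd)))
  have h1 : Primrec fun x : ((Word α × Word α) × Word α × Word α) × ℕ × List ℕ =>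
      powWord x.1.1.1 x.2.1 := primrec_powWord.comp (ha.comp hq) hN
  have h2 : Primrec fun x : ((Word α × Word α) × Word α × Word α) × ℕ × List ℕ =>
      powWord x.1.2.1 x.2.1 := primrec_powWord.comp (hb.comp hq) hN
  have h3 : Primrec fun x : ((Word α × Word α) × Word α × Word α) × ℕ × List ℕ =>
      x.1.1.2 ++ x.1.1.2 := Primrec.list_append.comp (he.comp hq) (he.comp hq)
  have h4 : Primrec fun x : ((Word α × Word α) × Word α × Word α) × ℕ × List ℕ =>
      x.1.2.2 ++ x.1.2.2 := Primrec.list_append.comp (hd.comp hq) (hd.comp hq)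
  have h5 : Primrec fun x : ((Word α × Word α) × Word α × Word α) × ℕ × List ℕ =>
      (List.range x.2.1).map fun i : ℕ => commWord x.1.1.2 (conjWord x.1.1.1 x.1.1.2 i) :=
    Primrec.list_map (Primrec.list_range.comp hN)
      (hc.comp (Primrec.pair (Primrec.fst.comp (hq.comp Primrec.fst)) Primrec.snd)).to₂
  have h6 : Primrec fun x : ((Word α × Word α) × Word α × Word α) × ℕ × List ℕ =>
      (List.range x.2.1).map fun i : ℕ => commWord x.1.2.2 (conjWord x.1.2.1 x.1.2.2 i) :=
    Primrec.list_map (Primrec.list_range.comp hN)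
      (hc.comp (Primrec.pair (Primrec.snd.comp (hq.comp Primrec.fst)) Primrec.snd)).to₂
  have h7 : Primrec fun x : ((Word α × Word α) × Word α × Word α) × ℕ × List ℕ =>
      x.2.2.map fun r : ℕ => compareWord x.1.1.1 x.1.1.2 x.1.2.1 x.1.2.2 r :=
    Primrec.list_map (Primrec.snd.comp Primrec.snd)
      (primrec_compareWord.comp (Primrec.pair (hq.comp Primrec.fst)
        (primrec_int_ofNat.comp Primrec.snd))).to₂
  have hp : Primrec fun x : ((Word α × Word α) × Word α × Word α) × ℕ × List ℕ =>
      [powWord x.1.1.1 x.2.1, powWord x.1.2.1 x.2.1, x.1.1.2 ++ x.1.1.2, x.1.2.2 ++ x.1.2.2] :=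
    Primrec.list_cons.comp h1 (Primrec.list_cons.comp h2
      (Primrec.list_cons.comp h3 (Primrec.list_cons.comp h4 (Primrec.const []))))
  exact Primrec.list_append.comp hp
    (Primrec.list_append.comp h5 (Primrec.list_append.comp h6 h7))

end FiniteRelations

/-! ### Coded finitary permutations of the natural numbers -/

section Swaps

/-- The product of a list of transpositions. -/
def swapsPerm (l : List (ℕ × ℕ)) : Equiv.Perm ℕ := (l.map fun s => Equiv.swap s.1 s.2).prod

/-- The morphism defined by permutations that are given as products of transpositions. -/
def swapsHom (P : List (List (ℕ × ℕ))) : FreeGroup ℕ →* Equiv.Perm ℕ :=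
  FreeGroup.lift fun j => swapsPerm (P.getD j [])

theorem swapsPerm_reverse (l : List (ℕ × ℕ)) : swapsPerm l.reverse = (swapsPerm l)⁻¹ := by
  simp [swapsPerm, List.prod_inv_reverse, Function.comp_def]

/-- The action of a product of transpositions. -/
def swapsAct (l : List (ℕ × ℕ)) (x : ℕ) : ℕ :=
  l.foldr (fun s y => if y = s.1 then s.2 else if y = s.2 then s.1 else y) x

theorem swapsAct_eq (l : List (ℕ × ℕ)) (x : ℕ) : swapsAct l x = swapsPerm l x := by
  induction l with
  | nil => rfl
  | cons s l ih =>
    rw [swapsPerm, List.map_cons, List.prod_cons, ← swapsPerm, Equiv.Perm.mul_apply, ← ih,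
      Equiv.swap_apply_def]
    rfl

/-- The action of a word on a point. -/
def wordAct (P : List (List (ℕ × ℕ))) (w : Word ℕ) (x : ℕ) : ℕ :=
  w.foldr (fun l y => swapsAct
    (if l.2 = true then P.getD l.1 [] else (P.getD l.1 []).reverse) y) x

theorem wordAct_eq (P : List (List (ℕ × ℕ))) (w : Word ℕ) (x : ℕ) :
    wordAct P w x = swapsHom P (FreeGroup.mk w) x := by
  induction w with
  | nil => rfl
  | cons l w ih =>
    change swapsAct _ (wordAct P w x) = swapsHom P (FreeGroup.mk ([l] ++ w)) x
    rw [← FreeGroup.mul_mk, map_mul, Equiv.Perm.mul_apply, ← ih, swapsAct_eq]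
    obtain ⟨j, b⟩ := l
    cases b <;> simp [swapsHom, swapsPerm_reverse]

theorem swapsAct_eq_self {l : List (ℕ × ℕ)} {x : ℕ} (h : x ∉ l.flatMap fun s => [s.1, s.2]) :
    swapsAct l x = x := by
  induction l with
  | nil => rfl
  | cons s l ih =>
    simp only [List.flatMap_cons, List.cons_append, List.nil_append, List.mem_cons, not_or] at h
    obtain ⟨h1, h2, h3⟩ := h
    change (if swapsAct l x = s.1 then s.2 else if swapsAct l x = s.2 then s.1 else
      swapsAct l x) = x
    rw [ih h3, if_neg h1, if_neg h2]

/-- The points that are moved by one of the transpositions. -/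
def swapPoints (P : List (List (ℕ × ℕ))) : List ℕ :=
  P.flatMap fun l => l.flatMap fun s => [s.1, s.2]

theorem wordAct_eq_self {P : List (List (ℕ × ℕ))} {x : ℕ} (hx : x ∉ swapPoints P) (w : Word ℕ) :
    wordAct P w x = x := by
  have hfix : ∀ j, swapsPerm (P.getD j []) x = x := by
    intro j
    rw [← swapsAct_eq]
    by_cases hj : j < P.length
    · refine swapsAct_eq_self fun h => hx (List.mem_flatMap.2 ⟨_, ?_, h⟩)
      rw [List.getD_eq_getElem _ _ hj]
      exact List.getElem_mem hj
    · rw [List.getD_eq_default _ _ (not_lt.1 hj)]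
      rfl
  induction w with
  | nil => rfl
  | cons l w ih =>
    change swapsAct _ (wordAct P w x) = x
    rw [ih, swapsAct_eq]
    split_ifs
    · exact hfix _
    · rw [swapsPerm_reverse, Equiv.Perm.inv_eq_iff_eq]
      exact (hfix _).symm

/-- Points outside the listed transpositions are fixed by every word, so triviality is a finite
check. -/
theorem swapsHom_eq_one_iff (P : List (List (ℕ × ℕ))) (w : Word ℕ) :
    swapsHom P (FreeGroup.mk w) = 1 ↔ ∀ x ∈ swapPoints P, wordAct P w x = x := by
  constructor
  · intro h x _
    rw [wordAct_eq, h]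
    rfl
  · intro h
    ext x
    rw [← wordAct_eq]
    by_cases hx : x ∈ swapPoints P
    · exact h x hx
    · exact wordAct_eq_self hx w

theorem primrec_swapsAct : Primrec₂ swapsAct := by
  have hy : Primrec fun z : (List (ℕ × ℕ) × ℕ) × (ℕ × ℕ) × ℕ => z.2.2 :=
    Primrec.snd.comp Primrec.snd
  have h1 : Primrec fun z : (List (ℕ × ℕ) × ℕ) × (ℕ × ℕ) × ℕ => z.2.1.1 :=
    Primrec.fst.comp (Primrec.fst.comp Primrec.snd)
  have h2 : Primrec fun z : (List (ℕ × ℕ) × ℕ) × (ℕ × ℕ) × ℕ => z.2.1.2 :=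
    Primrec.snd.comp (Primrec.fst.comp Primrec.snd)
  exact Primrec.list_foldr Primrec.fst Primrec.snd
    (Primrec.ite (Primrec.eq.comp hy h1) h2 (Primrec.ite (Primrec.eq.comp hy h2) h1 hy)).to₂

theorem primrec_wordAct :
    Primrec fun z : (List (List (ℕ × ℕ)) × Word ℕ) × ℕ => wordAct z.1.1 z.1.2 z.2 := by
  have hg : Primrec fun z : ((List (List (ℕ × ℕ)) × Word ℕ) × ℕ) × (ℕ × Bool) × ℕ =>
      z.1.1.1.getD z.2.1.1 [] :=
    (Primrec.list_getD []).comp (Primrec.fst.comp (Primrec.fst.comp Primrec.fst))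
      (Primrec.fst.comp (Primrec.fst.comp Primrec.snd))
  have hl : Primrec fun z : ((List (List (ℕ × ℕ)) × Word ℕ) × ℕ) × (ℕ × Bool) × ℕ =>
      if z.2.1.2 = true then z.1.1.1.getD z.2.1.1 [] else (z.1.1.1.getD z.2.1.1 []).reverse :=
    Primrec.ite (Primrec.eq.comp (Primrec.snd.comp (Primrec.fst.comp Primrec.snd))
      (Primrec.const true)) hg (Primrec.list_reverse.comp hg)
  exact Primrec.list_foldr (Primrec.snd.comp Primrec.fst) Primrec.snd
    (primrec_swapsAct.comp hl (Primrec.snd.comp Primrec.snd)).to₂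

theorem primrec_swapPoints : Primrec swapPoints := by
  have h1 : Primrec fun s : ℕ × ℕ => [s.1, s.2] :=
    Primrec.list_cons.comp Primrec.fst (Primrec.list_cons.comp Primrec.snd (Primrec.const []))
  have h2 : Primrec fun l : List (ℕ × ℕ) => l.flatMap fun s => [s.1, s.2] :=
    Primrec.list_flatMap Primrec.id (h1.comp Primrec.snd).to₂
  exact Primrec.list_flatMap Primrec.id (h2.comp Primrec.snd).to₂

theorem primrec_swapsHom_eq_one :
    PrimrecRel fun (w : Word ℕ) (P : List (List (ℕ × ℕ))) => swapsHom P (FreeGroup.mk w) = 1 := by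
  have h1 : PrimrecRel fun (x : ℕ) (z : Word ℕ × List (List (ℕ × ℕ))) =>
      wordAct z.2 z.1 x = x :=
    Primrec.eq.comp (primrec_wordAct.comp (Primrec.pair (Primrec.pair
      (Primrec.snd.comp Primrec.snd) (Primrec.fst.comp Primrec.snd)) Primrec.fst)) Primrec.fst
  refine PrimrecPred.of_eq ((PrimrecRel.forall_mem_list h1).comp
    (primrec_swapPoints.comp Primrec.snd)
    (Primrec.id : Primrec fun z : Word ℕ × List (List (ℕ × ℕ)) => z)) fun z => ?_
  exact (swapsHom_eq_one_iff z.2 z.1).symm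

/-- Transpositions generate the finite symmetric groups. The codes thus describe all representations
by permutations of finitely many points. -/
theorem exists_swapsPerm {m : ℕ} (σ : Equiv.Perm (Fin m)) :
    ∃ l, swapsPerm l = Equiv.Perm.viaEmbeddingHom Fin.valEmbedding σ := by
  induction σ using Equiv.Perm.swap_induction_on with
  | one => exact ⟨[], by rw [map_one]; rfl⟩
  | swap_mul σ x y _ ih =>
    obtain ⟨l, hl⟩ := ih
    refine ⟨(x.val, y.val) :: l, ?_⟩
    rw [swapsPerm, List.map_cons, List.prod_cons, ← swapsPerm, hl, map_mul]
    congr 1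
    ext z
    rw [Equiv.Perm.viaEmbeddingHom_apply]
    by_cases hz : z ∈ Set.range (Fin.valEmbedding (n := m))
    · obtain ⟨z, rfl⟩ := hz
      rw [Equiv.Perm.viaEmbedding_apply]
      exact (Function.Injective.swap_apply Fin.val_injective x y z)
    · rw [Equiv.Perm.viaEmbedding_apply_of_notMem _ _ _ hz]
      exact Equiv.swap_apply_of_ne_of_ne (fun h => hz ⟨x, h.symm⟩) fun h => hz ⟨y, h.symm⟩

end Swaps

/-! ### Certificates that the relations hold or fail in a finite group -/

section FinitePresentations

variable {k : ℕ} {R : List (Word (Fin k))}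

/-- Relators that hold for the images of the letters define a morphism. -/
theorem FinPresGroup.exists_hom {K : Type*} [Group K] (ψ : FreeGroup ℕ →* K)
    (h : ∀ r ∈ R, ψ (FreeGroup.mk (rawWord r)) = 1) :
    ∃ φ : FinPresGroup k R →* K, ∀ w, φ (FinPresGroup.ofWord R w) = ψ (FreeGroup.mk (rawWord w)) := by
  have hr : ∀ r ∈ {x : FreeGroup (Fin k) | ∃ r ∈ R, x = FreeGroup.mk r},
      (ψ.comp (FreeGroup.map Fin.val)) r = 1 := by
    rintro _ ⟨r, hr, rfl⟩
    exact h r hr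
  have hle : Subgroup.normalClosure {x : FreeGroup (Fin k) | ∃ r ∈ R, x = FreeGroup.mk r} ≤
      (ψ.comp (FreeGroup.map Fin.val)).ker := Subgroup.normalClosure_le_normal hr
  exact ⟨QuotientGroup.lift _ (ψ.comp (FreeGroup.map Fin.val)) hle, fun w => rfl⟩

/-- The morphism that sends the letters to the generators, and the superfluous letters to the
identity. -/
theorem FinPresGroup.exists_rawHom (R : List (Word (Fin k))) :
    ∃ ψ : FreeGroup ℕ →* FinPresGroup k R,
      ∀ w : Word (Fin k), ψ (FreeGroup.mk (rawWord w)) = FinPresGroup.ofWord R w := by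
  let g : ℕ → FinPresGroup k R := fun j =>
    if h : j < k then PresentedGroup.mk _ (FreeGroup.of ⟨j, h⟩) else 1
  refine ⟨FreeGroup.lift g, fun w => ?_⟩
  have h : (FreeGroup.lift g).comp (FreeGroup.map Fin.val) = PresentedGroup.mk
      {x : FreeGroup (Fin k) | ∃ r ∈ R, x = FreeGroup.mk r} := by
    ext j
    simp [g]
  exact DFunLike.congr_fun h (FreeGroup.mk w)

theorem FinPresGroup.ofWord_eq_one {r : Word (Fin k)} (hr : r ∈ R) :
    FinPresGroup.ofWord R r = 1 :=
  (QuotientGroup.eq_one_iff _).2 (Subgroup.subset_normalClosure ⟨r, hr, rfl⟩)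

/-- The four words listed in the input of an algorithm. -/
def quadOfList {α : Type*} (F : List (Word α)) : (Word α × Word α) × Word α × Word α :=
  ((F.getD 0 [], F.getD 1 []), F.getD 2 [], F.getD 3 [])

theorem primrec_quadOfList {α : Type*} [Primcodable α] :
    Primrec (quadOfList : List (Word α) → (Word α × Word α) × Word α × Word α) :=
  Primrec.pair
    (Primrec.pair ((Primrec.list_getD []).comp Primrec.id (Primrec.const 0))
      ((Primrec.list_getD []).comp Primrec.id (Primrec.const 1)))
    (Primrec.pair ((Primrec.list_getD []).comp Primrec.id (Primrec.const 2))
      ((Primrec.list_getD []).comp Primrec.id (Primrec.const 3)))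

theorem quadValue_quadOfList {K : Type*} [Group K] (ψ : FreeGroup ℕ →* K)
    (f : Fin 4 → Word (Fin k)) : quadValue ψ (quadOfList ((List.ofFn f).map rawWord)) =
      fun s => ψ (FreeGroup.mk (rawWord (f s))) := by
  ext s
  fin_cases s <;> simp [quadValue, quadOfList, List.ofFn_succ]

theorem DysonRel.of_injective {G K : Type*} [Group G] [Group K] {A : Set ℤ} {f : Fin 4 → G}
    {φ : G →* K} (hφ : Function.Injective φ) (h : DysonRel A fun i => φ (f i)) : DysonRel A f := by
  refine ⟨⟨hφ ?_, fun i => hφ ?_⟩, ⟨hφ ?_, fun i => hφ ?_⟩, fun i hi => hφ ?_⟩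
  · simpa using h.1.1
  · simpa using h.1.2 i
  · simpa using h.2.1.1
  · simpa using h.2.1.2 i
  · simpa using h.2.2 i hi

/-- The relations of Dyson's group hold in a finite group given by a presentation if and only if
finitely many relators are consequences of the relators of the presentation. -/
theorem dysonRel_iff_exists_consequences [Finite (FinPresGroup k R)] (A : Set ℤ)
    (f : Fin 4 → Word (Fin k)) :
    DysonRel A (fun s => FinPresGroup.ofWord R (f s)) ↔ ∃ N : ℕ, N ≠ 0 ∧
      ∀ w ∈ relWords (quadOfList ((List.ofFn f).map rawWord)) N ((residues A N).sort (· ≤ ·)),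
        FreeGroup.mk w ∈ Subgroup.normalClosure
          {x : FreeGroup ℕ | ∃ r ∈ R.map rawWord, x = FreeGroup.mk r} := by
  set M := Subgroup.normalClosure {x : FreeGroup ℕ | ∃ r ∈ R.map rawWord, x = FreeGroup.mk r}
    with hM
  have hq : ∀ N : ℕ, N ≠ 0 → ((∀ w ∈ relWords (quadOfList ((List.ofFn f).map rawWord)) N
      ((residues A N).sort (· ≤ ·)), FreeGroup.mk w ∈ M) ↔ _) := fun N hN =>
    (forall₂_congr fun w _ => (QuotientGroup.eq_one_iff (FreeGroup.mk w)).symm).trans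
      (relWords_iff (QuotientGroup.mk' M) A (quadOfList ((List.ofFn f).map rawWord)) hN)
  constructor
  · intro h
    obtain ⟨φ, hφ⟩ := FinPresGroup.exists_hom (R := R) (QuotientGroup.mk' M) fun r hr =>
      (QuotientGroup.eq_one_iff _).2 (Subgroup.subset_normalClosure
        ⟨_, List.mem_map_of_mem hr, rfl⟩)
    -- The order of the finite group is a suitable exponent, by Lagrange. The relations are carried
    -- over to the quotient by `M` by means of `φ`.
    refine ⟨Nat.card (FinPresGroup k R), Nat.card_pos.ne', (hq _ Nat.card_pos.ne').2 ?_⟩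
    rw [quadValue_quadOfList]
    simp only [← hφ, ← map_pow, pow_card_eq_one', map_one, true_and]
    exact h.map φ
  · rintro ⟨N, hN, h⟩
    obtain ⟨-, -, h⟩ := (hq N hN).1 h
    obtain ⟨ψ, hψ⟩ := FinPresGroup.exists_rawHom R
    -- The quotient by `M` still has the letters beyond `k`; `ψ` kills them and leads back to the
    -- finite group.
    have hle : M ≤ ψ.ker := by
      refine Subgroup.normalClosure_le_normal ?_
      rintro _ ⟨_, hr, rfl⟩
      obtain ⟨r, hr', rfl⟩ := List.mem_map.1 hr
      exact (hψ r).trans (FinPresGroup.ofWord_eq_one hr')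
    rw [quadValue_quadOfList] at h
    have h1 := h.map (QuotientGroup.lift M ψ hle)
    simpa [hψ] using h1

/-- The relations of Dyson's group fail in a finite group given by a presentation if and only if
one of finitely many relators is nontrivial in a permutation representation. -/
theorem not_dysonRel_iff_exists_perms [Finite (FinPresGroup k R)] (A : Set ℤ)
    (f : Fin 4 → Word (Fin k)) :
    ¬DysonRel A (fun s => FinPresGroup.ofWord R (f s)) ↔
      ∃ z : ℕ × List (List (ℕ × ℕ)), z.1 ≠ 0 ∧
        (∀ w ∈ powWord (quadOfList ((List.ofFn f).map rawWord)).1.1 z.1 ::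
          powWord (quadOfList ((List.ofFn f).map rawWord)).2.1 z.1 :: R.map rawWord,
            swapsHom z.2 (FreeGroup.mk w) = 1) ∧
        ∃ w ∈ relWords (quadOfList ((List.ofFn f).map rawWord)) z.1
          ((residues A z.1).sort (· ≤ ·)), ¬swapsHom z.2 (FreeGroup.mk w) = 1 := by
  have hpow : ∀ (P : List (List (ℕ × ℕ))) (N : ℕ), ((∀ w ∈
      powWord (quadOfList ((List.ofFn f).map rawWord)).1.1 N ::
        powWord (quadOfList ((List.ofFn f).map rawWord)).2.1 N :: R.map rawWord,
          swapsHom P (FreeGroup.mk w) = 1) ↔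
      quadValue (swapsHom P) (quadOfList ((List.ofFn f).map rawWord)) 0 ^ N = 1 ∧
      quadValue (swapsHom P) (quadOfList ((List.ofFn f).map rawWord)) 2 ^ N = 1 ∧
      ∀ r ∈ R, swapsHom P (FreeGroup.mk (rawWord r)) = 1) := by
    intro P N
    simp only [List.forall_mem_cons, mk_powWord, map_pow, List.forall_mem_map]
    rfl
  constructor
  · intro h
    obtain ⟨m, ⟨e⟩⟩ := Finite.exists_equiv_fin (FinPresGroup k R)
    -- Cayley's representation, extended by the identity to all natural numbers. It is faithful, so
    -- a relation that fails in the group fails for the permutations.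
    let η : FinPresGroup k R →* Equiv.Perm ℕ := (Equiv.Perm.viaEmbeddingHom Fin.valEmbedding).comp
      ((Equiv.permCongrHom e).toMonoidHom.comp (MulAction.toPermHom _ _))
    have hη : Function.Injective η :=
      (Equiv.Perm.viaEmbeddingHom_injective _).comp
        ((Equiv.permCongrHom e).injective.comp MulAction.toPerm_injective)
    choose P hP using fun j : Fin k => exists_swapsPerm
      (((Equiv.permCongrHom e).toMonoidHom.comp (MulAction.toPermHom _ _))
        (PresentedGroup.mk {x : FreeGroup (Fin k) | ∃ r ∈ R, x = FreeGroup.mk r}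
          (FreeGroup.of j)))
    have hval : ∀ w : Word (Fin k), swapsHom (List.ofFn P) (FreeGroup.mk (rawWord w)) =
        η (FinPresGroup.ofWord R w) := by
      intro w
      have h1 : (swapsHom (List.ofFn P)).comp (FreeGroup.map Fin.val) =
          η.comp (PresentedGroup.mk {x : FreeGroup (Fin k) | ∃ r ∈ R, x = FreeGroup.mk r}) := by
        refine FreeGroup.ext_hom _ _ fun j => ?_
        have h2 : (List.ofFn P).getD j [] = P j := by
          rw [List.getD_eq_getElem _ _ (by simp)]
          simp
        simp only [MonoidHom.comp_apply, FreeGroup.map.of, swapsHom, FreeGroup.lift_apply_of, h2, hP]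
        rfl
      exact DFunLike.congr_fun h1 (FreeGroup.mk w)
    have hN : Nat.card (FinPresGroup k R) ≠ 0 := Nat.card_pos.ne'
    have hrel := (hpow (List.ofFn P) (Nat.card (FinPresGroup k R))).2 (by
      rw [quadValue_quadOfList]
      simp only [hval, ← map_pow, pow_card_eq_one', map_one, true_and]
      intro r hr
      rw [FinPresGroup.ofWord_eq_one hr, map_one])
    refine ⟨(Nat.card (FinPresGroup k R), List.ofFn P), hN, hrel, ?_⟩
    by_contra hall
    push Not at hall
    obtain ⟨-, -, h3⟩ := (relWords_iff (swapsHom (List.ofFn P)) A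
      (quadOfList ((List.ofFn f).map rawWord)) hN).1 hall
    rw [quadValue_quadOfList] at h3
    simp only [hval] at h3
    exact h (h3.of_injective hη)
  · rintro ⟨⟨N, P⟩, hN, h1, w, hw, h2⟩ h
    -- Since the certificate includes the power relators, a nontrivial word of `relWords` means that
    -- a relation of Dyson's group fails, and not merely that `N` is a wrong exponent.
    obtain ⟨ha, hb, hr⟩ := (hpow P N).1 h1
    obtain ⟨φ, hφ⟩ := FinPresGroup.exists_hom (R := R) (swapsHom P) hr
    refine h2 ((relWords_iff (swapsHom P) A _ hN).2 ⟨ha, hb, ?_⟩ w hw)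
    rw [quadValue_quadOfList]
    simp only [← hφ]
    exact h.map φ

end FinitePresentations

/-! ### From computable residues to computable finite quotients -/

section Algorithm

variable {A : Set ℤ} {ρ : ℕ → List ℕ}

theorem computable_relWords (hρ : Computable ρ) :
    Computable fun y : (ℕ × List (Word ℕ) × List (Word ℕ)) × ℕ =>
      relWords (quadOfList y.1.2.2) y.2 (ρ y.2) := by
  have hq : Primrec fun x : ℕ × List (Word ℕ) × List (Word ℕ) => quadOfList x.2.2 :=
    primrec_quadOfList.comp (Primrec.snd.comp Primrec.snd)
  have h : Computable fun x : ((Word ℕ × Word ℕ) × Word ℕ × Word ℕ) × ℕ × List ℕ =>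
      relWords x.1 x.2.1 x.2.2 := primrec_relWords.to_comp
  have hc : Computable fun y : (ℕ × List (Word ℕ) × List (Word ℕ)) × ℕ =>
      (quadOfList y.1.2.2, y.2, ρ y.2) :=
    Computable.pair (hq.to_comp.comp Computable.fst)
      (Computable.pair Computable.snd (hρ.comp Computable.snd))
  exact (h.comp hc).of_eq fun _ => rfl

theorem rePred_relWords_consequences (hρ : Computable ρ) :
    REPred fun y : (ℕ × List (Word ℕ) × List (Word ℕ)) × ℕ =>
      ∀ w ∈ relWords (quadOfList y.1.2.2) y.2 (ρ y.2),
        FreeGroup.mk w ∈ Subgroup.normalClosure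
          {z : FreeGroup ℕ | ∃ r ∈ y.1.2.1, z = FreeGroup.mk r} := by
  have hm : Primrec fun z : List (Word ℕ) × List (Word ℕ) => z.2.map fun w => (z.1, w) :=
    Primrec.list_map Primrec.snd
      (Primrec.pair (Primrec.fst.comp Primrec.fst) Primrec.snd).to₂
  have hc : Computable fun y : (ℕ × List (Word ℕ) × List (Word ℕ)) × ℕ =>
      (relWords (quadOfList y.1.2.2) y.2 (ρ y.2)).map
        fun w => (y.1.2.1, w) := by
    have h := hm.to_comp.comp (Computable.pair
      (Computable.fst.comp (Computable.snd.comp Computable.fst))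
      (computable_relWords hρ))
    exact h.of_eq fun _ => rfl
  refine (rePred_comp (rePred_forall_mem rePred_mem_normalClosure) hc).of_eq fun y => ?_
  simp only [List.forall_mem_map]

theorem rePred_exists_consequences (hρ : Computable ρ) :
    REPred fun x : ℕ × List (Word ℕ) × List (Word ℕ) => ∃ N : ℕ, N ≠ 0 ∧
      ∀ w ∈ relWords (quadOfList x.2.2) N (ρ N), FreeGroup.mk w ∈
        Subgroup.normalClosure {y : FreeGroup ℕ | ∃ r ∈ x.2.1, y = FreeGroup.mk r} := by
  have h1 : REPred fun y : (ℕ × List (Word ℕ) × List (Word ℕ)) × ℕ => y.2 ≠ 0 :=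
    rePred_of_primrecPred (Primrec.eq.comp Primrec.snd (Primrec.const 0)).not
  exact rePred_exists (p := fun (x : ℕ × List (Word ℕ) × List (Word ℕ)) (N : ℕ) => N ≠ 0 ∧
      ∀ w ∈ relWords (quadOfList x.2.2) N (ρ N), FreeGroup.mk w ∈
        Subgroup.normalClosure {y : FreeGroup ℕ | ∃ r ∈ x.2.1, y = FreeGroup.mk r})
    (rePred_and h1 (rePred_relWords_consequences hρ))

theorem rePred_relators_perms :
    REPred fun y : (ℕ × List (Word ℕ) × List (Word ℕ)) × ℕ × List (List (ℕ × ℕ)) =>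
      ∀ w ∈ powWord (quadOfList y.1.2.2).1.1 y.2.1 ::
        powWord (quadOfList y.1.2.2).2.1 y.2.1 :: y.1.2.1,
          swapsHom y.2.2 (FreeGroup.mk w) = 1 := by
  have hN : Primrec fun y : (ℕ × List (Word ℕ) × List (Word ℕ)) × ℕ × List (List (ℕ × ℕ)) =>
      y.2.1 := Primrec.fst.comp Primrec.snd
  have hq : Primrec fun y : (ℕ × List (Word ℕ) × List (Word ℕ)) × ℕ × List (List (ℕ × ℕ)) =>
      quadOfList y.1.2.2 :=
    primrec_quadOfList.comp (Primrec.snd.comp (Primrec.snd.comp Primrec.fst))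
  have h1 : Primrec fun y : (ℕ × List (Word ℕ) × List (Word ℕ)) × ℕ × List (List (ℕ × ℕ)) =>
      powWord (quadOfList y.1.2.2).1.1 y.2.1 :=
    primrec_powWord.comp (Primrec.fst.comp (Primrec.fst.comp hq)) hN
  have h2 : Primrec fun y : (ℕ × List (Word ℕ) × List (Word ℕ)) × ℕ × List (List (ℕ × ℕ)) =>
      powWord (quadOfList y.1.2.2).2.1 y.2.1 :=
    primrec_powWord.comp (Primrec.fst.comp (Primrec.snd.comp hq)) hN
  have hl : Primrec fun y : (ℕ × List (Word ℕ) × List (Word ℕ)) × ℕ × List (List (ℕ × ℕ)) =>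
      powWord (quadOfList y.1.2.2).1.1 y.2.1 :: powWord (quadOfList y.1.2.2).2.1 y.2.1 ::
        y.1.2.1 :=
    Primrec.list_cons.comp h1 (Primrec.list_cons.comp h2
      (Primrec.fst.comp (Primrec.snd.comp Primrec.fst)))
  exact rePred_of_primrecPred ((PrimrecRel.forall_mem_list primrec_swapsHom_eq_one).comp hl
    (Primrec.snd.comp Primrec.snd))

theorem rePred_exists_relWords_perms (hρ : Computable ρ) :
    REPred fun y : (ℕ × List (Word ℕ) × List (Word ℕ)) × ℕ × List (List (ℕ × ℕ)) =>
      ∃ w ∈ relWords (quadOfList y.1.2.2) y.2.1 (ρ y.2.1),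
        ¬swapsHom y.2.2 (FreeGroup.mk w) = 1 := by
  have hn : PrimrecRel fun (w : Word ℕ) (P : List (List (ℕ × ℕ))) =>
      ¬swapsHom P (FreeGroup.mk w) = 1 := primrec_swapsHom_eq_one.not
  have hp : REPred fun z : List (Word ℕ) × List (List (ℕ × ℕ)) =>
      ∃ w ∈ z.1, ¬swapsHom z.2 (FreeGroup.mk w) = 1 :=
    rePred_of_primrecPred (PrimrecRel.exists_mem_list hn)
  have hp1 : Computable fun y : (ℕ × List (Word ℕ) × List (Word ℕ)) ×
      ℕ × List (List (ℕ × ℕ)) => (y.1, y.2.1) :=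
    Computable.pair Computable.fst (Computable.fst.comp Computable.snd)
  have hc : Computable fun y : (ℕ × List (Word ℕ) × List (Word ℕ)) ×
      ℕ × List (List (ℕ × ℕ)) =>
        (relWords (quadOfList y.1.2.2) y.2.1 (ρ y.2.1), y.2.2) := by
    have h := Computable.pair ((computable_relWords hρ).comp hp1)
      (Computable.snd.comp (Computable.snd (α := ℕ × List (Word ℕ) × List (Word ℕ))
        (β := ℕ × List (List (ℕ × ℕ)))))
    exact h.of_eq fun _ => rfl
  exact (rePred_comp (p := fun z : List (Word ℕ) × List (List (ℕ × ℕ)) =>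
    ∃ w ∈ z.1, ¬swapsHom z.2 (FreeGroup.mk w) = 1) hp hc).of_eq fun _ => Iff.rfl

theorem rePred_exists_perms (hρ : Computable ρ) :
    REPred fun x : ℕ × List (Word ℕ) × List (Word ℕ) =>
      ∃ z : ℕ × List (List (ℕ × ℕ)), z.1 ≠ 0 ∧
        (∀ w ∈ powWord (quadOfList x.2.2).1.1 z.1 :: powWord (quadOfList x.2.2).2.1 z.1 :: x.2.1,
          swapsHom z.2 (FreeGroup.mk w) = 1) ∧
        ∃ w ∈ relWords (quadOfList x.2.2) z.1 (ρ z.1),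
          ¬swapsHom z.2 (FreeGroup.mk w) = 1 := by
  have h1 : REPred fun y : (ℕ × List (Word ℕ) × List (Word ℕ)) × ℕ × List (List (ℕ × ℕ)) =>
      y.2.1 ≠ 0 :=
    rePred_of_primrecPred (Primrec.eq.comp (Primrec.fst.comp Primrec.snd) (Primrec.const 0)).not
  exact rePred_exists (p := fun (x : ℕ × List (Word ℕ) × List (Word ℕ))
      (z : ℕ × List (List (ℕ × ℕ))) => z.1 ≠ 0 ∧
        (∀ w ∈ powWord (quadOfList x.2.2).1.1 z.1 :: powWord (quadOfList x.2.2).2.1 z.1 :: x.2.1,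
          swapsHom z.2 (FreeGroup.mk w) = 1) ∧
        ∃ w ∈ relWords (quadOfList x.2.2) z.1 (ρ z.1),
          ¬swapsHom z.2 (FreeGroup.mk w) = 1)
    (rePred_and h1 (rePred_and rePred_relators_perms (rePred_exists_relWords_perms hρ)))

/-- The two kinds of certificates can be enumerated from the residues. For a finite group exactly
one kind exists, so searching for both at once always ends with the right answer. -/
theorem hasCFQ_of_computable (hA : Computable fun n : ℕ => (residues A n).sort (· ≤ ·)) :
    HasCFQ (DysonGroup A) := by
  obtain ⟨alg, halg, h⟩ := exists_separating_algorithm (rePred_exists_consequences hA)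
    (rePred_exists_perms hA)
  refine ⟨4, dysonGen A, generates_dysonGen, alg, halg, fun k R f hfin => ?_⟩
  have h1 := dysonRel_iff_exists_consequences (R := R) A f
  have h2 := not_dysonRel_iff_exists_perms (R := R) A f
  obtain ⟨b, hb, hbp⟩ := h (k, R.map rawWord, (List.ofFn f).map rawWord)
    (fun hyn => h2.2 hyn.2 (h1.2 hyn.1))
    ((em _).imp h1.1 h2.1)
  exact ⟨b, hb, hbp.trans (h1.symm.trans extendsToHom_dysonGen_iff.symm)⟩

end Algorithm

/-! ### Presenting a finite group by its short relators -/

section FiniteQuotient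

variable {k : ℕ} {R : List (Word (Fin k))}

theorem FinPresGroup.ofWord_append (v w : Word (Fin k)) :
    FinPresGroup.ofWord R (v ++ w) = FinPresGroup.ofWord R v * FinPresGroup.ofWord R w := by
  rw [FinPresGroup.ofWord, ← FreeGroup.mul_mk, map_mul]
  rfl

theorem wordValue_letters (w : Word (Fin k)) :
    wordValue (fun t => FinPresGroup.ofWord R [(t, true)]) w = FinPresGroup.ofWord R w := by
  have h : FreeGroup.lift (fun t => FinPresGroup.ofWord R [(t, true)]) =
      PresentedGroup.mk {x : FreeGroup (Fin k) | ∃ r ∈ R, x = FreeGroup.mk r} :=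
    FreeGroup.ext_hom _ _ fun t => FreeGroup.lift_apply_of
  exact DFunLike.congr_fun h (FreeGroup.mk w)

theorem wordValue_mem {G : Type*} [Group G] {H : Subgroup G} {g : Fin k → G} (hg : ∀ t, g t ∈ H)
    (w : Word (Fin k)) : wordValue g w ∈ H :=
  FreeGroup.range_lift_le (s := H) (by rintro _ ⟨t, rfl⟩; exact hg t) ⟨_, rfl⟩

/-- A word with more letters than the finite group that is generated by the letters has elements
can be shortened by a short relator. -/
theorem exists_short_word {G : Type*} [Group G] {H : Subgroup G} [Finite H] {g : Fin k → G}
    (hg : ∀ t, g t ∈ H) {C : ℕ} (hC : Nat.card H ≤ C)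
    (hR : ∀ w : Word (Fin k), w.length ≤ C → wordValue g w = 1 → w ∈ R) (w : Word (Fin k)) :
    ∃ v : Word (Fin k), v.length ≤ C ∧ wordValue g v = wordValue g w ∧
      FinPresGroup.ofWord R v = FinPresGroup.ofWord R w := by
  induction w with
  | nil => exact ⟨[], Nat.zero_le _, rfl, rfl⟩
  | cons l w ih =>
    obtain ⟨v, hv, h1, h2⟩ := ih
    have h1' : wordValue g (l :: v) = wordValue g (l :: w) := by
      rw [← List.singleton_append, wordValue_append, h1, ← wordValue_append, List.singleton_append]
    have h2' : FinPresGroup.ofWord R (l :: v) = FinPresGroup.ofWord R (l :: w) := by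
      rw [← List.singleton_append, FinPresGroup.ofWord_append, h2, ← FinPresGroup.ofWord_append,
        List.singleton_append]
    obtain hlt | heq := hv.lt_or_eq
    · exact ⟨l :: v, hlt, h1', h2'⟩
    have hlen : (l :: v).length = C + 1 := by rw [List.length_cons, heq]
    -- The prefixes of lengths `0, …, C` are `C + 1` words with values in a group of order at most
    -- `C`, so two values agree. The piece between them has at most `C` letters and is therefore
    -- itself a relator, which can be cut out.
    obtain ⟨i, j, hij, hval⟩ : ∃ i j : Fin (C + 1), i < j ∧
        wordValue g ((l :: v).take i) = wordValue g ((l :: v).take j) := by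
      obtain ⟨i, j, hne, h⟩ : ∃ i j : Fin (C + 1), i ≠ j ∧
          (⟨_, wordValue_mem hg ((l :: v).take i)⟩ : H) =
            ⟨_, wordValue_mem hg ((l :: v).take j)⟩ := by
        by_contra! hinj
        have hle := Nat.card_le_card_of_injective
          (fun i : Fin (C + 1) => (⟨_, wordValue_mem hg ((l :: v).take i)⟩ : H))
          fun i j h => not_imp_not.1 (hinj i j) h
        rw [Nat.card_eq_fintype_card, Fintype.card_fin] at hle
        omega
      obtain hlt | hlt := lt_or_gt_of_ne hne
      · exact ⟨i, j, hlt, congrArg Subtype.val h⟩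
      · exact ⟨j, i, hlt, (congrArg Subtype.val h).symm⟩
    set x := l :: v with hx
    set u := (x.take j).drop i with hu
    have hpre : x.take j = x.take i ++ u := by
      have h := List.take_append_drop i (x.take j)
      rw [List.take_take, min_eq_left (show (i : ℕ) ≤ j from Fin.le_of_lt hij)] at h
      exact h.symm
    have hu1 : wordValue g u = 1 := by
      rw [hpre, wordValue_append] at hval
      exact left_eq_mul.1 hval
    have huR : FinPresGroup.ofWord R u = 1 := by
      refine FinPresGroup.ofWord_eq_one (hR u ?_ hu1)
      rw [hu, List.length_drop, List.length_take]
      omega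
    have hdec : x = x.take i ++ u ++ x.drop j := by rw [← hpre, List.take_append_drop]
    refine ⟨x.take i ++ x.drop j, ?_, ?_, ?_⟩
    · rw [List.length_append, List.length_take, List.length_drop, hlen]
      have := Fin.lt_def.1 hij
      omega
    · rw [← h1']
      conv_rhs => rw [hdec, wordValue_append, wordValue_append, hu1, mul_one]
      rw [wordValue_append]
    · rw [← h2']
      conv_rhs => rw [hdec, FinPresGroup.ofWord_append, FinPresGroup.ofWord_append, huR, mul_one]
      rw [FinPresGroup.ofWord_append]

/-- Every element is represented by one of the finitely many words with at most `C` letters. -/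
theorem finite_finPresGroup {G : Type*} [Group G] {H : Subgroup G} [Finite H] {g : Fin k → G}
    (hg : ∀ t, g t ∈ H) {C : ℕ} (hC : Nat.card H ≤ C)
    (hR : ∀ w : Word (Fin k), w.length ≤ C → wordValue g w = 1 → w ∈ R) :
    Finite (FinPresGroup k R) := by
  have hfin : Finite {w : Word (Fin k) | w.length ≤ C} := List.finite_length_le _ _
  refine Finite.of_surjective (fun w : {w : Word (Fin k) | w.length ≤ C} =>
    FinPresGroup.ofWord R w.1) fun x => ?_
  obtain ⟨y, rfl⟩ := QuotientGroup.mk_surjective x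
  obtain ⟨w, rfl⟩ := Quot.exists_rep y
  obtain ⟨v, hv, -, h⟩ := exists_short_word hg hC hR w
  exact ⟨⟨v, hv⟩, h⟩

/-- The group that is presented by the short relators of a finite group embeds into the group. -/
theorem exists_injective_hom {G : Type*} [Group G] {H : Subgroup G} [Finite H] {g : Fin k → G}
    (hg : ∀ t, g t ∈ H) {C : ℕ} (hC : Nat.card H ≤ C)
    (hR : ∀ w : Word (Fin k), w ∈ R ↔ w.length ≤ C ∧ wordValue g w = 1) :
    ∃ φ : FinPresGroup k R →* G, Function.Injective φ ∧
      ∀ w, φ (FinPresGroup.ofWord R w) = wordValue g w := by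
  have hle : Subgroup.normalClosure {x : FreeGroup (Fin k) | ∃ r ∈ R, x = FreeGroup.mk r} ≤
      (FreeGroup.lift g).ker := by
    refine Subgroup.normalClosure_le_normal ?_
    rintro _ ⟨r, hr, rfl⟩
    exact ((hR r).1 hr).2
  refine ⟨QuotientGroup.lift _ (FreeGroup.lift g) hle, ?_, fun w => rfl⟩
  refine (injective_iff_map_eq_one _).2 fun x hx => ?_
  obtain ⟨y, rfl⟩ := QuotientGroup.mk_surjective x
  obtain ⟨w, rfl⟩ := Quot.exists_rep y
  -- The shortened word has the same value in both groups; if that value is trivial in `G`, the word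
  -- is one of the relators.
  obtain ⟨v, hv, h1, h2⟩ := exists_short_word hg hC (fun w h h' => (hR w).2 ⟨h, h'⟩) w
  exact h2.symm.trans (FinPresGroup.ofWord_eq_one ((hR v).2 ⟨hv, h1.trans hx⟩))

end FiniteQuotient

/-! ### Permutations that detect a residue -/

section TestPermutations

/-- The cyclic permutation of `0, …, n - 1`. -/
def cyclePerm (n : ℕ) : Equiv.Perm ℕ where
  toFun i := if i < n then if i + 1 = n then 0 else i + 1 else i
  invFun i := if i < n then if i = 0 then n - 1 else i - 1 else i
  left_inv i := by grind
  right_inv i := by grind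

/-- The permutation that changes the sign at the position `j`. -/
def flipPerm (j : ℕ) : Equiv.Perm (ℕ × Bool) :=
  Function.Involutive.toPerm (fun p => (p.1, if p.1 = j then !p.2 else p.2)) fun p => by
    dsimp only; split_ifs <;> simp

/-- The permutations of the positions, which do not change signs. -/
def positionHom : Equiv.Perm ℕ →* Equiv.Perm (ℕ × Bool) where
  toFun σ := σ.prodCongr (Equiv.refl _)
  map_one' := rfl
  map_mul' _ _ := rfl

theorem positionHom_conj_flipPerm (σ : Equiv.Perm ℕ) (j : ℕ) :
    positionHom σ * flipPerm j * (positionHom σ)⁻¹ = flipPerm (σ j) := by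
  rw [mul_inv_eq_iff_eq_mul]
  ext1 p
  change (σ p.1, if p.1 = j then !p.2 else p.2) = (σ p.1, if σ p.1 = σ j then !p.2 else p.2)
  simp only [σ.injective.eq_iff]

theorem flipPerm_injective : Function.Injective flipPerm := by
  intro i j h
  have h1 : (i, if i = i then !true else true) = (i, if i = j then !true else true) :=
    DFunLike.congr_fun h (i, true)
  by_contra hij
  simp [hij] at h1

theorem positionHom_zpow_conj_flipPerm (σ : Equiv.Perm ℕ) (j : ℕ) (i : ℤ) :
    positionHom σ ^ i * flipPerm j * positionHom σ ^ (-i) = flipPerm ((σ ^ i) j) := by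
  rw [zpow_neg, ← map_zpow, positionHom_conj_flipPerm]

theorem lampRel_positionHom_flipPerm (σ : Equiv.Perm ℕ) (j : ℕ) :
    LampRel (positionHom σ) (flipPerm j) := by
  constructor
  · ext1 p
    change (p.1, if p.1 = j then !(if p.1 = j then !p.2 else p.2) else
      if p.1 = j then !p.2 else p.2) = p
    split_ifs <;> simp
  · intro i
    rw [positionHom_zpow_conj_flipPerm]
    ext1 p
    change (p.1, if p.1 = j then !(if p.1 = (σ ^ i) j then !p.2 else p.2) else
        if p.1 = (σ ^ i) j then !p.2 else p.2) =
      (p.1, if p.1 = (σ ^ i) j then !(if p.1 = j then !p.2 else p.2) else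
        if p.1 = j then !p.2 else p.2)
    split_ifs <;> rfl

theorem cyclePerm_zpow_zero {n : ℕ} (hn : 0 < n) (i : ℤ) :
    ((cyclePerm n ^ i) 0 : ℕ) = (i % n : ℤ) := by
  have hstep : ∀ m : ℕ, m < n → ((cyclePerm n m : ℕ) : ℤ) = ((m : ℤ) + 1) % n := by
    intro m hm
    change ((if m < n then if m + 1 = n then 0 else m + 1 else m : ℕ) : ℤ) = _
    rw [if_pos hm]
    split_ifs with h
    · rw [← h]; simp
    · rw [Int.emod_eq_of_lt (by omega) (by omega)]; simp
  have hlt : ∀ m : ℕ, m < n → cyclePerm n m < n := by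
    intro m hm
    change (if m < n then if m + 1 = n then 0 else m + 1 else m : ℕ) < n
    split_ifs <;> omega
  -- An equivalence, so that the induction can go both up and down in `ℤ`.
  have hrec : ∀ i : ℤ, ((cyclePerm n ^ i) 0 : ℕ) = (i % n : ℤ) ↔
      ((cyclePerm n ^ (i + 1)) 0 : ℕ) = ((i + 1) % n : ℤ) := by
    intro i
    have hpos := Int.emod_nonneg i (show (n : ℤ) ≠ 0 by omega)
    have hb := Int.emod_lt_of_pos i (show 0 < (n : ℤ) by omega)
    have hm : cyclePerm n (i % n).toNat = (((i + 1) % n : ℤ)).toNat := by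
      have h := hstep (i % n).toNat (by omega)
      rw [Int.toNat_of_nonneg hpos, Int.emod_add_emod] at h
      omega
    have hpos' := Int.emod_nonneg (i + 1) (show (n : ℤ) ≠ 0 by omega)
    rw [add_comm i 1, zpow_add, zpow_one, Equiv.Perm.mul_apply, add_comm 1 i]
    constructor
    · intro h
      rw [show (cyclePerm n ^ i) 0 = (i % n).toNat by omega, hm, Int.toNat_of_nonneg hpos']
    · intro h
      have h1 : cyclePerm n ((cyclePerm n ^ i) 0) = cyclePerm n (i % n).toNat := by omega
      rw [(cyclePerm n).injective h1, Int.toNat_of_nonneg hpos]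
  induction i using Int.induction_on with
  | zero => simp
  | succ i ih => exact (hrec i).1 ih
  | pred i ih => exact (hrec (-i - 1)).2 (by rwa [sub_add_cancel])

/-- Permutations that satisfy the relations of Dyson's group for a set of integers if and only if
the residue `r` does not occur. -/
def testPerm (n r : ℕ) : Fin 4 → Equiv.Perm (ℕ × Bool) :=
  ![positionHom (cyclePerm n), flipPerm 0,
    positionHom (Equiv.swap r n * cyclePerm n * (Equiv.swap r n)⁻¹), flipPerm (Equiv.swap r n 0)]

/-- The cycle carries $0$ to $i \bmod n$. Hence $u_i$ changes the sign at $i \bmod n$, and $\hat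
u_i$ the sign at its image under the transposition of $r$ and $n$. Since $i \bmod n$ is less than
$n$, these agree unless $i \bmod n = r$. -/
theorem dysonRel_testPerm_iff (A : Set ℤ) {n r : ℕ} (hr : r < n) :
    DysonRel A (testPerm n r) ↔ r ∉ residues A n := by
  have hn : 0 < n := by omega
  have h : DysonRel A (testPerm n r) ↔ ∀ i ∈ A, ((cyclePerm n ^ i) 0) ≠ r := by
    constructor
    · intro h i hi hir
      have h1 := h.2.2 i hi
      change positionHom (cyclePerm n) ^ i * flipPerm 0 * positionHom (cyclePerm n) ^ (-i) =
        positionHom (Equiv.swap r n * cyclePerm n * (Equiv.swap r n)⁻¹) ^ i *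
          flipPerm (Equiv.swap r n 0) *
          positionHom (Equiv.swap r n * cyclePerm n * (Equiv.swap r n)⁻¹) ^ (-i) at h1
      rw [positionHom_zpow_conj_flipPerm, positionHom_zpow_conj_flipPerm] at h1
      have h2 := flipPerm_injective h1
      rw [conj_zpow, Equiv.Perm.mul_apply, Equiv.Perm.mul_apply, Equiv.Perm.inv_def, Equiv.symm_apply_apply, hir,
        Equiv.swap_apply_left] at h2
      omega
    · intro h
      refine ⟨lampRel_positionHom_flipPerm _ _, lampRel_positionHom_flipPerm _ _, fun i hi => ?_⟩
      change positionHom (cyclePerm n) ^ i * flipPerm 0 * positionHom (cyclePerm n) ^ (-i) =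
        positionHom (Equiv.swap r n * cyclePerm n * (Equiv.swap r n)⁻¹) ^ i *
          flipPerm (Equiv.swap r n 0) *
          positionHom (Equiv.swap r n * cyclePerm n * (Equiv.swap r n)⁻¹) ^ (-i)
      have hlt := Int.emod_lt_of_pos i (show 0 < (n : ℤ) by omega)
      have h0 := cyclePerm_zpow_zero hn i
      rw [positionHom_zpow_conj_flipPerm, positionHom_zpow_conj_flipPerm, conj_zpow,
        Equiv.Perm.mul_apply, Equiv.Perm.mul_apply, Equiv.Perm.inv_def, Equiv.symm_apply_apply,
        Equiv.swap_apply_of_ne_of_ne (h i hi) (by omega)]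
  rw [h]
  simp only [residues, Finset.mem_filter, Finset.mem_range, hr, true_and, not_exists, not_and]
  refine forall₂_congr fun i _ => not_congr ?_
  rw [Int.ModEq, Int.emod_eq_of_lt (show (0 : ℤ) ≤ r by omega) (by omega),
    ← cyclePerm_zpow_zero hn, Nat.cast_inj]

/-- The permutations of the signed positions up to `n`. -/
def boundedPerms (n : ℕ) : Subgroup (Equiv.Perm (ℕ × Bool)) where
  carrier := {σ | ∀ p, ¬p.1 ≤ n → σ p = p}
  one_mem' _ _ := rfl
  mul_mem' {σ τ} hσ hτ p hp := by rw [Equiv.Perm.mul_apply, hτ p hp, hσ p hp]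
  inv_mem' {σ} hσ p hp := by rw [Equiv.Perm.inv_eq_iff_eq, hσ p hp]

theorem testPerm_mem_boundedPerms {n r : ℕ} (hr : r ≤ n) (t : Fin 4) :
    testPerm n r t ∈ boundedPerms n := by
  have hc : ∀ i, ¬i ≤ n → cyclePerm n i = i := fun i hi => if_neg (by omega)
  have hs : ∀ i, ¬i ≤ n → Equiv.swap r n i = i := fun i hi =>
    Equiv.swap_apply_of_ne_of_ne (by omega) (by omega)
  have hs0 : Equiv.swap r n 0 ≤ n := by
    rw [Equiv.swap_apply_def]
    split_ifs <;> omega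
  intro p hp
  fin_cases t
  · exact Prod.ext (hc _ hp) rfl
  · exact Prod.ext rfl (if_neg (by omega))
  · refine Prod.ext ?_ rfl
    change Equiv.swap r n (cyclePerm n ((Equiv.swap r n)⁻¹ p.1)) = p.1
    rw [Equiv.swap_inv, hs _ hp, hc _ hp, hs _ hp]
  · exact Prod.ext rfl (if_neg (by omega))

/-- The signed positions up to `n` are the elements of a finite type. -/
def boundedPositionsEquiv (n : ℕ) : {p : ℕ × Bool // p.1 ≤ n} ≃ Fin (n + 1) × Bool where
  toFun p := (⟨p.1.1, Nat.lt_succ_of_le p.2⟩, p.1.2)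
  invFun q := ⟨(q.1.1, q.2), Nat.le_of_lt_succ q.1.2⟩
  left_inv _ := rfl
  right_inv _ := rfl

/-- The group of permutations of the signed positions up to `n`. -/
def boundedPermsEquiv (n : ℕ) : boundedPerms n ≃ Equiv.Perm (Fin (n + 1) × Bool) :=
  (Equiv.Perm.subtypeEquivSubtypePerm fun p : ℕ × Bool => p.1 ≤ n).symm.trans
    (Equiv.permCongr (boundedPositionsEquiv n))

instance finite_boundedPerms (n : ℕ) : Finite (boundedPerms n) :=
  Finite.of_equiv _ (boundedPermsEquiv n).symm

theorem card_boundedPerms (n : ℕ) : Nat.card (boundedPerms n) = ((n + 1) * 2).factorial := by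
  rw [Nat.card_congr (boundedPermsEquiv n), Nat.card_eq_fintype_card, Fintype.card_perm,
    Fintype.card_prod, Fintype.card_fin, Fintype.card_bool]

end TestPermutations

/-! ### Computable presentations of the test groups -/

section TestRelators

/-- The images of the position `i` under the transposition of `r` and `n`. -/
def swapIndex (n r i : ℕ) : ℕ := if i = r then n else if i = n then r else i

/-- The image of the position `i` under a cyclic permutation or its inverse. -/
def cycleIndex (b : Bool) (n i : ℕ) : ℕ :=
  if b = true then if i < n then if i + 1 = n then 0 else i + 1 else i
  else if i < n then if i = 0 then n - 1 else i - 1 else i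

/-- The action of a letter on a signed position. -/
def letterAct (z : ℕ × ℕ) (l : Fin 4 × Bool) (p : ℕ × Bool) : ℕ × Bool :=
  if l.1 = 0 then (cycleIndex l.2 z.1 p.1, p.2)
  else if l.1 = 1 then (p.1, if p.1 = 0 then !p.2 else p.2)
  else if l.1 = 2 then (swapIndex z.1 z.2 (cycleIndex l.2 z.1 (swapIndex z.1 z.2 p.1)), p.2)
  else (p.1, if p.1 = swapIndex z.1 z.2 0 then !p.2 else p.2)

theorem letterAct_eq (z : ℕ × ℕ) (l : Fin 4 × Bool) (p : ℕ × Bool) :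
    letterAct z l p = wordValue (testPerm z.1 z.2) [l] p := by
  obtain ⟨t, b⟩ := l
  fin_cases t <;> cases b <;> rfl

theorem foldr_letterAct (z : ℕ × ℕ) (w : Word (Fin 4)) (p : ℕ × Bool) :
    w.foldr (letterAct z) p = wordValue (testPerm z.1 z.2) w p := by
  induction w with
  | nil => rfl
  | cons l w ih =>
    rw [← List.singleton_append, wordValue_append, Equiv.Perm.mul_apply, ← ih, ← letterAct_eq]
    rfl

/-- The test permutations fix all positions above `n`, so finitely many points decide. -/
theorem wordValue_testPerm_eq_one_iff {z : ℕ × ℕ} (hz : z.2 ≤ z.1) (w : Word (Fin 4)) :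
    wordValue (testPerm z.1 z.2) w = 1 ↔ ∀ i ∈ List.range (z.1 + 1),
      w.foldr (letterAct z) (i, true) = (i, true) ∧
        w.foldr (letterAct z) (i, false) = (i, false) := by
  simp only [foldr_letterAct]
  constructor
  · intro h i _
    rw [h]
    exact ⟨rfl, rfl⟩
  · intro h
    ext1 p
    by_cases hp : p.1 ≤ z.1
    · obtain ⟨i, b⟩ := p
      have h1 := h i (List.mem_range.2 (Nat.lt_succ_of_le hp))
      cases b
      · exact h1.2
      · exact h1.1
    · exact wordValue_mem (H := boundedPerms z.1) (testPerm_mem_boundedPerms hz) w p hp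

theorem primrec_swapIndex : Primrec fun x : (ℕ × ℕ) × ℕ => swapIndex x.1.1 x.1.2 x.2 := by
  have hn : Primrec fun x : (ℕ × ℕ) × ℕ => x.1.1 := Primrec.fst.comp Primrec.fst
  have hr : Primrec fun x : (ℕ × ℕ) × ℕ => x.1.2 := Primrec.snd.comp Primrec.fst
  have hi : Primrec fun x : (ℕ × ℕ) × ℕ => x.2 := Primrec.snd
  exact Primrec.ite (Primrec.eq.comp hi hr) hn (Primrec.ite (Primrec.eq.comp hi hn) hr hi)

theorem primrec_cycleIndex : Primrec fun x : Bool × ℕ × ℕ => cycleIndex x.1 x.2.1 x.2.2 := by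
  have hb : Primrec fun x : Bool × ℕ × ℕ => x.1 := Primrec.fst
  have hn : Primrec fun x : Bool × ℕ × ℕ => x.2.1 := Primrec.fst.comp Primrec.snd
  have hi : Primrec fun x : Bool × ℕ × ℕ => x.2.2 := Primrec.snd.comp Primrec.snd
  have hlt : PrimrecPred fun x : Bool × ℕ × ℕ => x.2.2 < x.2.1 := Primrec.nat_lt.comp hi hn
  have hs : Primrec fun x : Bool × ℕ × ℕ => x.2.2 + 1 := Primrec.succ.comp hi
  exact Primrec.ite (Primrec.eq.comp hb (Primrec.const true))
    (Primrec.ite hlt (Primrec.ite (Primrec.eq.comp hs hn) (Primrec.const 0) hs) hi)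
    (Primrec.ite hlt (Primrec.ite (Primrec.eq.comp hi (Primrec.const 0))
      (Primrec.nat_sub.comp hn (Primrec.const 1)) (Primrec.nat_sub.comp hi (Primrec.const 1))) hi)

theorem primrec_letterAct :
    Primrec fun x : (ℕ × ℕ) × (Fin 4 × Bool) × ℕ × Bool => letterAct x.1 x.2.1 x.2.2 := by
  have ht : Primrec fun x : (ℕ × ℕ) × (Fin 4 × Bool) × ℕ × Bool => x.2.1.1 :=
    Primrec.fst.comp (Primrec.fst.comp Primrec.snd)
  have hb : Primrec fun x : (ℕ × ℕ) × (Fin 4 × Bool) × ℕ × Bool => x.2.1.2 :=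
    Primrec.snd.comp (Primrec.fst.comp Primrec.snd)
  have hi : Primrec fun x : (ℕ × ℕ) × (Fin 4 × Bool) × ℕ × Bool => x.2.2.1 :=
    Primrec.fst.comp (Primrec.snd.comp Primrec.snd)
  have hs : Primrec fun x : (ℕ × ℕ) × (Fin 4 × Bool) × ℕ × Bool => x.2.2.2 :=
    Primrec.snd.comp (Primrec.snd.comp Primrec.snd)
  have hn : Primrec fun x : (ℕ × ℕ) × (Fin 4 × Bool) × ℕ × Bool => x.1.1 :=
    Primrec.fst.comp Primrec.fst
  have hns : Primrec fun x : (ℕ × ℕ) × (Fin 4 × Bool) × ℕ × Bool => !x.2.2.2 :=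
    Primrec.not.comp hs
  have h0 : Primrec fun x : (ℕ × ℕ) × (Fin 4 × Bool) × ℕ × Bool =>
      cycleIndex x.2.1.2 x.1.1 x.2.2.1 :=
    (primrec_cycleIndex.comp (Primrec.pair hb (Primrec.pair hn hi))).of_eq fun _ => rfl
  have hw : Primrec fun x : (ℕ × ℕ) × (Fin 4 × Bool) × ℕ × Bool =>
      swapIndex x.1.1 x.1.2 x.2.2.1 :=
    (primrec_swapIndex.comp (Primrec.pair Primrec.fst hi)).of_eq fun _ => rfl
  have h2 : Primrec fun x : (ℕ × ℕ) × (Fin 4 × Bool) × ℕ × Bool =>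
      cycleIndex x.2.1.2 x.1.1 (swapIndex x.1.1 x.1.2 x.2.2.1) :=
    (primrec_cycleIndex.comp (Primrec.pair hb (Primrec.pair hn hw))).of_eq fun _ => rfl
  have h2' : Primrec fun x : (ℕ × ℕ) × (Fin 4 × Bool) × ℕ × Bool =>
      swapIndex x.1.1 x.1.2 (cycleIndex x.2.1.2 x.1.1 (swapIndex x.1.1 x.1.2 x.2.2.1)) :=
    (primrec_swapIndex.comp (Primrec.pair Primrec.fst h2)).of_eq fun _ => rfl
  have h3 : Primrec fun x : (ℕ × ℕ) × (Fin 4 × Bool) × ℕ × Bool => swapIndex x.1.1 x.1.2 0 :=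
    (primrec_swapIndex.comp (Primrec.pair Primrec.fst (Primrec.const 0))).of_eq fun _ => rfl
  have hp3 : Primrec fun x : (ℕ × ℕ) × (Fin 4 × Bool) × ℕ × Bool =>
      (x.2.2.1, if x.2.2.1 = swapIndex x.1.1 x.1.2 0 then !x.2.2.2 else x.2.2.2) :=
    Primrec.pair hi (Primrec.ite (Primrec.eq.comp hi h3) hns hs)
  have hp1 : Primrec fun x : (ℕ × ℕ) × (Fin 4 × Bool) × ℕ × Bool =>
      (x.2.2.1, if x.2.2.1 = 0 then !x.2.2.2 else x.2.2.2) :=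
    Primrec.pair hi (Primrec.ite (Primrec.eq.comp hi (Primrec.const 0)) hns hs)
  have hc : ∀ t : Fin 4, PrimrecPred fun x : (ℕ × ℕ) × (Fin 4 × Bool) × ℕ × Bool =>
      x.2.1.1 = t := fun t => Primrec.eq.comp ht (Primrec.const t)
  have h := Primrec.ite (hc 0) (Primrec.pair h0 hs)
    (Primrec.ite (hc 1) hp1 (Primrec.ite (hc 2) (Primrec.pair h2' hs) hp3))
  exact h.of_eq fun _ => rfl

theorem primrec_foldr_letterAct : Primrec fun x : ((ℕ × ℕ) × Word (Fin 4)) × ℕ × Bool =>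
    x.1.2.foldr (letterAct x.1.1) x.2 :=
  Primrec.list_foldr (Primrec.snd.comp Primrec.fst) Primrec.snd
    (primrec_letterAct.comp (Primrec.pair (Primrec.fst.comp (Primrec.fst.comp Primrec.fst))
      Primrec.snd)).to₂

/-- The words that act trivially on the signed positions up to `n`. -/
def IsTestRelator (w : Word (Fin 4)) (z : ℕ × ℕ) : Prop :=
  ∀ i ∈ List.range (z.1 + 1), w.foldr (letterAct z) (i, true) = (i, true) ∧
    w.foldr (letterAct z) (i, false) = (i, false)

theorem primrec_isTestRelator : PrimrecRel IsTestRelator := by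
  have h : ∀ b : Bool, Primrec fun y : ℕ × Word (Fin 4) × ℕ × ℕ =>
      y.2.1.foldr (letterAct y.2.2) (y.1, b) := fun b =>
    primrec_foldr_letterAct.comp (Primrec.pair
      (Primrec.pair (Primrec.snd.comp Primrec.snd) (Primrec.fst.comp Primrec.snd))
      (Primrec.pair Primrec.fst (Primrec.const b)))
  have hr : ∀ b : Bool, PrimrecPred fun y : ℕ × Word (Fin 4) × ℕ × ℕ =>
      y.2.1.foldr (letterAct y.2.2) (y.1, b) = (y.1, b) := fun b =>
    Primrec.eq.comp (h b) (Primrec.pair Primrec.fst (Primrec.const b))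
  have h1 : PrimrecRel fun (i : ℕ) (y : Word (Fin 4) × ℕ × ℕ) =>
      y.1.foldr (letterAct y.2) (i, true) = (i, true) ∧
        y.1.foldr (letterAct y.2) (i, false) = (i, false) := (hr true).and (hr false)
  have h2 : Primrec fun y : Word (Fin 4) × ℕ × ℕ => List.range (y.2.1 + 1) :=
    Primrec.list_range.comp (Primrec.succ.comp (Primrec.fst.comp Primrec.snd))
  exact (PrimrecRel.forall_mem_list h1).comp h2 Primrec.id

/-- The words with at most `C` letters. -/
noncomputable def shortWords {α : Type*} [Fintype α] (C : ℕ) : List (Word α) :=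
  C.rec [[]] fun _ L => [] ::
    (Finset.univ : Finset (α × Bool)).toList.flatMap fun l => L.map fun w => l :: w

theorem mem_shortWords {α : Type*} [Fintype α] {C : ℕ} {w : Word α} :
    w ∈ shortWords C ↔ w.length ≤ C := by
  induction C generalizing w with
  | zero => simp [shortWords]
  | succ C ih =>
    change w ∈ [] :: ((Finset.univ : Finset (α × Bool)).toList.flatMap fun l =>
      (shortWords C).map fun w => l :: w) ↔ _
    cases w with
    | nil => simp
    | cons l w => simp [ih]

/-- The list of all letters is chosen noncomputably, but it is one fixed finite list and enters as a
constant. -/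
theorem primrec_shortWords {α : Type*} [Fintype α] [Primcodable α] :
    Primrec (shortWords : ℕ → List (Word α)) := by
  have h1 : Primrec fun y : List (Word α) × (α × Bool) => y.1.map fun w => y.2 :: w :=
    Primrec.list_map Primrec.fst
      (Primrec.list_cons.comp (Primrec.snd.comp Primrec.fst) Primrec.snd).to₂
  have h2 : Primrec fun L : List (Word α) =>
      (Finset.univ : Finset (α × Bool)).toList.flatMap fun l => L.map fun w => l :: w :=
    Primrec.list_flatMap (Primrec.const _) h1.to₂
  have h3 : Primrec₂ fun (_ : ℕ) (L : List (Word α)) => ([] : Word α) ::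
      (Finset.univ : Finset (α × Bool)).toList.flatMap fun l => L.map fun w => l :: w :=
    (Primrec.list_cons.comp (Primrec.const []) (h2.comp Primrec.snd)).to₂
  exact Primrec.nat_rec₁ _ h3

theorem primrec_factorial : Primrec Nat.factorial := by
  have h : Primrec₂ fun (n x : ℕ) => (n + 1) * x :=
    (Primrec.nat_mul.comp (Primrec.succ.comp Primrec.fst) Primrec.snd).to₂
  refine (Primrec.nat_rec₁ 1 h).of_eq fun n => ?_
  induction n with
  | zero => rfl
  | succ n ih => rw [Nat.factorial_succ, ← ih]

open Classical in
/-- The relators of a finite presentation of the group that is generated by the permutations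
`testPerm`. -/
noncomputable def testRelators (z : ℕ × ℕ) : List (Word (Fin 4)) :=
  (shortWords ((z.1 + 1) * 2).factorial).filter fun w => IsTestRelator w z

theorem mem_testRelators {z : ℕ × ℕ} (hz : z.2 ≤ z.1) {w : Word (Fin 4)} : w ∈ testRelators z ↔
    w.length ≤ ((z.1 + 1) * 2).factorial ∧ wordValue (testPerm z.1 z.2) w = 1 := by
  classical
  exact List.mem_filter.trans (and_congr mem_shortWords
    (decide_eq_true_iff.trans (wordValue_testPerm_eq_one_iff hz w).symm))

theorem primrec_testRelators : Primrec testRelators := by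
  let _ : DecidableRel IsTestRelator := fun _ _ => Classical.propDecidable _
  have h : Primrec fun z : ℕ × ℕ => (shortWords ((z.1 + 1) * 2).factorial : List (Word (Fin 4))) :=
    primrec_shortWords.comp (primrec_factorial.comp (Primrec.nat_mul.comp
      (Primrec.succ.comp Primrec.fst) (Primrec.const 2)))
  exact (primrec_isTestRelator.listFilter.comp h Primrec.id).of_eq fun _ => rfl

theorem primrec_rawWord {k : ℕ} : Primrec (rawWord : Word (Fin k) → Word ℕ) :=
  Primrec.list_map Primrec.id (Primrec.pair
    (Primrec.fin_val.comp (Primrec.fst.comp Primrec.snd)) (Primrec.snd.comp Primrec.snd)).to₂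

theorem finite_testGroup {z : ℕ × ℕ} (hz : z.2 ≤ z.1) :
    Finite (FinPresGroup 4 (testRelators z)) :=
  finite_finPresGroup (testPerm_mem_boundedPerms hz) (card_boundedPerms z.1).le
    fun _ h1 h2 => (mem_testRelators hz).2 ⟨h1, h2⟩

end TestRelators

/-! ### From computable finite quotients to computable residues -/

section Residues

variable {A : Set ℤ}

/-- A residue does not occur if and only if the words for the generators extend to a morphism into
a finite group that is given by a presentation. -/
theorem notMem_residues_iff {m : ℕ} {S : Fin m → DysonGroup A} {f : Fin m → Word (Fin 4)}
    (hf : ∀ s, wordValue (dysonGen A) (f s) = S s) {W : Fin 4 → Word (Fin m)}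
    (hW : ∀ t, wordValue S (W t) = dysonGen A t) {n r : ℕ} (hr : r < n) :
    r ∉ residues A n ↔
      (∀ t, wordValue (testPerm n r) (substWord f (W t)) = testPerm n r t) ∧
        ExtendsToHom S fun s => FinPresGroup.ofWord (testRelators (n, r)) (f s) := by
  obtain ⟨π, hπ, hπw⟩ := exists_injective_hom (testPerm_mem_boundedPerms hr.le)
    (card_boundedPerms n).le fun w => mem_testRelators (z := (n, r)) hr.le
  have hπ1 : ∀ t, π (FinPresGroup.ofWord (testRelators (n, r)) [(t, true)]) = testPerm n r t :=
    fun t => (hπw _).trans (wordValue_singleton _ t)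
  -- The first condition is needed because `S` is arbitrary. A morphism that extends the words `f`
  -- sends the `t`-th standard generator to `W t` rewritten by `f`, and this need not equal the
  -- `t`-th letter in the test group.
  rw [← dysonRel_testPerm_iff A hr]
  constructor
  · intro h
    constructor
    · intro t
      obtain ⟨φ, hφ⟩ := exists_dyson_hom h
      have h1 : wordValue (dysonGen A) (substWord f (W t)) = dysonGen A t := by
        rw [wordValue_substWord, ← hW t]
        exact congrArg (fun T => wordValue T (W t)) (funext hf)
      have h2 := congrArg φ h1
      rw [map_wordValue, hφ, funext hφ] at h2
      exact h2
    · have h1 : DysonRel A fun t => FinPresGroup.ofWord (testRelators (n, r)) [(t, true)] :=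
        DysonRel.of_injective hπ (by simpa only [hπ1] using h)
      obtain ⟨φ, hφ⟩ := exists_dyson_hom h1
      refine ⟨φ, fun s => ?_⟩
      rw [← hf, map_wordValue, funext hφ, wordValue_letters]
  · rintro ⟨h1, φ, hφ⟩
    refine extendsToHom_dysonGen_iff.1 ⟨π.comp φ, fun t => ?_⟩
    have h2 : (fun s => (π.comp φ) (S s)) = fun s => wordValue (testPerm n r) (f s) := by
      funext s
      rw [MonoidHom.comp_apply, hφ, hπw]
    rw [← hW, map_wordValue, h2, ← wordValue_substWord, h1]

theorem residues_sort_eq_filter (n : ℕ) {d : ℕ → Bool}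
    (hd : ∀ r < n, (d r = true ↔ r ∉ residues A n)) :
    (residues A n).sort (· ≤ ·) = (List.range n).filter fun r => !d r := by
  refine List.Perm.eq_of_pairwise (le := (· ≤ ·)) (fun a b _ _ h1 h2 => le_antisymm h1 h2)
    (Finset.pairwise_sort _ _) (List.pairwise_le_range.filter _) ?_
  refine (List.perm_ext_iff_of_nodup (Finset.sort_nodup _ _) (List.nodup_range.filter _)).2
    fun r => ?_
  rw [Finset.mem_sort, List.mem_filter, List.mem_range]
  constructor
  · intro h
    have hr : r < n := by
      simp only [residues, Finset.mem_filter, Finset.mem_range] at h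
      exact h.1
    refine ⟨hr, ?_⟩
    simpa [h] using hd r hr
  · rintro ⟨hr, h⟩
    by_contra hn
    simp [(hd r hr).2 hn] at h

theorem computable_filter_range {d : ℕ × ℕ → Bool} (hd : Computable d) :
    Computable fun n : ℕ => (List.range n).filter fun r => !d (n, r) := by
  have hk : Computable fun x : ℕ × ℕ × List ℕ => d (x.1, x.2.1) :=
    hd.comp (Computable.pair Computable.fst (Computable.fst.comp Computable.snd))
  have hL : Computable fun x : ℕ × ℕ × List ℕ => x.2.2 := Computable.snd.comp Computable.snd
  have hL' : Computable fun x : ℕ × ℕ × List ℕ => x.2.2 ++ [x.2.1] :=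
    Computable.list_append.comp hL (Computable.list_cons.comp
      (Computable.fst.comp Computable.snd) (Computable.const []))
  have h := Computable.nat_rec (f := fun n : ℕ => n) (g := fun _ : ℕ => ([] : List ℕ))
    (h := fun (n : ℕ) (x : ℕ × List ℕ) => bif d (n, x.1) then x.2 else x.2 ++ [x.1])
    Computable.id (Computable.const []) (Computable.cond hk hL hL').to₂
  refine h.of_eq fun n => ?_
  have hrec : ∀ j : ℕ, (Nat.rec ([] : List ℕ)
      (fun y L => bif d (n, y) then L else L ++ [y]) j : List ℕ) =
        (List.range j).filter fun r => !d (n, r) := by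
    intro j
    induction j with
    | zero => rfl
    | succ j ih =>
      rw [List.range_succ, List.filter_append, ← ih]
      cases hj : d (n, j) <;> simp [hj]
  exact hrec n

/-- For each residue the algorithm is run on the presentation of the test group. Its answer,
together with a finite check on permutations, tells whether the residue occurs. -/
theorem computable_of_hasCFQ (h : HasCFQ (DysonGroup A)) :
    Computable fun n : ℕ => (residues A n).sort (· ≤ ·) := by
  classical
  obtain ⟨m, S, hS, alg, halg, hq⟩ := h
  choose f hf using fun s => exists_wordValue_eq _ (generates_dysonGen (A := A)) (S s)
  choose W hW using fun t => exists_wordValue_eq S hS (dysonGen A t)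
  -- Capping `r` at `n` makes every input a presentation of a finite group, so the algorithm halts
  -- on all pairs and defines a total function. For `r < n` nothing changes.
  have hmin : Primrec fun x : ℕ × ℕ => (x.1, min x.2 x.1) :=
    Primrec.pair Primrec.fst (Primrec.nat_min.comp Primrec.snd Primrec.fst)
  have hin : Primrec fun x : ℕ × ℕ => ((4, (testRelators (x.1, min x.2 x.1)).map rawWord,
      (List.ofFn f).map rawWord) : ℕ × List (Word ℕ) × List (Word ℕ)) :=
    Primrec.pair (Primrec.const 4) (Primrec.pair
      (Primrec.list_map (primrec_testRelators.comp hmin) (primrec_rawWord.comp Primrec.snd).to₂)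
      (Primrec.const _))
  choose q hqm hqt using fun x : ℕ × ℕ => hq 4 (testRelators (x.1, min x.2 x.1)) f
    (finite_testGroup (min_le_right _ _))
  have hqc : Computable q := Partrec.of_eq_tot (halg.comp hin.to_comp) hqm
  -- Each word compares a standard generator, rewritten through `S` and back, with the letter
  -- itself; all of them must act trivially.
  let T : List (Word (Fin 4)) := List.ofFn fun t => substWord f (W t) ++ [(t, false)]
  have hT : PrimrecPred fun x : ℕ × ℕ => ∀ w ∈ T, IsTestRelator w (x.1, min x.2 x.1) :=
    (PrimrecRel.forall_mem_list primrec_isTestRelator).comp (Primrec.const T) hmin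
  have hd : Computable fun x : ℕ × ℕ =>
      (decide (∀ w ∈ T, IsTestRelator w (x.1, min x.2 x.1)) && q x) :=
    Primrec.and.to_comp.comp hT.decide.to_comp hqc
  refine (computable_filter_range hd).of_eq fun n => (residues_sort_eq_filter n fun r hr => ?_).symm
  have hmin_eq : ∀ s, s = r → (ExtendsToHom S (fun i =>
      FinPresGroup.ofWord (testRelators (n, s)) (f i)) ↔ ExtendsToHom S fun i =>
        FinPresGroup.ofWord (testRelators (n, r)) (f i)) := by
    rintro _ rfl
    rfl
  rw [notMem_residues_iff hf hW hr, Bool.and_eq_true, decide_eq_true_iff, hqt,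
    hmin_eq _ (min_eq_left hr.le)]
  simp only [min_eq_left hr.le]
  refine and_congr_left fun _ => ?_
  simp only [T, List.forall_mem_ofFn_iff]
  refine forall_congr' fun t => (wordValue_testPerm_eq_one_iff (z := (n, r)) hr.le _).symm.trans ?_
  have h1 : wordValue (testPerm n r) [(t, false)] = (testPerm n r t)⁻¹ := by
    simp [wordValue]
  rw [wordValue_append, h1, mul_inv_eq_one]

end Residues

end Dyson

theorem mainTheorem3 (A : Set ℤ) :
    ((Dyson.IsRecursivelyPresented (Dyson.DysonGroup A) ↔ REPred (fun z : ℤ => z ∈ A)) ∧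
      (Dyson.IsCoRE (Dyson.DysonGroup A) ↔ REPred (fun z : ℤ => z ∉ A)) ∧
      (Dyson.HasSolvableWordProblem (Dyson.DysonGroup A) ↔ ComputablePred (fun z : ℤ => z ∈ A))) ∧
    ((Group.ResiduallyFinite (Dyson.DysonGroup A) ↔ @IsClosed ℤ Dyson.profiniteTopology A) ∧
      ∃ e : Dyson.FinitaryImage (Dyson.DysonGroup A) ≃*
          Dyson.DysonGroup (Dyson.profiniteClosure A),
        ∀ (c : Fin 2) (x : Dyson.Lamplighter),
          e (QuotientGroup.mk (Dyson.DysonGroup.incl A c x)) =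
            Dyson.DysonGroup.incl (Dyson.profiniteClosure A) c x) ∧
    (Dyson.HasCFQ (Dyson.DysonGroup A) ↔
      Computable fun n : ℕ => (Dyson.residues A n).sort (· ≤ ·)) :=
  ⟨⟨Dyson.isRecursivelyPresented_iff A, Dyson.isCoRE_iff A, Dyson.hasSolvableWordProblem_iff A⟩,
    ⟨Dyson.residuallyFinite_dysonGroup_iff A, Dyson.exists_finitaryImage_equiv A⟩,
    ⟨Dyson.computable_of_hasCFQ, Dyson.hasCFQ_of_computable⟩⟩
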